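/- All varieties are reduced complex varieties. For integers $m\ge 1$, $N\ge 0$ and $0\le k\le mN$ let $A_N=\mathbb C[t]/(t^N)$ and let $X^{(N)}_{k,m}$ be the quiver Grassmannian of all $A_N$-submodules $U\subset \mathbb C^m\otimes A_N$ with $\dim_{\mathbb C}U=k$ (that is, of all $t$-invariant subspaces of dimension $k$), a closed subvariety of the Grassmannian of $k$-dimensional subspaces of $\mathbb C^m\otimes A_N$. Let $I\subset SL_m(\mathbb C[t,t^{-1}])$ be the Iwahori subgroup of the matrices with entries in $\mathbb C[t]$ that are upper triangular modulo $t$. For $0\le b<m$ let $P_b\supset I$ be the maximal parahoric subgroup corresponding to the $b$-th affine simple root, that is, the stabilizer in $SL_m(\mathbb C[t,t^{-1}])$ of the lattice $L_b$ spanned by $\mathbb C^m\otimes\mathbb C[t]$ and $w_1\otimes t^{-1},\dots,w_b\otimes t^{-1}$, where $w_1,\dots,w_m$ is the standard basis of $\mathbb C^m$. The affine flag variety $SL_m(\mathbb C[t,t^{-1}])/P_b$ is an ind-variety through the embedding $gP_b\mapsto gL_b$ into the Sato Grassmannian. A Schubert variety in it is the closure of the $I$-orbit of a point fixed by the Cartan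 torus (the diagonal matrices in $SL_m(\mathbb C)$ and the loop rotations $t\mapsto ct$, $c\in\mathbb C^\times$). Then $X^{(N)}_{k,m}$ is isomorphic, as a variety, to a Schubert variety in $SL_m(\mathbb C[t,t^{-1}])/P_{k \bmod m}$. In particular, for $n\ge 1$ and $N\ge 0$ let $\mathrm{Gr}^a_N(\mathfrak{gl}_n)$ be the variety of the subspaces $U\subset\mathbb C^n\otimes\mathbb C[t,t^{-1}]$ with $\mathbb C^n\otimes t^N\mathbb C[t]\subset U\subset \mathbb C^n\otimes t^{-N}\mathbb C[t]$ which belong to the Sato Grassmannian $\mathrm{SGr}_0$ (that is, for some $r\geq 0$ the space $U$ contains $\mathbb C^n\otimes t^r\mathbb C[t]$ with codimension $nr$) and satisfy $pr(tU)\subset U$, where $pr$ is the projection along $\mathbb C^n\otimes 1$ onto the span of the $\mathbb C^n\otimes t^l$, $l\neq 0$. Then $\mathrm{Gr}^a_N(\mathfrak{gl}_n)$ is isomorphic to a Schubert variety in $SL_{2n}(\mathbb C[t,t^{-1}])/P_{Nn \bmod 2n}$. -/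

import Mathlib

open scoped LaurentPolynomial Polynomial Topology

namespace AffineSchubert

noncomputable section

/-! ## Spaces with functions

Complex varieties are treated in the classical way, as topological spaces with a sheaf of
`ℂ`-valued regular functions. -/

/-- A topology on `X` together with a sheaf of `ℂ`-algebras of `ℂ`-valued functions on `X`.
A function on an open set `O` is represented by any total function extending it;
`regular O` is the set of total functions whose restriction to `O` is regular. -/
structure SpaceWithFunctions (X : Type*) where
  top : TopologicalSpace X
  regular : Set X → Set (X → ℂ)
  /-- restriction to smaller open sets -/
  restrict : ∀ {O O' : Set X} {f : X → ℂ}, IsOpen[top] O → IsOpen[top] O' → O' ⊆ O →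
    f ∈ regular O → f ∈ regular O'
  /-- being regular is local, and depends only on the values on the open set -/
  glue : ∀ {O : Set X} {f : X → ℂ}, IsOpen[top] O →
    (∀ x ∈ O, ∃ O' ⊆ O, IsOpen[top] O' ∧ x ∈ O' ∧ ∃ g ∈ regular O', Set.EqOn f g O') →
    f ∈ regular O
  const : ∀ {O : Set X} (c : ℂ), IsOpen[top] O → (fun _ => c) ∈ regular O
  add : ∀ {O : Set X} {f g : X → ℂ}, IsOpen[top] O → f ∈ regular O → g ∈ regular O →
    (fun x => f x + g x) ∈ regular O
  mul : ∀ {O : Set X} {f g : X → ℂ}, IsOpen[top] O → f ∈ regular O → g ∈ regular O →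
    (fun x => f x * g x) ∈ regular O

/-- An isomorphism of spaces with functions: a bijection which identifies the open sets and the
regular functions on them. -/
structure SpaceIso {X Y : Type*} (S : SpaceWithFunctions X) (S' : SpaceWithFunctions Y) where
  toEquiv : X ≃ Y
  isOpen_iff : ∀ O : Set Y, IsOpen[S'.top] O ↔ IsOpen[S.top] (toEquiv ⁻¹' O)
  regular_iff : ∀ (O : Set Y) (f : Y → ℂ), IsOpen[S'.top] O →
    (f ∈ S'.regular O ↔ f ∘ toEquiv ∈ S.regular (toEquiv ⁻¹' O))

/-- The structure induced on `Y` by a map `i : Y → X` (used for injective `i`): the induced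
topology, and the functions which locally are restrictions of regular functions on `X`. For a
closed subset of a variety this is its structure of closed (reduced) subvariety. -/
def SpaceWithFunctions.induced {X Y : Type*} (S : SpaceWithFunctions X) (i : Y → X) :
    SpaceWithFunctions Y where
  top := S.top.induced i
  regular O := {f | ∀ y ∈ O, ∃ O' : Set X, IsOpen[S.top] O' ∧ i y ∈ O' ∧
    ∃ g ∈ S.regular O', ∀ z ∈ O, i z ∈ O' → f z = g (i z)}
  restrict := by
    intro O O' f _ _ hsub hf y hy
    obtain ⟨A, hA, hyA, g, hg, h⟩ := hf y (hsub hy)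
    exact ⟨A, hA, hyA, g, hg, fun z hz hzA => h z (hsub hz) hzA⟩
  glue := by
    intro O f _ h y hy
    obtain ⟨O', hsub, ⟨B, hB, rfl⟩, hyO', g, hg, hfg⟩ := h y hy
    obtain ⟨A, hA, hyA, g', hg', h'⟩ := hg y hyO'
    refine ⟨A ∩ B, S.top.isOpen_inter _ _ hA hB, ⟨hyA, hyO'⟩, g',
      S.restrict hA (S.top.isOpen_inter _ _ hA hB) Set.inter_subset_left hg', ?_⟩
    intro z _ hzA
    rw [hfg hzA.2, h' z hzA.2 hzA.1]
  const := fun c _ y _ => ⟨Set.univ, @isOpen_univ _ S.top, trivial, fun _ => c,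
    S.const c (@isOpen_univ _ S.top), fun _ _ _ => rfl⟩
  add := by
    intro O f g _ hf hg y hy
    obtain ⟨A, hA, hyA, f', hf', h1⟩ := hf y hy
    obtain ⟨B, hB, hyB, g', hg', h2⟩ := hg y hy
    have hAB := S.top.isOpen_inter _ _ hA hB
    refine ⟨A ∩ B, hAB, ⟨hyA, hyB⟩, _, S.add hAB
      (S.restrict hA hAB Set.inter_subset_left hf')
      (S.restrict hB hAB Set.inter_subset_right hg'), ?_⟩
    intro z hz hzA
    simp only [h1 z hz hzA.1, h2 z hz hzA.2]
  mul := by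
    intro O f g _ hf hg y hy
    obtain ⟨A, hA, hyA, f', hf', h1⟩ := hf y hy
    obtain ⟨B, hB, hyB, g', hg', h2⟩ := hg y hy
    have hAB := S.top.isOpen_inter _ _ hA hB
    refine ⟨A ∩ B, hAB, ⟨hyA, hyB⟩, _, S.mul hAB
      (S.restrict hA hAB Set.inter_subset_left hf')
      (S.restrict hB hAB Set.inter_subset_right hg'), ?_⟩
    intro z hz hzA
    simp only [h1 z hz hzA.1, h2 z hz hzA.2]

/-- The inductive limit structure on `Y`, for an exhaustion of `Y` by subsets `Q 0 ⊆ Q 1 ⊆ …`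
which carry structures: a set is open if its trace on every `Q n` is open, and a function is
regular if its restriction to every `Q n` is. -/
def SpaceWithFunctions.indLimit {Y : Type*} (Q : ℕ → Set Y)
    (S : ∀ n, SpaceWithFunctions (Q n)) : SpaceWithFunctions Y where
  top := ⨆ n, (S n).top.coinduced (Subtype.val : Q n → Y)
  regular O := {f | ∀ n, f ∘ (Subtype.val : Q n → Y) ∈ (S n).regular (Subtype.val ⁻¹' O)}
  restrict := by
    intro O O' f hO hO' hsub hf n
    rw [isOpen_iSup_iff] at hO hO'
    exact (S n).restrict (hO n) (hO' n) (Set.preimage_mono hsub) (hf n)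
  glue := by
    intro O f hO h n
    rw [isOpen_iSup_iff] at hO
    refine (S n).glue (hO n) fun x hx => ?_
    obtain ⟨O', hsub, hO', hxO', g, hg, hfg⟩ := h x.1 hx
    rw [isOpen_iSup_iff] at hO'
    exact ⟨Subtype.val ⁻¹' O', Set.preimage_mono hsub, hO' n, hxO', _, hg n,
      fun z hz => hfg hz⟩
  const := by
    intro O c hO n
    rw [isOpen_iSup_iff] at hO
    exact (S n).const c (hO n)
  add := by
    intro O f g hO hf hg n
    rw [isOpen_iSup_iff] at hO
    exact (S n).add (hO n) (hf n) (hg n)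
  mul := by
    intro O f g hO hf hg n
    rw [isOpen_iSup_iff] at hO
    exact (S n).mul (hO n) (hf n) (hg n)

/-! ## Grassmannians -/

section Grassmannian

variable {M : Type*} [AddCommGroup M] [Module ℂ M]

/-- `v` is a basis (frame) of the `k`-dimensional subspace `U`. -/
def IsFrame (k : ℕ) (U : Submodule ℂ M) (v : Fin k → M) : Prop :=
  LinearIndependent ℂ v ∧ Submodule.span ℂ (Set.range v) = U

/-- Polynomials in the Plücker coordinates on `k`-dimensional subspaces of `M`: there is one
variable for every linear form on `Λᵏ M`, that is, for every alternating `k`-form on `M`. -/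
abbrev PluckerPoly (M : Type*) [AddCommGroup M] [Module ℂ M] (k : ℕ) : Type _ :=
  MvPolynomial (M [⋀^Fin k]→ₗ[ℂ] ℂ) ℂ

/-- The value of a polynomial in the Plücker coordinates at the decomposable vector
`v₁ ∧ ⋯ ∧ vₖ`. -/
def evalAt {k : ℕ} (v : Fin k → M) (F : PluckerPoly M k) : ℂ :=
  MvPolynomial.eval (fun φ : M [⋀^Fin k]→ₗ[ℂ] ℂ => φ v) F

/-- Two frames of the same subspace have proportional Plücker coordinates. -/
theorem IsFrame.proportional {k : ℕ} {U : Submodule ℂ M} {v w : Fin k → M}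
    (hv : IsFrame k U v) (hw : IsFrame k U w) :
    ∃ c : ℂ, c ≠ 0 ∧ ∀ (d : ℕ) (F : PluckerPoly M k), F.IsHomogeneous d →
      evalAt w F = c ^ d * evalAt v F := by
  obtain ⟨hv1, rfl⟩ := hv
  obtain ⟨hw1, hw2⟩ := hw
  let b := Module.Basis.span hv1
  have hwm : ∀ i, w i ∈ Submodule.span ℂ (Set.range v) := fun i =>
    hw2 ▸ Submodule.subset_span ⟨i, rfl⟩
  let w' : Fin k → Submodule.span ℂ (Set.range v) := fun i => ⟨w i, hwm i⟩
  have key : ∀ φ : M [⋀^Fin k]→ₗ[ℂ] ℂ, φ w = b.det w' * φ v := by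
    intro φ
    have h := (φ.compLinearMap (Submodule.span ℂ (Set.range v)).subtype).eq_smul_basis_det b
    have h1 := congrArg (fun ψ => ψ w') h
    have h2 : (fun i => ((b i : Submodule.span ℂ (Set.range v)) : M)) = v := by
      funext i
      exact congrArg Subtype.val (Module.Basis.span_apply hv1 i)
    simp only [AlternatingMap.smul_apply, AlternatingMap.compLinearMap_apply,
      Submodule.coe_subtype, smul_eq_mul] at h1
    rw [mul_comm]
    have h3 : φ (fun i => ((b i : Submodule.span ℂ (Set.range v)) : M)) = φ v := by rw [h2]
    rw [← h3]
    exact h1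
  refine ⟨b.det w', ?_, ?_⟩
  · have hli : LinearIndependent ℂ w' := by
      apply LinearIndependent.of_comp (Submodule.span ℂ (Set.range v)).subtype
      exact hw1
    have hsp : Submodule.span ℂ (Set.range w') = ⊤ := by
      apply Submodule.map_injective_of_injective
        (Submodule.injective_subtype (Submodule.span ℂ (Set.range v)))
      rw [Submodule.map_span, Submodule.map_top, Submodule.range_subtype, ← Set.range_comp]
      exact hw2
    exact ((b.is_basis_iff_det).1 ⟨hli, hsp⟩).ne_zero
  · intro d F hF
    unfold evalAt
    rw [MvPolynomial.eval_eq, MvPolynomial.eval_eq, Finset.mul_sum]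
    refine Finset.sum_congr rfl fun x hx => ?_
    have hd := hF.degree_eq_sum_deg_support hx
    simp only [key, mul_pow, Finset.prod_mul_distrib, Finset.prod_pow_eq_pow_sum]
    rw [hd]
    ring

/-- The basic open set `F ≠ 0` in the Grassmannian of `k`-dimensional subspaces. -/
def basicOpen {k : ℕ} (F : PluckerPoly M k) : Set (Submodule ℂ M) :=
  {U | ∃ v, IsFrame k U v ∧ evalAt v F ≠ 0}

/-- The Zariski topology of the Grassmannian of all finite-dimensional subspaces of `M`, which is
the disjoint union over `k` of the Grassmannians of `k`-dimensional subspaces. -/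
@[reducible]
def grassmannianTop (M : Type*) [AddCommGroup M] [Module ℂ M] :
    TopologicalSpace (Submodule ℂ M) :=
  TopologicalSpace.generateFrom
    {D | ∃ (k d : ℕ) (F : PluckerPoly M k), F.IsHomogeneous d ∧ D = basicOpen F}

/-- On `O` the function `f` is the quotient of the forms `F` and `G` of the same degree in the
Plücker coordinates of `k`-dimensional subspaces, and `G` vanishes nowhere on `O`. -/
def IsQuotientOn {k : ℕ} (F G : PluckerPoly M k) (O : Set (Submodule ℂ M))
    (f : Submodule ℂ M → ℂ) : Prop :=
  (∃ d : ℕ, F.IsHomogeneous d ∧ G.IsHomogeneous d) ∧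
    ∀ U ∈ O, ∃ v, IsFrame k U v ∧ evalAt v G ≠ 0 ∧ f U = evalAt v F / evalAt v G

theorem IsFrame.finrank_eq {k : ℕ} {U : Submodule ℂ M} {v : Fin k → M} (hv : IsFrame k U v) :
    Module.finrank ℂ U = k := by
  rw [← hv.2, finrank_span_eq_card hv.1, Fintype.card_fin]

/-- If both functions are quotients of forms near a point, then both are such quotients with
respect to common frames. -/
theorem IsQuotientOn.common {k l : ℕ} {F G : PluckerPoly M k} {F' G' : PluckerPoly M l}
    {O O' : Set (Submodule ℂ M)} {f g : Submodule ℂ M → ℂ} (h : IsQuotientOn F G O f)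
    (h' : IsQuotientOn F' G' O' g) {U : Submodule ℂ M} (hU : U ∈ O) (hU' : U ∈ O') :
    ∃ (F₁ G₁ : PluckerPoly M k) (d e : ℕ), F.IsHomogeneous d ∧ G.IsHomogeneous d ∧
      F₁.IsHomogeneous e ∧ G₁.IsHomogeneous e ∧ ∀ V ∈ O ∩ O', ∃ v, IsFrame k V v ∧
        evalAt v G ≠ 0 ∧ f V = evalAt v F / evalAt v G ∧
        evalAt v G₁ ≠ 0 ∧ g V = evalAt v F₁ / evalAt v G₁ := by
  obtain ⟨⟨d, hF, hG⟩, h⟩ := h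
  obtain ⟨⟨e, hF', hG'⟩, h'⟩ := h'
  obtain ⟨v, hv, _⟩ := h U hU
  obtain ⟨w, hw, _⟩ := h' U hU'
  obtain rfl : k = l := by rw [← hv.finrank_eq, hw.finrank_eq]
  refine ⟨F', G', d, e, hF, hG, hF', hG', fun V hV => ?_⟩
  obtain ⟨v, hv, hv1, hv2⟩ := h V hV.1
  obtain ⟨w, hw, hw1, hw2⟩ := h' V hV.2
  obtain ⟨c, hc, hcF⟩ := hw.proportional hv
  refine ⟨v, hv, hv1, hv2, ?_, ?_⟩
  · rw [hcF e G' hG']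
    exact mul_ne_zero (pow_ne_zero _ hc) hw1
  · rw [hcF e G' hG', hcF e F' hF', hw2, mul_div_mul_left _ _ (pow_ne_zero _ hc)]

/-- The Grassmannian of all subspaces of the finite-dimensional space `M` (the disjoint union of
the Grassmannians `Gr_k(M)`), as a disjoint union of projective varieties via the Plücker
embeddings: the regular functions are locally quotients of two forms of the same degree in the
Plücker coordinates. -/
def grassmannian (M : Type*) [AddCommGroup M] [Module ℂ M] [FiniteDimensional ℂ M] :
    SpaceWithFunctions (Submodule ℂ M) where
  top := grassmannianTop M
  regular O := {f | ∀ U ∈ O, ∃ O' ⊆ O, IsOpen[grassmannianTop M] O' ∧ U ∈ O' ∧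
      ∃ (k : ℕ) (F G : PluckerPoly M k), IsQuotientOn F G O' f}
  restrict := by
    intro O O' f _ hO' hsub hf U hU
    obtain ⟨A, hA, hAo, hUA, k, F, G, hd, h⟩ := hf U (hsub hU)
    exact ⟨A ∩ O', Set.inter_subset_right, (grassmannianTop M).isOpen_inter _ _ hAo hO',
      ⟨hUA, hU⟩, k, F, G, hd, fun V hV => h V hV.1⟩
  glue := by
    intro O f _ h U hU
    obtain ⟨O', hsub, _, hUO', g, hg, hfg⟩ := h U hU
    obtain ⟨A, hA, hAo, hUA, k, F, G, hd, hq⟩ := hg U hUO'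
    refine ⟨A, hA.trans hsub, hAo, hUA, k, F, G, hd, fun V hV => ?_⟩
    rw [hfg (hA hV)]
    exact hq V hV
  const := by
    intro O c hO U hU
    let b := Module.finBasis ℂ U
    have hb : IsFrame (Module.finrank ℂ U) U (fun i => (b i : M)) := by
      refine ⟨b.linearIndependent.map' U.subtype U.ker_subtype, ?_⟩
      have h := congrArg (Submodule.map U.subtype) b.span_eq
      rw [Submodule.map_span, Submodule.map_top, Submodule.range_subtype, ← Set.range_comp] at h
      exact h
    have h1 : IsOpen[grassmannianTop M] (basicOpen (1 : PluckerPoly M (Module.finrank ℂ U))) :=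
      TopologicalSpace.isOpen_generateFrom_of_mem
        ⟨_, 0, 1, MvPolynomial.isHomogeneous_one _ _, rfl⟩
    refine ⟨O ∩ basicOpen (1 : PluckerPoly M (Module.finrank ℂ U)), Set.inter_subset_left,
      (grassmannianTop M).isOpen_inter _ _ hO h1,
      ⟨hU, _, hb, by simp [evalAt]⟩, Module.finrank ℂ U, MvPolynomial.C c, 1,
      ⟨0, MvPolynomial.isHomogeneous_C _ _, MvPolynomial.isHomogeneous_one _ _⟩, ?_⟩
    rintro V ⟨_, v, hv, _⟩
    exact ⟨v, hv, by simp [evalAt], by simp [evalAt]⟩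
  add := by
    intro O f g _ hf hg U hU
    obtain ⟨A, hA, hAo, hUA, k, F, G, hq⟩ := hf U hU
    obtain ⟨B, hB, hBo, hUB, l, F', G', hq'⟩ := hg U hU
    obtain ⟨F₁, G₁, d, e, hF, hG, hF₁, hG₁, h⟩ := hq.common hq' hUA hUB
    refine ⟨A ∩ B, Set.inter_subset_left.trans hA,
      (grassmannianTop M).isOpen_inter _ _ hAo hBo, ⟨hUA, hUB⟩, k, F * G₁ + G * F₁, G * G₁,
      ⟨d + e, (hF.mul hG₁).add (hG.mul hF₁), hG.mul hG₁⟩, fun V hV => ?_⟩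
    obtain ⟨v, hv, h1, h2, h3, h4⟩ := h V hV
    refine ⟨v, hv, ?_, ?_⟩
    · simpa [evalAt] using ⟨h1, h3⟩
    · change f V + g V = _
      rw [h2, h4, div_add_div _ _ h1 h3]
      simp [evalAt]
  mul := by
    intro O f g _ hf hg U hU
    obtain ⟨A, hA, hAo, hUA, k, F, G, hq⟩ := hf U hU
    obtain ⟨B, hB, hBo, hUB, l, F', G', hq'⟩ := hg U hU
    obtain ⟨F₁, G₁, d, e, hF, hG, hF₁, hG₁, h⟩ := hq.common hq' hUA hUB
    refine ⟨A ∩ B, Set.inter_subset_left.trans hA,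
      (grassmannianTop M).isOpen_inter _ _ hAo hBo, ⟨hUA, hUB⟩, k, F * F₁, G * G₁,
      ⟨d + e, hF.mul hF₁, hG.mul hG₁⟩, fun V hV => ?_⟩
    obtain ⟨v, hv, h1, h2, h3, h4⟩ := h V hV
    refine ⟨v, hv, ?_, ?_⟩
    · simpa [evalAt] using ⟨h1, h3⟩
    · change f V * g V = _
      rw [h2, h4, div_mul_div_comm]
      simp [evalAt]

end Grassmannian

/-! ## Quiver Grassmannians of the truncated loop quiver -/

/-- The truncated polynomial ring `A_N = ℂ[t]/(t^N)`. -/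
abbrev TruncPoly (N : ℕ) : Type := AdjoinRoot (Polynomial.X ^ N : ℂ[X])

instance (N : ℕ) : FiniteDimensional ℂ (TruncPoly N) :=
  (AdjoinRoot.powerBasis' (Polynomial.monic_X_pow (R := ℂ) N)).finite

/-- The points of `X^{(N)}_{k,m}`: the `A_N`-submodules (equivalently, the `t`-invariant
subspaces) of `ℂ^m ⊗ A_N = A_N^m` of dimension `k` over `ℂ`. -/
def QuiverGrassmannian (m N k : ℕ) : Type :=
  {U : Submodule (TruncPoly N) (Fin m → TruncPoly N) // Module.finrank ℂ U = k}

/-- The variety `X^{(N)}_{k,m}`, as a closed subvariety of the Grassmannian of `ℂ^m ⊗ A_N`. -/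
def quiverGrassmannian (m N k : ℕ) : SpaceWithFunctions (QuiverGrassmannian m N k) :=
  (grassmannian (Fin m → TruncPoly N)).induced fun U => U.1.restrictScalars ℂ

/-! ## Lattices in `ℂ^m ⊗ ℂ[t, t⁻¹]` -/

/-- The space `ℂ^m ⊗ ℂ[t, t⁻¹]`. -/
abbrev LoopSpace (m : ℕ) : Type := Fin m → ℂ[T;T⁻¹]

/-- The Laurent polynomial `f` lies in `t^a ℂ[t]`. -/
def OrdGE (a : ℤ) (f : ℂ[T;T⁻¹]) : Prop := ∀ l < a, f.coeff l = 0

theorem OrdGE.mono {a b : ℤ} {f : ℂ[T;T⁻¹]} (h : a ≤ b) (hf : OrdGE b f) : OrdGE a f :=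
  fun l hl => hf l (hl.trans_le h)

theorem OrdGE.sum {ι : Type*} {s : Finset ι} {a : ℤ} {f : ι → ℂ[T;T⁻¹]}
    (h : ∀ i ∈ s, OrdGE a (f i)) : OrdGE a (∑ i ∈ s, f i) := by
  intro l hl
  rw [AddMonoidAlgebra.coeff_sum, Finsupp.finsetSum_apply]
  exact Finset.sum_eq_zero fun i hi => h i hi l hl

theorem OrdGE.mul {a b : ℤ} {f g : ℂ[T;T⁻¹]} (hf : OrdGE a f) (hg : OrdGE b g) :
    OrdGE (a + b) (f * g) := by
  intro l hl
  classical
  rw [AddMonoidAlgebra.coeff_mul]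
  refine Finset.sum_eq_zero fun x _ => Finset.sum_eq_zero fun y _ => ?_
  dsimp only
  split_ifs with hxy
  · by_cases hx : x < a
    · rw [hf x hx, zero_mul]
    · rw [hg y (by omega), mul_zero]
  · rfl

/-- The lattice spanned by the `w_i ⊗ t^l` with `l ≥ c i`. -/
def coordLattice {m : ℕ} (c : Fin m → ℤ) : Submodule ℂ (LoopSpace m) where
  carrier := {v | ∀ i, OrdGE (c i) (v i)}
  add_mem' := fun hv hw i l hl => by simp [hv i l hl, hw i l hl]
  zero_mem' := fun i l _ => by simp
  smul_mem' := fun a v hv i l hl => by simp [hv i l hl]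

/-- The lattice `ℂ^m ⊗ t^a ℂ[t]`. -/
def stdLattice (m : ℕ) (a : ℤ) : Submodule ℂ (LoopSpace m) := coordLattice fun _ => a

/-- The coefficients at `t^l`, `-n ≤ l < n`. On `ℂ^m ⊗ t^{-n} ℂ[t]` this is the quotient map onto
`(ℂ^m ⊗ t^{-n} ℂ[t]) / (ℂ^m ⊗ t^n ℂ[t])`, written in coordinates. -/
def window (m n : ℕ) : LoopSpace m →ₗ[ℂ] (Fin m × Fin (2 * n) → ℂ) where
  toFun v x := (v x.1).coeff ((x.2 : ℤ) - n)
  map_add' v w := by ext x; simp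
  map_smul' a v := by ext x; simp

/-! ## The affine group `SL_m(ℂ[t, t⁻¹])` and its flag varieties -/

/-- The group `SL_m(ℂ[t, t⁻¹])`. -/
abbrev LoopSL (m : ℕ) : Type := Matrix.SpecialLinearGroup (Fin m) ℂ[T;T⁻¹]

/-- The units of determinant one of the order of all matrices `g` with
`g i j ∈ t^(e i j) ℂ[t]`. -/
def unitsOfOrder {m : ℕ} (e : Fin m → Fin m → ℤ) (h0 : ∀ i, e i i = 0)
    (h : ∀ i j l, e i l ≤ e i j + e j l) : Subgroup (LoopSL m) where
  carrier := {g | ∀ i j, OrdGE (e i j) (g.1 i j) ∧ OrdGE (e i j) (g⁻¹.1 i j)}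
  one_mem' := by
    have key : ∀ i j, OrdGE (e i j) ((1 : Matrix (Fin m) (Fin m) ℂ[T;T⁻¹]) i j) := by
      intro i j l hl
      by_cases hij : i = j
      · subst hij
        rw [h0] at hl
        rw [Matrix.one_apply_eq, ← LaurentPolynomial.T_zero, LaurentPolynomial.T_apply,
          if_neg hl.ne']
      · rw [Matrix.one_apply_ne hij]
        simp
    intro i j
    rw [inv_one]
    exact ⟨key i j, key i j⟩
  mul_mem' := by
    have key : ∀ a b : Matrix (Fin m) (Fin m) ℂ[T;T⁻¹], (∀ i j, OrdGE (e i j) (a i j)) →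
        (∀ i j, OrdGE (e i j) (b i j)) → ∀ i j, OrdGE (e i j) ((a * b) i j) := by
      intro a b ha hb i j
      rw [Matrix.mul_apply]
      exact OrdGE.sum fun l _ => ((ha i l).mul (hb l j)).mono (h i l j)
    intro a b ha hb i j
    rw [mul_inv_rev]
    exact ⟨key a.1 b.1 (fun i j => (ha i j).1) (fun i j => (hb i j).1) i j,
      key b⁻¹.1 a⁻¹.1 (fun i j => (hb i j).2) (fun i j => (ha i j).2) i j⟩
  inv_mem' := by
    intro a ha i j
    rw [inv_inv]
    exact ⟨(ha i j).2, (ha i j).1⟩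

/-- The Iwahori subgroup: the matrices with entries in `ℂ[t]` which are upper triangular
modulo `t`. -/
def iwahori (m : ℕ) : Subgroup (LoopSL m) :=
  unitsOfOrder (fun i j => if j < i then 1 else 0) (by simp) (by
    intro i j l
    split_ifs <;> omega)

/-- The exponents of the lattice spanned by `ℂ^m ⊗ ℂ[t]` and `w_1 ⊗ t⁻¹, …, w_b ⊗ t⁻¹`. -/
def fundExp (m b : ℕ) (i : Fin m) : ℤ := if (i : ℕ) < b then -1 else 0

/-- The maximal parahoric subgroup `P_b`, `0 ≤ b < m`, containing the Iwahori subgroup and all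
simple reflections except for the `b`-th one. It is the conjugate of
`P_0 = SL_m(ℂ[t])` by `diag(t⁻¹, …, t⁻¹, 1, …, 1)` (with `b` entries `t⁻¹`): in block form with
blocks of sizes `b` and `m - b`, the diagonal blocks have entries in `ℂ[t]`, the upper right block
in `t⁻¹ ℂ[t]` and the lower left block in `t ℂ[t]`. -/
def parahoric (m b : ℕ) : Subgroup (LoopSL m) :=
  unitsOfOrder (fun i j => fundExp m b i - fundExp m b j) (by simp) (by intros; omega)

/-- The points of the affine flag variety of `SL_m` for the parahoric subgroup `P_b`. -/
def FlagVariety (m b : ℕ) : Type := LoopSL m ⧸ parahoric m b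

instance (m b : ℕ) : MulAction (LoopSL m) (FlagVariety m b) :=
  inferInstanceAs (MulAction (LoopSL m) (LoopSL m ⧸ parahoric m b))

/-- The point `g P_b` of the affine flag variety. -/
def FlagVariety.mk {m b : ℕ} (g : LoopSL m) : FlagVariety m b :=
  (QuotientGroup.mk g : LoopSL m ⧸ parahoric m b)

/-- The image of a subspace of `ℂ^m ⊗ ℂ[t, t⁻¹]` under an element of `SL_m(ℂ[t, t⁻¹])`. -/
def translate {m : ℕ} (g : LoopSL m) (L : Submodule ℂ (LoopSpace m)) :
    Submodule ℂ (LoopSpace m) :=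
  L.map ((Matrix.mulVecLin g.1).restrictScalars ℂ)

theorem translate_mul {m : ℕ} (g h : LoopSL m) (L : Submodule ℂ (LoopSpace m)) :
    translate (g * h) L = translate g (translate h L) := by
  unfold translate
  rw [← Submodule.map_comp]
  congr 1
  ext1 v
  simp

theorem translate_le_of_mem {m b : ℕ} {g : LoopSL m} (hg : g ∈ parahoric m b) :
    translate g (coordLattice (fundExp m b)) ≤ coordLattice (fundExp m b) := by
  rintro _ ⟨v, hv, rfl⟩ i
  have h : OrdGE (fundExp m b i) (∑ j, g.1 i j * v j) :=
    OrdGE.sum fun j _ => (((hg i j).1).mul (hv j)).mono (by dsimp only; omega)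
  exact h

theorem translate_of_mem {m b : ℕ} {g : LoopSL m} (hg : g ∈ parahoric m b) :
    translate g (coordLattice (fundExp m b)) = coordLattice (fundExp m b) := by
  refine le_antisymm (translate_le_of_mem hg) ?_
  have h := Submodule.map_mono (f := (Matrix.mulVecLin g.1).restrictScalars ℂ)
    (translate_le_of_mem (inv_mem hg))
  change translate g (translate g⁻¹ _) ≤ translate g _ at h
  rw [← translate_mul, mul_inv_cancel] at h
  refine le_trans ?_ h
  intro v hv
  exact ⟨v, hv, by simp⟩

/-- The lattice `g L_b` attached to the point `g P_b`, where `L_b` is spanned by `ℂ^m ⊗ ℂ[t]` and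
`w_1 ⊗ t⁻¹, …, w_b ⊗ t⁻¹`. This is the embedding of the affine flag variety into the Sato
Grassmannian. -/
def FlagVariety.lattice {m b : ℕ} (p : FlagVariety m b) : Submodule ℂ (LoopSpace m) :=
  Quotient.liftOn' p (fun g => translate g (coordLattice (fundExp m b))) (by
    intro g h hgh
    rw [QuotientGroup.leftRel_apply] at hgh
    rw [← translate_of_mem hgh, ← translate_mul, mul_inv_cancel_left, translate_of_mem hgh])

/-- The `n`-th piece of the affine flag variety: the points whose lattice lies between
`ℂ^m ⊗ t^n ℂ[t]` and `ℂ^m ⊗ t^{-n} ℂ[t]`. -/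
def FlagVariety.piece (m b n : ℕ) : Set (FlagVariety m b) :=
  {p | stdLattice m n ≤ p.lattice ∧ p.lattice ≤ stdLattice m (-n)}

/-- The structure of ind-variety on a subset of the affine flag variety (given by an injective
map `i` into the affine flag variety). The `n`-th piece of the affine flag variety
is a projective variety, embedded by `L ↦ L / (ℂ^m ⊗ t^n ℂ[t])` into the Grassmannian of
the finite-dimensional space `(ℂ^m ⊗ t^{-n} ℂ[t]) / (ℂ^m ⊗ t^n ℂ[t])`, and the ind-variety is the
inductive limit of these pieces. -/
def flagStructure {m b : ℕ} {Y : Type*} (i : Y → FlagVariety m b) : SpaceWithFunctions Y :=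
  SpaceWithFunctions.indLimit (fun n => i ⁻¹' FlagVariety.piece m b n) fun n =>
    (grassmannian (Fin m × Fin (2 * n) → ℂ)).induced fun y =>
      (i y.1).lattice.map (window m n)

/-- The ind-variety topology of the affine flag variety. -/
@[reducible]
def FlagVariety.top (m b : ℕ) : TopologicalSpace (FlagVariety m b) :=
  (flagStructure (id : FlagVariety m b → FlagVariety m b)).top

/-- The loop rotation by `c`: the automorphism `t ↦ c t` of `ℂ[t, t⁻¹]`. -/
def rotate (c : ℂˣ) : ℂ[T;T⁻¹] →+* ℂ[T;T⁻¹] :=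
  LaurentPolynomial.eval₂ LaurentPolynomial.C
    (Units.map (LaurentPolynomial.C : ℂ →+* ℂ[T;T⁻¹]).toMonoidHom c *
      (LaurentPolynomial.isUnit_T (R := ℂ) 1).unit)

/-- The points of the affine flag variety which are fixed by the Cartan torus, that is, by
the diagonal matrices in `SL_m(ℂ)` and by the loop rotations. -/
def IsTorusFixed {m b : ℕ} (p : FlagVariety m b) : Prop :=
  (∀ (h : LoopSL m) (d : Fin m → ℂ),
    h.1 = Matrix.diagonal (fun i => LaurentPolynomial.C (d i)) → h • p = p) ∧
  ∀ (c : ℂˣ) (g : LoopSL m), FlagVariety.mk g = p →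
    FlagVariety.mk (Matrix.SpecialLinearGroup.map (rotate c) g) = p

/-- The Schubert variety through `p` (for a torus fixed point `p`): the closure of the orbit of
`p` under the Iwahori subgroup. -/
def schubertSet {m b : ℕ} (p : FlagVariety m b) : Set (FlagVariety m b) :=
  @closure _ (FlagVariety.top m b) {q | ∃ g ∈ iwahori m, q = g • p}

/-- The Schubert variety through `p` with its structure of variety. -/
def schubertVariety {m b : ℕ} (p : FlagVariety m b) : SpaceWithFunctions (schubertSet p) :=
  flagStructure Subtype.val

/-- The space with functions `S` is isomorphic to a Schubert variety in the affine flag variety of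
`SL_m` for the parahoric subgroup `P_b`. -/
def IsAffineSchubert (m b : ℕ) {X : Type*} (S : SpaceWithFunctions X) : Prop :=
  ∃ p : FlagVariety m b, IsTorusFixed p ∧ Nonempty (SpaceIso S (schubertVariety p))

/-! ## Degenerate affine Grassmannians -/

/-- The Sato Grassmannian `SGr_0`: the subspaces `U` of `ℂ^n ⊗ ℂ[t, t⁻¹]` which, for some `r`,
contain `ℂ^n ⊗ t^r ℂ[t]` as a subspace of (finite) codimension `n r`. -/
def satoGrassmannian (n : ℕ) : Set (Submodule ℂ (LoopSpace n)) :=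
  {U | ∃ r : ℕ, stdLattice n r ≤ U ∧
    FiniteDimensional ℂ (U ⧸ (stdLattice n r).submoduleOf U) ∧
    Module.finrank ℂ (U ⧸ (stdLattice n r).submoduleOf U) = n * r}

/-- The projection along `ℂ^n ⊗ 1` to the span of the `ℂ^n ⊗ t^l`, `l ≠ 0`. -/
def prConst {n : ℕ} (v : LoopSpace n) : LoopSpace n :=
  fun i => v i - LaurentPolynomial.C ((v i).coeff 0)

/-- The points of the degenerate affine Grassmannian `Gr^a(gl_n)`: the subspaces `U` in `SGr_0`
with `pr (t U) ⊆ U`, where `pr` is the projection along `ℂ^n ⊗ 1`. -/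
def degenerateGrassmannian (n : ℕ) : Set (Submodule ℂ (LoopSpace n)) :=
  {U | U ∈ satoGrassmannian n ∧
    ∀ u ∈ U, prConst (fun i => LaurentPolynomial.T 1 * u i) ∈ U}

/-- The points of `Gr^a_N(gl_n)`: the points `U` of `Gr^a(gl_n)` with
`ℂ^n ⊗ t^N ℂ[t] ⊆ U ⊆ ℂ^n ⊗ t^{-N} ℂ[t]`. -/
def DegGrassmannian (n N : ℕ) : Type :=
  {U : Submodule ℂ (LoopSpace n) //
    U ∈ degenerateGrassmannian n ∧ stdLattice n N ≤ U ∧ U ≤ stdLattice n (-N)}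

/-- The variety `Gr^a_N(gl_n)`, as a closed subvariety of the Grassmannian of
`(ℂ^n ⊗ t^{-N} ℂ[t]) / (ℂ^n ⊗ t^N ℂ[t])`. -/
def degGrassmannian (n N : ℕ) : SpaceWithFunctions (DegGrassmannian n N) :=
  (grassmannian (Fin n × Fin (2 * N) → ℂ)).induced fun U => U.1.map (window n N)

end

end AffineSchubert

open scoped LaurentPolynomial Polynomial Topology

namespace AffineSchubert

noncomputable section

/-! ## Comparison of families of subspaces through their Plücker coordinates -/

section Plucker

variable {M M' M'' : Type*} [AddCommGroup M] [Module ℂ M] [AddCommGroup M'] [Module ℂ M']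
  [AddCommGroup M''] [Module ℂ M'']

/-! Write `k = q m + b` with `0 ≤ b < m` and put `a = q - N`. A lattice `L` between `t^(a+N)` and
`t^a` (`InWindow a N L`) is the same as a subspace of a space with coordinates `Fin m × Fin N`, on
which `t` acts as the nilpotent operator `shift` with `m` Jordan blocks of size `N`. The window of
`L_b` has dimension `q m + b = k`. Hence `X^{(N)}_{k,m}` parametrizes the `t`-stable lattices in
this window whose window has the same dimension as that of `L_b`. It remains to see that these are
exactly the points `g P_b` in the window, that together they form one orbit closure, and that the
two structures of variety agree.

Orbits. The Iwahori subgroup is triangular for the order of the monomials `w_i ⊗ t^l` given by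
`key`. A reduced echelon basis of a `t`-stable lattice is therefore the image of monomials under an
element of the Iwahori subgroup, so the lattice is `translate g (coordLattice c)`
(`exists_translate_coordLattice`). The dimension of the window fixes `∑ c i = -b`, which is what
makes `coordLattice c` the lattice of a torus fixed point of the flag variety for `P_b`. So the
window is a finite union of Iwahori orbits of fixed points, and it is closed.

One dense orbit. For `j < i` the curve `s ↦ (1 + s t^d E_ij) coordLattice c` starts at `coordLattice
c` and, for `s ≠ 0`, lies in the orbit of the lattice obtained by transferring `e` units from `c i`
to `c j`; this is a computation in `SL_2` (`translate_elem_eq`, `fixedPoint_mem_schubertSet`).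
Transfers within the window end at exponents of the form `(a+N, …, a+N, x, a, …, a)`, which are
determined by their sum. Every orbit in the window thus lies in the closure of the same orbit, and
the window is a Schubert variety (`exists_schubertSet_eq`).

Structures. All varieties involved are families of subspaces with the structure induced from a
Grassmannian. Two families induce the same structure when the Plücker coordinates of each are, up to
a common factor, Plücker coordinates of the other (`PluckerEquiv`). This covers injective linear
maps with a linear left inverse and the addition of a fixed complement, hence any change of window;
so on a bounded set the ind-structure is that of a single window
(`nonempty_spaceIso_flagStructure`).

Degenerate Grassmannians. On the window `-N ≤ l < N` the operator `pr ∘ t` breaks each of the `n`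
chains of length `2N` at exponent `0`. This leaves `2n` Jordan blocks of size `N`, and the Sato
condition says that the dimension is `N n`; so `Gr^a_N(gl_n)` is the case `m = 2n`, `k = N n`. -/

theorem exists_isFrame [FiniteDimensional ℂ M] {k : ℕ} {U : Submodule ℂ M}
    (hU : Module.finrank ℂ U = k) : ∃ v, IsFrame k U v := by
  subst hU
  let b := Module.finBasis ℂ U
  refine ⟨fun i => (b i : M), b.linearIndependent.map' U.subtype U.ker_subtype, ?_⟩
  have h := congrArg (Submodule.map U.subtype) b.span_eq
  rw [Submodule.map_span, Submodule.map_top, Submodule.range_subtype, ← Set.range_comp] at h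
  exact h

theorem IsFrame.exists_smul {k : ℕ} {U : Submodule ℂ M} {v w : Fin k → M}
    (hv : IsFrame k U v) (hw : IsFrame k U w) :
    ∃ c : ℂ, c ≠ 0 ∧ ∀ φ : M [⋀^Fin k]→ₗ[ℂ] ℂ, φ w = c * φ v := by
  obtain ⟨c, hc, h⟩ := hv.proportional hw
  refine ⟨c, hc, fun φ => ?_⟩
  have := h 1 (MvPolynomial.X φ) (MvPolynomial.isHomogeneous_X _ _)
  simpa [evalAt] using this

theorem IsFrame.map {k : ℕ} {U : Submodule ℂ M} {v : Fin k → M} (hv : IsFrame k U v)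
    (T : M →ₗ[ℂ] M') (hT : ∀ u ∈ U, T u = 0 → u = 0) : IsFrame k (U.map T) (T ∘ v) := by
  obtain ⟨h1, rfl⟩ := hv
  refine ⟨h1.map (Submodule.disjoint_def.2 fun u hu h0 => hT u hu h0), ?_⟩
  rw [Submodule.map_span, Set.range_comp]

theorem IsFrame.evalAt_ne_zero_iff {k d : ℕ} {U : Submodule ℂ M} {v w : Fin k → M}
    (hv : IsFrame k U v) (hw : IsFrame k U w) {F : PluckerPoly M k} (hF : F.IsHomogeneous d) :
    evalAt v F ≠ 0 ↔ evalAt w F ≠ 0 := by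
  obtain ⟨c, hc, h⟩ := hv.proportional hw
  rw [h d F hF]
  simp [hc]

theorem IsFrame.mem_basicOpen {k d : ℕ} {U : Submodule ℂ M} {v : Fin k → M}
    (hv : IsFrame k U v) {F : PluckerPoly M k} (hF : F.IsHomogeneous d) :
    U ∈ basicOpen F ↔ evalAt v F ≠ 0 :=
  ⟨fun ⟨_, hw, h⟩ => (hw.evalAt_ne_zero_iff hv hF).1 h, fun h => ⟨v, hv, h⟩⟩

theorem isOpen_basicOpen {k d : ℕ} {F : PluckerPoly M k} (hF : F.IsHomogeneous d) :
    IsOpen[grassmannianTop M] (basicOpen F) :=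
  TopologicalSpace.isOpen_generateFrom_of_mem ⟨_, _, _, hF, rfl⟩

/-- The Plücker coordinates of the `k'`-dimensional spaces `i' y` are, up to a common factor
depending on `y`, also Plücker coordinates of the `k`-dimensional spaces `i y`. -/
def PluckerDom {Y : Type*} (k k' : ℕ) (i : Y → Submodule ℂ M) (i' : Y → Submodule ℂ M') : Prop :=
  ∃ A : (M' [⋀^Fin k']→ₗ[ℂ] ℂ) → (M [⋀^Fin k]→ₗ[ℂ] ℂ), ∀ y, ∃ v v', IsFrame k (i y) v ∧
    IsFrame k' (i' y) v' ∧ ∃ c : ℂ, c ≠ 0 ∧ ∀ φ, φ v' = c * A φ v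

variable {Y : Type*} {k k' k'' : ℕ} {i : Y → Submodule ℂ M} {i' : Y → Submodule ℂ M'}
  {i'' : Y → Submodule ℂ M''}

theorem PluckerDom.finrank_eq_right (h : PluckerDom k k' i i') (y : Y) :
    Module.finrank ℂ (i' y) = k' := by
  obtain ⟨A, hA⟩ := h
  obtain ⟨v, v', -, hv', -⟩ := hA y
  exact hv'.finrank_eq

theorem PluckerDom.trans (h : PluckerDom k k' i i') (h' : PluckerDom k' k'' i' i'') :
    PluckerDom k k'' i i'' := by
  obtain ⟨A, hA⟩ := h
  obtain ⟨B, hB⟩ := h'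
  refine ⟨A ∘ B, fun y => ?_⟩
  obtain ⟨v, v', hv, hv', c, hc, h⟩ := hA y
  obtain ⟨w, w', hw, hw', e, he, h'⟩ := hB y
  -- The two hypotheses may use different frames of `i' y`; changing between them costs the factor
  -- `r`.
  obtain ⟨r, hr, hr'⟩ := hv'.exists_smul hw
  refine ⟨v, w', hv, hw', e * r * c, by positivity, fun φ => ?_⟩
  rw [h', hr', h]
  simp only [Function.comp_apply]
  ring

theorem PluckerDom.map [FiniteDimensional ℂ M] (hk : ∀ y, Module.finrank ℂ (i y) = k)
    (T : M →ₗ[ℂ] M') (hT : ∀ y, ∀ u ∈ i y, T u = 0 → u = 0) (hi' : ∀ y, i' y = (i y).map T) :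
    PluckerDom k k i i' := by
  refine ⟨fun φ => φ.compLinearMap T, fun y => ?_⟩
  obtain ⟨v, hv⟩ := exists_isFrame (hk y)
  exact ⟨v, T ∘ v, hv, hi' y ▸ hv.map T (hT y), 1, one_ne_zero, fun φ => by simp [Function.comp_def]⟩

theorem IsFrame.cons {U : Submodule ℂ M} {v : Fin k → M} (hv : IsFrame k U v) {x : M}
    (hx : x ∉ U) : IsFrame (k + 1) (U ⊔ Submodule.span ℂ {x}) (Fin.cons x v) := by
  obtain ⟨h1, rfl⟩ := hv
  refine ⟨h1.finCons hx, ?_⟩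
  rw [Fin.range_cons, Set.insert_eq, Submodule.span_union, sup_comm]

/-- On the frame `(x, v)` of `i y ⊕ ⟨x⟩`, contracting a form with `x` gives a form evaluated at `v`.
Conversely `φ v = (l ∧ φ)(x, v)`, since `l x = 1` and `l` kills `v`. A fixed extra vector therefore
does not affect the induced structure. -/
theorem PluckerDom.sup_span_singleton [FiniteDimensional ℂ M]
    (hk : ∀ y, Module.finrank ℂ (i y) = k) (x : M) (l : M →ₗ[ℂ] ℂ) (hx : l x = 1)
    (hl : ∀ y, ∀ u ∈ i y, l u = 0) :
    PluckerDom k (k + 1) i (fun y => i y ⊔ Submodule.span ℂ {x}) ∧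
      PluckerDom (k + 1) k (fun y => i y ⊔ Submodule.span ℂ {x}) i := by
  have hxn : ∀ y, x ∉ i y := fun y h => by simpa [hx] using hl y x h
  constructor
  · refine ⟨fun φ => φ.curryLeft x, fun y => ?_⟩
    obtain ⟨v, hv⟩ := exists_isFrame (hk y)
    exact ⟨v, _, hv, hv.cons (hxn y), 1, one_ne_zero, fun φ => by simp [Matrix.vecCons]⟩
  · refine ⟨fun φ => AlternatingMap.alternatizeUncurryFin (l.smulRight φ), fun y => ?_⟩
    obtain ⟨v, hv⟩ := exists_isFrame (hk y)
    refine ⟨_, v, hv.cons (hxn y), hv, 1, one_ne_zero, fun φ => ?_⟩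
    have h0 : ∀ j, l (v j) = 0 := fun j =>
      hl y _ (hv.2 ▸ Submodule.subset_span (Set.mem_range_self j))
    -- Only the term in which `l` receives the first argument `x` survives.
    rw [AlternatingMap.alternatizeUncurryFin_apply, Fin.sum_univ_succ]
    simp [h0, hx]

theorem finrank_sup_span_singleton [FiniteDimensional ℂ M] {U : Submodule ℂ M} {x : M}
    (hx : x ∉ U) : Module.finrank ℂ ↥(U ⊔ Submodule.span ℂ {x}) = Module.finrank ℂ U + 1 := by
  obtain ⟨v, hv⟩ := exists_isFrame (U := U) rfl
  exact (hv.cons hx).finrank_eq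

/-- The subspace of the vectors with support in `s`. -/
def coordSpace {κ : Type*} [DecidableEq κ] (s : Finset κ) : Submodule ℂ (κ → ℂ) :=
  Submodule.span ℂ ((fun x => Pi.single x 1) '' (s : Set κ))

theorem mem_coordSpace {κ : Type*} [Fintype κ] [DecidableEq κ] {s : Finset κ} {u : κ → ℂ} :
    u ∈ coordSpace s ↔ ∀ x, x ∉ s → u x = 0 := by
  constructor
  · intro h x hx
    have : coordSpace s ≤ LinearMap.ker (LinearMap.proj x : (κ → ℂ) →ₗ[ℂ] ℂ) := by
      rw [coordSpace, Submodule.span_le]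
      rintro _ ⟨z, hz, rfl⟩
      have : x ≠ z := fun h => hx (h ▸ hz)
      simp [this]
    exact this h
  · intro h
    have : u = ∑ x ∈ s, u x • (Pi.single x 1 : κ → ℂ) := by
      ext z
      rw [Finset.sum_apply]
      simp only [Pi.smul_apply, Pi.single_apply, smul_eq_mul, mul_ite, mul_one, mul_zero]
      rw [Finset.sum_ite_eq]
      split_ifs with hz
      · rfl
      · exact h z hz
    rw [this]
    exact Submodule.sum_mem _ fun x hx =>
      Submodule.smul_mem _ _ (Submodule.subset_span ⟨x, hx, rfl⟩)

theorem finrank_coordSpace {κ : Type*} [Fintype κ] [DecidableEq κ] (s : Finset κ) :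
    Module.finrank ℂ (coordSpace s) = s.card := by
  have h : LinearIndependent ℂ (fun x : s => (Pi.single x.1 1 : κ → ℂ)) := by
    have := (Pi.basisFun ℂ κ).linearIndependent.comp (Subtype.val : s → κ) Subtype.val_injective
    simpa [Function.comp_def] using this
  have h2 := finrank_span_eq_card h
  rw [Fintype.card_coe] at h2
  rw [← h2, coordSpace, Set.image_eq_range]
  rfl

/-- Coordinate vectors are added one at a time. The functional for each is its own coordinate, which
vanishes on the family by `hs` and on the vectors already added. -/
theorem PluckerDom.sup_coordSpace {κ : Type*} [Fintype κ] [DecidableEq κ]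
    {i : Y → Submodule ℂ (κ → ℂ)} (hk : ∀ y, Module.finrank ℂ (i y) = k) (s : Finset κ)
    (hs : ∀ y, ∀ u ∈ i y, ∀ x ∈ s, u x = 0) :
    PluckerDom k (k + s.card) i (fun y => i y ⊔ coordSpace s) ∧
      PluckerDom (k + s.card) k (fun y => i y ⊔ coordSpace s) i ∧
      ∀ y, Module.finrank ℂ ↥(i y ⊔ coordSpace s) = k + s.card := by
  induction s using Finset.induction with
  | empty =>
    have h0 : (fun y => i y ⊔ coordSpace (∅ : Finset κ)) = i := by
      funext y; simp [coordSpace]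
    have h0' := congrFun h0
    rw [h0]
    have := PluckerDom.map (i' := i) hk LinearMap.id (fun _ _ _ h => h) (by simp)
    exact ⟨this, this, fun y => by rw [h0' y]; simpa using hk y⟩
  | insert x s hx ih =>
    obtain ⟨h1, h2, h3⟩ := ih fun y u hu z hz => hs y u hu z (Finset.mem_insert_of_mem hz)
    have e : (fun y => i y ⊔ coordSpace (insert x s)) =
        fun y => (i y ⊔ coordSpace s) ⊔ Submodule.span ℂ {Pi.single x 1} := by
      funext y
      rw [coordSpace, Finset.coe_insert, Set.image_insert_eq, Set.insert_eq, Submodule.span_union,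
        sup_comm (Submodule.span ℂ {_}), ← sup_assoc]
      rfl
    have hl : ∀ y, ∀ u ∈ i y ⊔ coordSpace s, (LinearMap.proj x : (κ → ℂ) →ₗ[ℂ] ℂ) u = 0 := by
      intro y u hu
      obtain ⟨a, ha, b, hb, rfl⟩ := Submodule.mem_sup.1 hu
      have h1 := hs y a ha x (Finset.mem_insert_self _ _)
      have h2 := mem_coordSpace.1 hb x hx
      simp [h1, h2]
    have hx1 : (LinearMap.proj x : (κ → ℂ) →ₗ[ℂ] ℂ) (Pi.single x 1) = 1 := by simp
    obtain ⟨h4, h5⟩ := PluckerDom.sup_span_singleton h3 (Pi.single x 1) (LinearMap.proj x) hx1 hl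
    rw [Finset.card_insert_of_notMem hx, ← add_assoc, e]
    refine ⟨h1.trans h4, h5.trans h2, fun y => ?_⟩
    have e' := congrFun e y
    rw [e', finrank_sup_span_singleton, h3]
    intro h
    simpa using hl y _ h

end Plucker

/-! ## Regular functions on induced structures -/

section Induced

variable {M M' : Type*} [AddCommGroup M] [Module ℂ M] [AddCommGroup M'] [Module ℂ M']
  {Y : Type*} {k k' : ℕ} {i : Y → Submodule ℂ M} {i' : Y → Submodule ℂ M'}

/-- Substituting coordinates for coordinates preserves the degree, and homogeneity collects the
common factor into one power `c ^ d`, which drops out of nonvanishing conditions and of quotients.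
-/
theorem evalAt_rename {A : (M' [⋀^Fin k']→ₗ[ℂ] ℂ) → (M [⋀^Fin k]→ₗ[ℂ] ℂ)} {v : Fin k → M}
    {v' : Fin k' → M'} {c : ℂ} (h : ∀ φ, φ v' = c * A φ v) {d : ℕ} {F : PluckerPoly M' k'}
    (hF : F.IsHomogeneous d) :
    evalAt v' F = c ^ d * evalAt v (MvPolynomial.rename A F) := by
  unfold evalAt
  rw [MvPolynomial.eval_rename, MvPolynomial.eval_eq, MvPolynomial.eval_eq, Finset.mul_sum]
  refine Finset.sum_congr rfl fun x hx => ?_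
  have hd := hF.degree_eq_sum_deg_support hx
  simp only [h, mul_pow, Finset.prod_mul_distrib, Finset.prod_pow_eq_pow_sum,
    Function.comp_apply]
  rw [hd]
  ring

theorem PluckerDom.isOpen (h : PluckerDom k k' i i') {O : Set Y}
    (hO : IsOpen[(grassmannianTop M').induced i'] O) :
    IsOpen[(grassmannianTop M).induced i] O := by
  obtain ⟨A, hA⟩ := h
  have hle : (grassmannianTop M).induced i ≤ (grassmannianTop M').induced i' := by
    rw [← continuous_iff_le_induced]
    refine continuous_generateFrom_iff.2 ?_
    rintro _ ⟨l, d, F, hF, rfl⟩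
    by_cases hl : l = k'
    · subst hl
      refine ⟨basicOpen (MvPolynomial.rename A F),
        isOpen_basicOpen hF.rename_isHomogeneous, ?_⟩
      ext y
      obtain ⟨v, v', hv, hv', c, hc, h⟩ := hA y
      rw [Set.mem_preimage, Set.mem_preimage, hv.mem_basicOpen hF.rename_isHomogeneous,
        hv'.mem_basicOpen hF, evalAt_rename h hF]
      simp [hc]
    -- All members of the family have dimension `k'`, so a basic open set for another dimension
    -- meets none of them.
    · convert! @isOpen_empty _ ((grassmannianTop M).induced i)
      rw [Set.eq_empty_iff_forall_notMem]
      rintro y ⟨w, hw, _⟩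
      obtain ⟨v, v', hv, hv', -⟩ := hA y
      exact hl (hw.finrank_eq.symm.trans hv'.finrank_eq)
  exact hle O hO

/-- Locally the function is `F / G` with forms of equal degree. After the substitution both acquire
the same factor, so the quotient becomes one of forms in the coordinates of `i y`. -/
theorem PluckerDom.regular [FiniteDimensional ℂ M] [FiniteDimensional ℂ M']
    (h : PluckerDom k k' i i') {O : Set Y} {f : Y → ℂ}
    (hf : f ∈ ((grassmannian M').induced i').regular O) :
    f ∈ ((grassmannian M).induced i).regular O := by
  intro y hy
  obtain ⟨O₁, hO₁, hyO₁, g, hg, hfg⟩ := hf y hy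
  obtain ⟨O₂, hsub, hO₂, hyO₂, l, F, G, ⟨d, hF, hG⟩, hq⟩ := hg _ hyO₁
  obtain ⟨B, hB, hBO⟩ := h.isOpen (O := i' ⁻¹' O₂) ⟨O₂, hO₂, rfl⟩
  obtain ⟨A, hA⟩ := h
  obtain rfl : l = k' := by
    obtain ⟨w, hw, -⟩ := hq _ hyO₂
    obtain ⟨v, v', hv, hv', -⟩ := hA y
    exact hw.finrank_eq.symm.trans hv'.finrank_eq
  have hF' := hF.rename_isHomogeneous (f := A)
  have hG' := hG.rename_isHomogeneous (f := A)
  have key : ∀ z, i' z ∈ O₂ → ∀ w, IsFrame k (i z) w →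
      evalAt w (MvPolynomial.rename A G) ≠ 0 ∧
      g (i' z) = evalAt w (MvPolynomial.rename A F) / evalAt w (MvPolynomial.rename A G) := by
    intro z hz w hw
    obtain ⟨v, v', hv, hv', c, hc, h⟩ := hA z
    obtain ⟨u, hu, hu1, hu2⟩ := hq _ hz
    obtain ⟨e, he, h1⟩ := hv'.proportional hu
    obtain ⟨r, hr, h2⟩ := hw.proportional hv
    have hG1 : evalAt u G = (e ^ d * c ^ d * r ^ d) * evalAt w (MvPolynomial.rename A G) := by
      rw [h1 d G hG, evalAt_rename h hG, h2 d _ hG']; ring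
    have hF1 : evalAt u F = (e ^ d * c ^ d * r ^ d) * evalAt w (MvPolynomial.rename A F) := by
      rw [h1 d F hF, evalAt_rename h hF, h2 d _ hF']; ring
    rw [hG1] at hu1
    rw [hu2, hG1, hF1, mul_div_mul_left _ _ (left_ne_zero_of_mul hu1)]
    exact ⟨right_ne_zero_of_mul hu1, rfl⟩
  classical
  -- A function on all subspaces is required. The quotient does not depend on the chosen frame, and
  -- `0` is a dummy value for subspaces of dimension other than `k`.
  let g' : Submodule ℂ M → ℂ := fun U =>
    if h : ∃ v, IsFrame k U v then evalAt h.choose (MvPolynomial.rename A F) /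
      evalAt h.choose (MvPolynomial.rename A G) else 0
  refine ⟨B ∩ basicOpen (MvPolynomial.rename A G),
    (grassmannianTop M).isOpen_inter _ _ hB (isOpen_basicOpen hG'), ⟨?_, ?_⟩, g', ?_, ?_⟩
  · change y ∈ i ⁻¹' B
    rw [hBO]; exact hyO₂
  · obtain ⟨v, v', hv, -⟩ := hA y
    exact ⟨v, hv, (key y hyO₂ v hv).1⟩
  · intro U hU
    refine ⟨_, subset_rfl, (grassmannianTop M).isOpen_inter _ _ hB (isOpen_basicOpen hG'), hU, k,
      _, _, ⟨d, hF', hG'⟩, ?_⟩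
    rintro V ⟨-, w, hw, hw1⟩
    have hV : ∃ v, IsFrame k V v := ⟨w, hw⟩
    refine ⟨hV.choose, hV.choose_spec, (hw.evalAt_ne_zero_iff hV.choose_spec hG').1 hw1, ?_⟩
    simp only [g', dif_pos hV]
  · rintro z hz ⟨hzB, -⟩
    have hzO : i' z ∈ O₂ := by
      change z ∈ i ⁻¹' B at hzB
      rw [hBO] at hzB; exact hzB
    obtain ⟨v, v', hv, -⟩ := hA z
    have hV : ∃ v, IsFrame k (i z) v := ⟨v, hv⟩
    rw [hfg z hz (hsub hzO), (key z hzO _ hV.choose_spec).2]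
    simp only [g', dif_pos hV]

/-- Families of subspaces with equivalent Plücker coordinates induce the same structure. -/
def PluckerEquiv (k k' : ℕ) (i : Y → Submodule ℂ M) (i' : Y → Submodule ℂ M') : Prop :=
  PluckerDom k k' i i' ∧ PluckerDom k' k i' i

theorem PluckerEquiv.symm (h : PluckerEquiv k k' i i') : PluckerEquiv k' k i' i := ⟨h.2, h.1⟩

theorem PluckerEquiv.trans {M'' : Type*} [AddCommGroup M''] [Module ℂ M''] {k'' : ℕ}
    {i'' : Y → Submodule ℂ M''} (h : PluckerEquiv k k' i i') (h' : PluckerEquiv k' k'' i' i'') :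
    PluckerEquiv k k'' i i'' := ⟨h.1.trans h'.1, h'.2.trans h.2⟩

theorem PluckerEquiv.map [FiniteDimensional ℂ M] [FiniteDimensional ℂ M']
    (hk : ∀ y, Module.finrank ℂ (i y) = k) (T : M →ₗ[ℂ] M') (T' : M' →ₗ[ℂ] M)
    (hT : ∀ u, T' (T u) = u) (hi' : ∀ y, i' y = (i y).map T) :
    PluckerEquiv k k i i' := by
  have hinj : Function.Injective T := Function.LeftInverse.injective hT
  refine ⟨PluckerDom.map hk T (fun y u _ h => hinj (by rw [h, map_zero])) hi',
    PluckerDom.map (fun y => ?_) T' (fun y u hu h => ?_) fun y => ?_⟩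
  · rw [hi', ← (Submodule.equivMapOfInjective T hinj (i y)).finrank_eq, hk]
  · rw [hi'] at hu
    obtain ⟨w, -, rfl⟩ := hu
    rw [hT] at h
    rw [h, map_zero]
  · rw [hi', ← Submodule.map_comp]
    have : T' ∘ₗ T = LinearMap.id := LinearMap.ext hT
    rw [this, Submodule.map_id]

theorem PluckerEquiv.isOpen_iff (h : PluckerEquiv k k' i i') (O : Set Y) :
    IsOpen[(grassmannianTop M').induced i'] O ↔ IsOpen[(grassmannianTop M).induced i] O :=
  ⟨h.1.isOpen, h.2.isOpen⟩

theorem PluckerEquiv.regular_iff [FiniteDimensional ℂ M] [FiniteDimensional ℂ M']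
    (h : PluckerEquiv k k' i i') (O : Set Y) (f : Y → ℂ) :
    f ∈ ((grassmannian M').induced i').regular O ↔ f ∈ ((grassmannian M).induced i).regular O :=
  ⟨h.1.regular, h.2.regular⟩

theorem induced_comp_isOpen_iff {X Z W : Type*} (S : SpaceWithFunctions W) (j : Z → W) (e : X ≃ Z)
    (O : Set Z) : IsOpen[(S.induced j).top] O ↔ IsOpen[(S.induced (j ∘ e)).top] (e ⁻¹' O) := by
  constructor
  · rintro ⟨A, hA, rfl⟩
    exact ⟨A, hA, rfl⟩
  · rintro ⟨A, hA, h⟩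
    refine ⟨A, hA, ?_⟩
    rw [Set.preimage_comp] at h
    exact (Set.preimage_injective.2 e.surjective) h

theorem induced_comp_regular_iff {X Z W : Type*} (S : SpaceWithFunctions W) (j : Z → W) (e : X ≃ Z)
    (O : Set Z) (f : Z → ℂ) :
    f ∈ (S.induced j).regular O ↔ f ∘ e ∈ (S.induced (j ∘ e)).regular (e ⁻¹' O) := by
  constructor
  · intro h x hx
    obtain ⟨A, hA, hxA, g, hg, hfg⟩ := h (e x) hx
    exact ⟨A, hA, hxA, g, hg, fun z hz hzA => hfg _ hz hzA⟩
  · intro h z hz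
    obtain ⟨A, hA, hxA, g, hg, hfg⟩ := h (e.symm z) (by simpa using hz)
    refine ⟨A, hA, by simpa using hxA, g, hg, fun w hw hwA => ?_⟩
    simpa using hfg (e.symm w) (by simpa using hw) (by simpa using hwA)

theorem PluckerEquiv.spaceIso {X Z : Type*} [FiniteDimensional ℂ M] [FiniteDimensional ℂ M']
    {i : X → Submodule ℂ M} {j : Z → Submodule ℂ M'} (e : X ≃ Z)
    (h : PluckerEquiv k k' i (j ∘ e)) :
    Nonempty (SpaceIso ((grassmannian M).induced i) ((grassmannian M').induced j)) := by
  refine ⟨⟨e, fun O => ?_, fun O f _ => ?_⟩⟩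
  · rw [induced_comp_isOpen_iff]
    exact h.isOpen_iff _
  · rw [induced_comp_regular_iff]
    exact h.regular_iff _ _

theorem SpaceIso.trans {X Y Z : Type*} {S : SpaceWithFunctions X} {S' : SpaceWithFunctions Y}
    {S'' : SpaceWithFunctions Z} (e : SpaceIso S S') (e' : SpaceIso S' S'') :
    Nonempty (SpaceIso S S'') := by
  refine ⟨⟨e.toEquiv.trans e'.toEquiv, fun O => ?_, fun O f hO => ?_⟩⟩
  · rw [e'.isOpen_iff, e.isOpen_iff]; rfl
  · rw [e'.regular_iff O f hO, e.regular_iff _ _ ((e'.isOpen_iff O).1 hO)]; rfl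

end Induced

/-! ## Closed subsets of Grassmannians and curves in them -/

section GrassmannianTopology

variable {M : Type*} [AddCommGroup M] [Module ℂ M] {k : ℕ}

/-- The determinant with respect to the basis `v` of its span, pulled back along a linear retraction
of `M` onto that span, takes the value `1`. -/
theorem exists_alternatingMap_ne_zero {v : Fin k → M} (hv : LinearIndependent ℂ v) :
    ∃ φ : M [⋀^Fin k]→ₗ[ℂ] ℂ, φ v ≠ 0 := by
  let b := Module.Basis.span hv
  obtain ⟨p, hp⟩ := LinearMap.exists_leftInverse_of_injective
    (Submodule.span ℂ (Set.range v)).subtype (Submodule.ker_subtype _)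
  refine ⟨b.det.compLinearMap p, ?_⟩
  have h : ∀ i, p (v i) = b i := by
    intro i
    have h1 : ((b i : Submodule.span ℂ (Set.range v)) : M) = v i :=
      congrArg Subtype.val (Module.Basis.span_apply hv i)
    rw [← h1]
    exact LinearMap.congr_fun hp (b i)
  rw [AlternatingMap.compLinearMap_apply]
  simp only [h, Module.Basis.det_self, ne_eq, one_ne_zero, not_false_eq_true]

theorem isClosed_of_exists_form {S : Set (Submodule ℂ M)}
    (h : ∀ U ∉ S, ∃ (k : ℕ) (φ : M [⋀^Fin k]→ₗ[ℂ] ℂ), (∃ v, IsFrame k U v ∧ φ v ≠ 0) ∧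
      ∀ V ∈ S, ∀ v, IsFrame k V v → φ v = 0) :
    IsClosed[grassmannianTop M] S := by
  let _ := grassmannianTop M
  rw [← isOpen_compl_iff, isOpen_iff_forall_mem_open]
  intro U hU
  obtain ⟨k, φ, ⟨v, hv, h1⟩, h2⟩ := h U hU
  refine ⟨basicOpen (MvPolynomial.X φ), ?_,
    isOpen_basicOpen (MvPolynomial.isHomogeneous_X _ _), ⟨v, hv, by simpa [evalAt] using h1⟩⟩
  rintro V ⟨w, hw, hw1⟩ hV
  exact hw1 (by simpa [evalAt] using h2 V hV w hw)

/-- If `x ∈ V`, then `x ∧ v₁ ∧ ⋯ ∧ vₖ` vanishes for every frame of `V`. If `x ∉ U`, some form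
detects this vector, and its contraction with `x` separates `U` from the set. -/
theorem isClosed_mem [FiniteDimensional ℂ M] (x : M) : IsClosed[grassmannianTop M] {U : Submodule ℂ M | x ∈ U} := by
  refine isClosed_of_exists_form fun U hU => ?_
  obtain ⟨v, hv⟩ := exists_isFrame (U := U) rfl
  obtain ⟨φ, hφ⟩ := exists_alternatingMap_ne_zero (hv.cons hU).1
  refine ⟨_, φ.curryLeft x, ⟨v, hv, hφ⟩, fun V hV w hw => ?_⟩
  rw [AlternatingMap.curryLeft_apply_apply]
  refine AlternatingMap.map_linearDependent _ _ fun h => ?_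
  rw [Matrix.vecCons, linearIndependent_finCons, hw.2] at h
  exact h.2 hV

/-- If `l` is nonzero on `U`, split `U` as `(U ∩ ker l) ⊕ ⟨u⟩` with `l u = 1`, and take `φ` nonzero
on `U ∩ ker l`. The form `l ∧ φ` is nonzero on `U` and vanishes on every subspace of `ker l`. -/
theorem isClosed_le_ker [FiniteDimensional ℂ M] (l : M →ₗ[ℂ] ℂ) :
    IsClosed[grassmannianTop M] {U : Submodule ℂ M | ∀ u ∈ U, l u = 0} := by
  refine isClosed_of_exists_form fun U hU => ?_
  obtain ⟨u, hu, hlu⟩ : ∃ u ∈ U, l u = 1 := by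
    simp only [Set.mem_ofPred_eq, not_forall] at hU
    obtain ⟨u, hu, h⟩ := hU
    exact ⟨(l u)⁻¹ • u, U.smul_mem _ hu, by simp [h]⟩
  obtain ⟨v, hv⟩ := exists_isFrame (U := U ⊓ LinearMap.ker l) rfl
  have hun : u ∉ U ⊓ LinearMap.ker l := by
    rintro ⟨-, h⟩
    rw [SetLike.mem_coe, LinearMap.mem_ker, hlu] at h
    exact one_ne_zero h
  have hU' : (U ⊓ LinearMap.ker l) ⊔ Submodule.span ℂ {u} = U := by
    refine le_antisymm (sup_le inf_le_left (by simpa using hu)) fun w hw => ?_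
    rw [← sub_add_cancel w (l w • u)]
    refine Submodule.add_mem_sup ⟨U.sub_mem hw (U.smul_mem _ hu), ?_⟩
      (Submodule.smul_mem _ _ (Submodule.mem_span_singleton_self u))
    simp [hlu]
  obtain ⟨φ, hφ⟩ := exists_alternatingMap_ne_zero hv.1
  refine ⟨_, AlternatingMap.alternatizeUncurryFin (l.smulRight φ),
    ⟨_, hU' ▸ hv.cons hun, ?_⟩, fun V hV w hw => ?_⟩
  · have h0 : ∀ j, l (v j) = 0 := fun j => by
      have : v j ∈ U ⊓ LinearMap.ker l := by
        rw [← hv.2]; exact Submodule.subset_span ⟨j, rfl⟩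
      exact this.2
    rw [AlternatingMap.alternatizeUncurryFin_apply, Fin.sum_univ_succ]
    simpa [h0, hlu] using hφ
  · rw [AlternatingMap.alternatizeUncurryFin_apply]
    refine Finset.sum_eq_zero fun j _ => ?_
    have : l (w j) = 0 := hV _ (hw.2 ▸ Submodule.subset_span ⟨j, rfl⟩)
    simp [this]

/-- Multilinear expansion exhibits the value as a polynomial in `s`. -/
theorem continuous_alternatingMap_add_smul (φ : M [⋀^Fin k]→ₗ[ℂ] ℂ) (v w : Fin k → M) :
    Continuous fun s : ℂ => φ (v + s • w) := by
  have h : ∀ s : ℂ, φ (v + s • w) = ∑ t : Finset (Fin k),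
      s ^ (tᶜ).card * φ (t.piecewise v w) := by
    intro s
    have h1 := φ.toMultilinearMap.map_add_univ v (s • w)
    simp only [AlternatingMap.coe_multilinearMap] at h1
    rw [h1]
    refine Finset.sum_congr rfl fun t _ => ?_
    have h2 : t.piecewise v (s • w) = tᶜ.piecewise (fun i => s • t.piecewise v w i)
        (t.piecewise v w) := by
      ext1 i
      by_cases hi : i ∈ t <;> simp [Finset.piecewise, hi]
    rw [h2]
    have h3 := φ.toMultilinearMap.map_piecewise_smul (fun _ => s) (t.piecewise v w) tᶜ
    simp only [AlternatingMap.coe_multilinearMap] at h3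
    rw [h3]
    simp
  simp only [h]
  fun_prop

/-- A one-parameter family of linear automorphisms of the form `1 + s E` moves a subspace along
a curve in the Grassmannian, which is continuous from the classical to the Zariski topology. -/
theorem continuous_map_one_add_smul [FiniteDimensional ℂ M] (E : M →ₗ[ℂ] M) (hE : ∀ u, E (E u) = 0)
    (U : Submodule ℂ M) :
    @Continuous _ _ _ (grassmannianTop M) fun s : ℂ => U.map (LinearMap.id + s • E) := by
  have hinj : ∀ s : ℂ, ∀ u : M, (LinearMap.id + s • E : M →ₗ[ℂ] M) u = 0 → u = 0 := by
    intro s u h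
    have h1 : u + s • E u = 0 := h
    -- Applying `E` to `u + s E u = 0` gives `E u = 0`, because `E² = 0`; hence `u = 0`.
    have h2 := congrArg E h1
    rw [map_add, map_smul, hE, smul_zero, add_zero, map_zero] at h2
    rwa [h2, smul_zero, add_zero] at h1
  refine continuous_generateFrom_iff.2 ?_
  rintro _ ⟨l, d, F, hF, rfl⟩
  by_cases hl : Module.finrank ℂ U = l
  · obtain ⟨v, hv⟩ := exists_isFrame hl
    have h : (fun s : ℂ => U.map (LinearMap.id + s • E)) ⁻¹' basicOpen F =
        {s : ℂ | evalAt (v + s • (E ∘ v)) F ≠ 0} := by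
      ext s
      rw [Set.mem_preimage, (hv.map _ fun u _ => hinj s u).mem_basicOpen hF]
      rfl
    rw [h]
    refine isOpen_ne_fun ?_ continuous_const
    unfold evalAt
    simp only [MvPolynomial.eval_eq]
    exact continuous_finsetSum _ fun d _ => continuous_const.mul <| continuous_finsetProd _
      fun φ _ => (continuous_alternatingMap_add_smul φ v (E ∘ v)).pow _
  · convert! isOpen_empty
    rw [Set.eq_empty_iff_forall_notMem]
    rintro s ⟨w, hw, _⟩
    obtain ⟨v, hv⟩ := exists_isFrame (U := U) rfl
    exact hl ((hv.map _ fun u _ => hinj s u).finrank_eq.symm.trans hw.finrank_eq)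

end GrassmannianTopology

/-! ## Windows of lattices -/

section Windows

variable {m : ℕ}

theorem coeff_T_mul (n : ℤ) (f : ℂ[T;T⁻¹]) (l : ℤ) :
    (LaurentPolynomial.T n * f).coeff l = f.coeff (l - n) := by
  induction f using LaurentPolynomial.induction_on' with
  | add p q hp hq =>
    rw [mul_add, AddMonoidAlgebra.coeff_add, AddMonoidAlgebra.coeff_add, Finsupp.add_apply,
      Finsupp.add_apply, hp, hq]
  | C_mul_T j a =>
    rw [← mul_assoc, mul_comm (LaurentPolynomial.T n), mul_assoc, ← LaurentPolynomial.T_add,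
      ← LaurentPolynomial.single_eq_C_mul_T, ← LaurentPolynomial.single_eq_C_mul_T]
    simp only [AddMonoidAlgebra.coeff_single, Finsupp.single_apply]
    congr 1
    apply propext
    omega

theorem coeff_C_mul (a : ℂ) (f : ℂ[T;T⁻¹]) (l : ℤ) :
    (LaurentPolynomial.C a * f).coeff l = a * f.coeff l := by
  rw [← LaurentPolynomial.smul_eq_C_mul]
  simp

theorem coeff_smul_T (a : ℂ) (n l : ℤ) :
    (a • (LaurentPolynomial.T n : ℂ[T;T⁻¹])).coeff l = if n = l then a else 0 := by
  simp

theorem mem_coordLattice {c : Fin m → ℤ} {v : LoopSpace m} :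
    v ∈ coordLattice c ↔ ∀ i, ∀ l < c i, (v i).coeff l = 0 := Iff.rfl

theorem mem_stdLattice {a : ℤ} {v : LoopSpace m} :
    v ∈ stdLattice m a ↔ ∀ i, ∀ l < a, (v i).coeff l = 0 := Iff.rfl

theorem stdLattice_anti {a b : ℤ} (h : a ≤ b) : stdLattice m b ≤ stdLattice m a :=
  fun _ hv i l hl => hv i l (hl.trans_le h)

/-- The coefficients at `t^l`, `a ≤ l < a + N`. -/
def win (m : ℕ) (a : ℤ) (N : ℕ) : LoopSpace m →ₗ[ℂ] (Fin m × Fin N → ℂ) where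
  toFun v x := (v x.1).coeff (a + x.2)
  map_add' v w := by ext x; simp
  map_smul' a v := by ext x; simp

theorem win_apply (a : ℤ) (N : ℕ) (v : LoopSpace m) (x : Fin m × Fin N) :
    win m a N v x = (v x.1).coeff (a + x.2) := rfl

theorem window_eq_win (m n : ℕ) : window m n = win m (-n) (2 * n) := by
  refine LinearMap.ext fun v => funext fun x => ?_
  change (v x.1).coeff _ = (v x.1).coeff _
  congr 1
  ring

/-- The section of `win` with values in the span of the `t^l`, `a ≤ l < a + N`. -/
def sec (m : ℕ) (a : ℤ) (N : ℕ) : (Fin m × Fin N → ℂ) →ₗ[ℂ] LoopSpace m where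
  toFun x i := ∑ l : Fin N, x (i, l) • LaurentPolynomial.T (a + l)
  map_add' v w := by ext1 i; simp [add_smul, Finset.sum_add_distrib]
  map_smul' a v := by ext1 i; simp [mul_smul, Finset.smul_sum]

theorem coeff_sec {a : ℤ} {N : ℕ} (x : Fin m × Fin N → ℂ) (i : Fin m) (l : ℤ) :
    (sec m a N x i).coeff l = ∑ j : Fin N, if a + j = l then x (i, j) else 0 := by
  change (∑ j : Fin N, x (i, j) • LaurentPolynomial.T (a + j) : ℂ[T;T⁻¹]).coeff l = _
  rw [AddMonoidAlgebra.coeff_sum, Finsupp.finsetSum_apply]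
  simp only [coeff_smul_T]

theorem coeff_sec_add {a : ℤ} {N : ℕ} (x : Fin m × Fin N → ℂ) (i : Fin m) (j : Fin N) :
    (sec m a N x i).coeff (a + j) = x (i, j) := by
  rw [coeff_sec, Finset.sum_eq_single j]
  · simp
  · intro b _ hb
    rw [if_neg]
    intro h
    exact hb (Fin.ext (by omega))
  · simp

theorem coeff_sec_of_lt {a : ℤ} {N : ℕ} (x : Fin m × Fin N → ℂ) (i : Fin m) {l : ℤ} (h : l < a) :
    (sec m a N x i).coeff l = 0 := by
  rw [coeff_sec]
  exact Finset.sum_eq_zero fun j _ => if_neg (by omega)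

theorem coeff_sec_of_ge {a : ℤ} {N : ℕ} (x : Fin m × Fin N → ℂ) (i : Fin m) {l : ℤ}
    (h : a + N ≤ l) : (sec m a N x i).coeff l = 0 := by
  rw [coeff_sec]
  exact Finset.sum_eq_zero fun j _ => if_neg (by omega)

theorem win_sec (a : ℤ) (N : ℕ) (x : Fin m × Fin N → ℂ) : win m a N (sec m a N x) = x := by
  funext y
  rw [win_apply, coeff_sec_add]

theorem sec_mem (a : ℤ) (N : ℕ) (x : Fin m × Fin N → ℂ) : sec m a N x ∈ stdLattice m a :=
  fun i _ hl => coeff_sec_of_lt x i hl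

theorem win_eq_zero {a : ℤ} {N : ℕ} {v : LoopSpace m} (hv : v ∈ stdLattice m (a + N)) :
    win m a N v = 0 := by
  funext x
  exact mem_stdLattice.1 hv x.1 _ (by omega)

theorem mem_of_win_eq_zero {a : ℤ} {N : ℕ} {v : LoopSpace m} (hv : v ∈ stdLattice m a)
    (h : win m a N v = 0) : v ∈ stdLattice m (a + N) := by
  refine mem_stdLattice.2 fun i l hl => ?_
  by_cases hla : l < a
  · exact hv i l hla
  · have := congrFun h (i, ⟨(l - a).toNat, by omega⟩)
    rw [win_apply] at this
    have e : a + ((l - a).toNat : ℤ) = l := by omega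
    rwa [e] at this

theorem sub_sec_win_mem {a : ℤ} {N : ℕ} {v : LoopSpace m} (hv : v ∈ stdLattice m a) :
    v - sec m a N (win m a N v) ∈ stdLattice m (a + N) :=
  mem_of_win_eq_zero (Submodule.sub_mem _ hv (sec_mem _ _ _)) (by rw [map_sub, win_sec, sub_self])

/-- The lattice `L` lies between `t^(a+N)` and `t^a`. -/
def InWindow (a : ℤ) (N : ℕ) (L : Submodule ℂ (LoopSpace m)) : Prop :=
  stdLattice m (a + N) ≤ L ∧ L ≤ stdLattice m a

theorem InWindow.mono {a a' : ℤ} {N N' : ℕ} {L : Submodule ℂ (LoopSpace m)}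
    (h : InWindow a N L) (ha : a' ≤ a) (hN : a + N ≤ a' + N') : InWindow a' N' L :=
  ⟨(stdLattice_anti hN).trans h.1, h.2.trans (stdLattice_anti ha)⟩

theorem InWindow.sec_win_mem {a : ℤ} {N : ℕ} {L : Submodule ℂ (LoopSpace m)}
    (h : InWindow a N L) {v : LoopSpace m} (hv : v ∈ L) : sec m a N (win m a N v) ∈ L := by
  have := L.sub_mem hv (h.1 (sub_sec_win_mem (h.2 hv)))
  rwa [sub_sub_cancel] at this

theorem InWindow.mem_map_win {a : ℤ} {N : ℕ} {L : Submodule ℂ (LoopSpace m)}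
    (h : InWindow a N L) {x : Fin m × Fin N → ℂ} : x ∈ L.map (win m a N) ↔ sec m a N x ∈ L := by
  constructor
  · rintro ⟨v, hv, rfl⟩
    exact h.sec_win_mem hv
  · intro hx
    exact ⟨_, hx, win_sec _ _ _⟩

theorem InWindow.mem_iff {a : ℤ} {N : ℕ} {L : Submodule ℂ (LoopSpace m)}
    (h : InWindow a N L) {v : LoopSpace m} (hv : v ∈ stdLattice m a) :
    v ∈ L ↔ win m a N v ∈ L.map (win m a N) := by
  refine ⟨fun h => ⟨v, h, rfl⟩, fun hw => ?_⟩
  rw [h.mem_map_win] at hw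
  have := L.add_mem hw (h.1 (sub_sec_win_mem hv))
  rwa [add_sub_cancel] at this

theorem InWindow.eq_of_map_win_eq {a : ℤ} {N : ℕ} {L L' : Submodule ℂ (LoopSpace m)}
    (h : InWindow a N L) (h' : InWindow a N L')
    (e : L.map (win m a N) = L'.map (win m a N)) : L = L' := by
  ext v
  constructor
  · intro hv
    rw [h'.mem_iff (h.2 hv), ← e]
    exact ⟨v, hv, rfl⟩
  · intro hv
    rw [h.mem_iff (h'.2 hv), e]
    exact ⟨v, hv, rfl⟩

/-- The lattice with a given window. -/
def latticeOf (a : ℤ) (N : ℕ) (U : Submodule ℂ (Fin m × Fin N → ℂ)) :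
    Submodule ℂ (LoopSpace m) := stdLattice m a ⊓ U.comap (win m a N)

theorem latticeOf_inWindow (a : ℤ) (N : ℕ) (U : Submodule ℂ (Fin m × Fin N → ℂ)) :
    InWindow a N (latticeOf a N U) := by
  refine ⟨fun v hv => ⟨stdLattice_anti (by omega) hv, ?_⟩, inf_le_left⟩
  change win m a N v ∈ U
  rw [win_eq_zero hv]
  exact U.zero_mem

theorem map_win_latticeOf (a : ℤ) (N : ℕ) (U : Submodule ℂ (Fin m × Fin N → ℂ)) :
    (latticeOf a N U).map (win m a N) = U := by
  ext x
  rw [(latticeOf_inWindow a N U).mem_map_win]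
  refine ⟨fun h => ?_, fun h => ⟨sec_mem _ _ _, ?_⟩⟩
  · have := h.2
    rwa [SetLike.mem_coe, Submodule.mem_comap, win_sec] at this
  · rwa [SetLike.mem_coe, Submodule.mem_comap, win_sec]

/-- The larger window of `ℓ y` is the image of the smaller one plus all coordinates of exponent at
least `a + N`. The latter are contained in every `ℓ y`, so they form a fixed complement. -/
theorem pluckerEquiv_win_of_subset {Y : Type*} {ℓ : Y → Submodule ℂ (LoopSpace m)} {a a' : ℤ}
    {N N' k : ℕ} (ha : a' ≤ a) (hN : a + N ≤ a' + N') (hℓ : ∀ y, InWindow a N (ℓ y))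
    (hk : ∀ y, Module.finrank ℂ ((ℓ y).map (win m a N)) = k) :
    PluckerEquiv k
      (k + (Finset.univ.filter fun x : Fin m × Fin N' => a + N ≤ a' + x.2).card)
      (fun y => (ℓ y).map (win m a N)) fun y => (ℓ y).map (win m a' N') := by
  let s : Finset (Fin m × Fin N') := Finset.univ.filter fun x => a + N ≤ a' + x.2
  let ι := win m a' N' ∘ₗ sec m a N
  have h1 : PluckerEquiv k k (fun y => (ℓ y).map (win m a N))
      fun y => ((ℓ y).map (win m a N)).map ι := by
    refine PluckerEquiv.map hk ι (win m a N ∘ₗ sec m a' N') (fun x => ?_) fun y => rfl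
    have h := stdLattice_anti hN (sub_sec_win_mem (N := N') (stdLattice_anti ha (sec_mem a N x)))
    have h2 := win_eq_zero h
    rw [map_sub, win_sec, sub_eq_zero] at h2
    exact h2.symm
  have h1k : ∀ y, Module.finrank ℂ (((ℓ y).map (win m a N)).map ι) = k := h1.1.finrank_eq_right
  have h2 : (fun y => (ℓ y).map (win m a' N')) =
      fun y => ((ℓ y).map (win m a N)).map ι ⊔ coordSpace s := by
    funext y
    refine le_antisymm ?_ (sup_le ?_ ?_)
    · rintro _ ⟨v, hv, rfl⟩
      have : win m a' N' v = ι (win m a N v) + win m a' N' (v - sec m a N (win m a N v)) := by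
        change _ = win m a' N' (sec m a N (win m a N v)) + _
        rw [← map_add, add_sub_cancel]
      rw [this]
      refine Submodule.add_mem_sup ⟨_, ⟨v, hv, rfl⟩, rfl⟩ (mem_coordSpace.2 fun x hx => ?_)
      refine sub_sec_win_mem ((hℓ y).2 hv) _ _ ?_
      simpa [s] using hx
    · rintro _ ⟨_, ⟨v, hv, rfl⟩, rfl⟩
      exact ⟨_, (hℓ y).sec_win_mem hv, rfl⟩
    · intro x hx
      refine ⟨sec m a' N' x, (hℓ y).1 (mem_stdLattice.2 fun i l hl => ?_), win_sec _ _ _⟩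
      rw [coeff_sec]
      refine Finset.sum_eq_zero fun j _ => ?_
      split_ifs with hj
      · refine mem_coordSpace.1 hx _ ?_
        simp only [s, Finset.mem_filter, Finset.mem_univ, true_and]
        omega
      · rfl
  rw [h2]
  obtain ⟨h3, h4, -⟩ := PluckerDom.sup_coordSpace h1k s (by
    rintro y _ ⟨x, hx, rfl⟩ z hz
    refine coeff_sec_of_ge _ _ ?_
    simpa [s] using hz)
  exact h1.trans ⟨h3, h4⟩

theorem pluckerEquiv_win {Y : Type*} {ℓ : Y → Submodule ℂ (LoopSpace m)} {a a' : ℤ}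
    {N N' k k' : ℕ} (hℓ : ∀ y, InWindow a N (ℓ y)) (hℓ' : ∀ y, InWindow a' N' (ℓ y))
    (hk : ∀ y, Module.finrank ℂ ((ℓ y).map (win m a N)) = k)
    (hk' : ∀ y, Module.finrank ℂ ((ℓ y).map (win m a' N')) = k') :
    PluckerEquiv k k' (fun y => (ℓ y).map (win m a N)) fun y => (ℓ y).map (win m a' N') := by
  let b := min a a'
  let R := (max (a + N) (a' + N') - b).toNat
  have h1 := pluckerEquiv_win_of_subset (a' := b) (N' := R) (by omega) (by omega) hℓ hk
  have h2 := pluckerEquiv_win_of_subset (a' := b) (N' := R) (by omega) (by omega) hℓ' hk'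
  -- Both windows are compared with one containing them. The two values obtained for the dimension
  -- there agree because they are the dimension at a point; an empty family needs no comparison.
  by_cases hY : Nonempty Y
  · obtain ⟨y⟩ := hY
    rw [← h1.1.finrank_eq_right y, h2.1.finrank_eq_right y] at h1
    exact h1.trans h2.symm
  · exact ⟨⟨fun _ => 0, fun y => (hY ⟨y⟩).elim⟩, ⟨fun _ => 0, fun y => (hY ⟨y⟩).elim⟩⟩

end Windows

/-! ## The action of the loop group on lattices -/

section Action

variable {m b : ℕ}

theorem mem_translate {g : LoopSL m} {L : Submodule ℂ (LoopSpace m)} {v : LoopSpace m} :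
    v ∈ translate g L ↔ ∃ w ∈ L, g.1.mulVec w = v := Iff.rfl

theorem translate_one (L : Submodule ℂ (LoopSpace m)) : translate 1 L = L := by
  ext v
  simp [mem_translate]

theorem translate_mono (g : LoopSL m) {L L' : Submodule ℂ (LoopSpace m)} (h : L ≤ L') :
    translate g L ≤ translate g L' := Submodule.map_mono h

theorem translate_inv_eq_iff {g : LoopSL m} {L L' : Submodule ℂ (LoopSpace m)} :
    translate g⁻¹ L = L' ↔ L = translate g L' := by
  constructor
  · rintro rfl
    rw [← translate_mul, mul_inv_cancel, translate_one]
  · rintro rfl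
    rw [← translate_mul, inv_mul_cancel, translate_one]

theorem mulVec_mem_stdLattice {g : Matrix (Fin m) (Fin m) ℂ[T;T⁻¹]} (hg : ∀ i j, OrdGE 0 (g i j))
    {a : ℤ} {v : LoopSpace m} (hv : v ∈ stdLattice m a) : g.mulVec v ∈ stdLattice m a := by
  intro i
  refine OrdGE.sum (s := Finset.univ) (f := fun j => g i j * v j) fun j _ => ?_
  have := (hg i j).mul (hv j)
  rwa [zero_add] at this

theorem iwahori_ordGE {g : LoopSL m} (hg : g ∈ iwahori m) (i j : Fin m) : OrdGE 0 (g.1 i j) :=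
  ((hg i j).1).mono (by dsimp only; split_ifs <;> simp)

theorem translate_stdLattice {g : LoopSL m} (hg : g ∈ iwahori m) (a : ℤ) :
    translate g (stdLattice m a) = stdLattice m a := by
  have key : ∀ g ∈ iwahori m, translate g (stdLattice m a) ≤ stdLattice m a := by
    rintro g hg _ ⟨v, hv, rfl⟩
    exact mulVec_mem_stdLattice (iwahori_ordGE hg) hv
  refine le_antisymm (key g hg) ?_
  have := translate_mono g (key g⁻¹ (inv_mem hg))
  rwa [← translate_mul, mul_inv_cancel, translate_one] at this

theorem InWindow.translate {g : LoopSL m} (hg : g ∈ iwahori m) {a : ℤ} {N : ℕ}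
    {L : Submodule ℂ (LoopSpace m)} (h : InWindow a N L) : InWindow a N (translate g L) := by
  have h1 := translate_mono g h.1
  have h2 := translate_mono g h.2
  rw [translate_stdLattice hg] at h1 h2
  exact ⟨h1, h2⟩

/-- The action of an element of the Iwahori subgroup on a window. -/
def windowAction (g : LoopSL m) (a : ℤ) (N : ℕ) : (Fin m × Fin N → ℂ) →ₗ[ℂ] (Fin m × Fin N → ℂ) :=
  win m a N ∘ₗ (Matrix.mulVecLin g.1).restrictScalars ℂ ∘ₗ sec m a N

/-- Since `g` preserves `t^(a+N)`, the part of `v` beyond the window contributes nothing to the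
window of `g v`. -/
theorem windowAction_win {g : LoopSL m} (hg : g ∈ iwahori m) {a : ℤ} {N : ℕ} {v : LoopSpace m}
    (hv : v ∈ stdLattice m a) :
    windowAction g a N (win m a N v) = win m a N (g.1.mulVec v) := by
  have h := win_eq_zero (mulVec_mem_stdLattice (iwahori_ordGE hg) (sub_sec_win_mem (N := N) hv))
  rw [Matrix.mulVec_sub, map_sub, sub_eq_zero] at h
  exact h.symm

theorem windowAction_inv {g : LoopSL m} (hg : g ∈ iwahori m) (a : ℤ) (N : ℕ)
    (x : Fin m × Fin N → ℂ) : windowAction g⁻¹ a N (windowAction g a N x) = x := by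
  have h := windowAction_win (inv_mem hg) (N := N)
    (mulVec_mem_stdLattice (iwahori_ordGE hg) (sec_mem a N x))
  rw [Matrix.mulVec_mulVec, ← Matrix.SpecialLinearGroup.coe_mul, inv_mul_cancel,
    Matrix.SpecialLinearGroup.coe_one, Matrix.one_mulVec, win_sec] at h
  exact h

theorem map_win_translate {g : LoopSL m} (hg : g ∈ iwahori m) {a : ℤ} {N : ℕ}
    {L : Submodule ℂ (LoopSpace m)} (hL : L ≤ stdLattice m a) :
    (translate g L).map (win m a N) = (L.map (win m a N)).map (windowAction g a N) := by
  ext x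
  constructor
  · rintro ⟨_, ⟨v, hv, rfl⟩, rfl⟩
    exact ⟨_, ⟨v, hv, rfl⟩, windowAction_win hg (hL hv)⟩
  · rintro ⟨_, ⟨v, hv, rfl⟩, rfl⟩
    exact ⟨_, ⟨v, hv, rfl⟩, (windowAction_win hg (hL hv)).symm⟩

theorem finrank_map_win_translate {g : LoopSL m} (hg : g ∈ iwahori m) {a : ℤ} {N : ℕ}
    {L : Submodule ℂ (LoopSpace m)} (hL : L ≤ stdLattice m a) :
    Module.finrank ℂ ((translate g L).map (win m a N)) =
      Module.finrank ℂ (L.map (win m a N)) := by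
  rw [map_win_translate hg hL]
  exact (Submodule.equivMapOfInjective _
    (Function.LeftInverse.injective (windowAction_inv hg a N)) _).finrank_eq.symm

/-! ### Points of the affine flag variety as lattices -/

theorem mk_surjective (p : FlagVariety m b) : ∃ g, FlagVariety.mk g = p :=
  QuotientGroup.mk_surjective p

theorem lattice_mk (g : LoopSL m) :
    (FlagVariety.mk g : FlagVariety m b).lattice = translate g (coordLattice (fundExp m b)) := rfl

theorem smul_mk (g h : LoopSL m) :
    g • (FlagVariety.mk h : FlagVariety m b) = FlagVariety.mk (g * h) := rfl

theorem lattice_smul (g : LoopSL m) (p : FlagVariety m b) :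
    (g • p).lattice = translate g p.lattice := by
  obtain ⟨h, rfl⟩ := mk_surjective p
  rw [smul_mk, lattice_mk, lattice_mk, translate_mul]

/-- The basis vector `w_i ⊗ t^l`. -/
abbrev monom (i : Fin m) (l : ℤ) : LoopSpace m := Pi.single i (LaurentPolynomial.T l)

theorem coeff_monom (i j : Fin m) (n l : ℤ) :
    (monom i n j).coeff l = if j = i ∧ n = l then 1 else 0 := by
  by_cases hj : j = i
  · subst hj
    simp [monom]
  · simp [hj, monom]

theorem monom_mem_coordLattice {c : Fin m → ℤ} {i : Fin m} {n : ℤ} (h : c i ≤ n) :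
    monom i n ∈ coordLattice c := by
  intro j l hl
  rw [coeff_monom, if_neg]
  rintro ⟨rfl, rfl⟩
  omega

theorem coordLattice_le_iff {c c' : Fin m → ℤ} :
    coordLattice c ≤ coordLattice c' ↔ ∀ i, c' i ≤ c i := by
  constructor
  · intro h i
    by_contra hi
    have := h (monom_mem_coordLattice (le_refl (c i))) i (c i) (by omega)
    simp at this
  · intro h v hv i l hl
    exact hv i l (hl.trans_le (h i))

theorem inWindow_coordLattice_iff {c : Fin m → ℤ} {a : ℤ} {N : ℕ} :
    InWindow a N (coordLattice c) ↔ ∀ i, a ≤ c i ∧ c i ≤ a + N := by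
  unfold InWindow stdLattice
  rw [coordLattice_le_iff, coordLattice_le_iff]
  exact ⟨fun h i => ⟨h.2 i, h.1 i⟩, fun h => ⟨fun i => (h i).2, fun i => (h i).1⟩⟩

/-- The image of `w_j ⊗ t^(c j)` is `t^(c j)` times column `j` of `g`, so the orders of the entries
can be read off from it. -/
theorem ordGE_of_translate_coordLattice_le {c c' : Fin m → ℤ} {g : LoopSL m}
    (h : translate g (coordLattice c) ≤ coordLattice c') (i j : Fin m) :
    OrdGE (c' i - c j) (g.1 i j) := by
  intro l hl
  have h1 := h ⟨_, monom_mem_coordLattice (le_refl (c j)), rfl⟩ i (l + c j) (by omega)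
  have h2 : (g.1.mulVec (monom j (c j))) i =
      LaurentPolynomial.T (c j) * g.1 i j := by
    rw [Matrix.mulVec_single, mul_comm]
    rfl
  have h3 := coeff_T_mul (c j) (g.1 i j) (l + c j)
  rw [← h2, add_sub_cancel_right] at h3
  rw [← h3]
  exact h1

/-- The stabilizer of `L_b` is `P_b`: the order bounds for `g⁻¹ g'` and its inverse, both of which
preserve `L_b`, are the definition of `parahoric`. -/
theorem lattice_injective : Function.Injective (FlagVariety.lattice (m := m) (b := b)) := by
  intro p q h
  obtain ⟨g, rfl⟩ := mk_surjective p
  obtain ⟨g', rfl⟩ := mk_surjective q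
  refine QuotientGroup.eq.2 ?_
  rw [lattice_mk, lattice_mk] at h
  have h1 : translate (g⁻¹ * g') (coordLattice (fundExp m b)) = coordLattice (fundExp m b) := by
    rw [translate_mul, ← h, ← translate_mul, inv_mul_cancel, translate_one]
  have h2 : translate (g⁻¹ * g')⁻¹ (coordLattice (fundExp m b)) = coordLattice (fundExp m b) := by
    rw [translate_inv_eq_iff, h1]
  exact fun i j => ⟨ordGE_of_translate_coordLattice_le h1.le i j,
    ordGE_of_translate_coordLattice_le h2.le i j⟩

/-- Stability under multiplication by `t`. -/
def TStable (L : Submodule ℂ (LoopSpace m)) : Prop :=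
  ∀ v ∈ L, (fun i => LaurentPolynomial.T 1 * v i : LoopSpace m) ∈ L

theorem coordLattice_tStable (c : Fin m → ℤ) : TStable (coordLattice c) := by
  intro v hv i l hl
  rw [coeff_T_mul]
  exact hv i _ (by omega)

theorem TStable.translate {L : Submodule ℂ (LoopSpace m)} (h : TStable L) (g : LoopSL m) :
    TStable (translate g L) := by
  rintro _ ⟨v, hv, rfl⟩
  refine ⟨_, h v hv, ?_⟩
  exact Matrix.mulVec_smul g.1 (LaurentPolynomial.T 1 : ℂ[T;T⁻¹]) v

theorem lattice_tStable (p : FlagVariety m b) : TStable p.lattice := by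
  obtain ⟨g, rfl⟩ := mk_surjective p
  exact (coordLattice_tStable _).translate g

end Action

/-! ## Reduced echelon form of lattices -/

section Echelon

variable {m : ℕ}

/-- The position of `w_i ⊗ t^l` in the order for which the Iwahori subgroup is triangular. -/
def key (i : Fin m) (l : ℤ) : ℤ := l * m + (m - 1 - (i : ℕ))

/-- All the terms of `v` have position at least `K`. -/
def KeyGE (K : ℤ) (v : LoopSpace m) : Prop := ∀ i l, key i l < K → (v i).coeff l = 0

/-- The power of `t` dominates the order, so the multiples of `m` are the thresholds at which the
lattices `ℂ^m ⊗ t^A ℂ[t]` begin. -/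
theorem key_lt_iff (i : Fin m) (l A : ℤ) : key i l < A * m ↔ l < A := by
  have hi := i.2
  unfold key
  constructor
  · intro h
    by_contra hl
    nlinarith [mul_le_mul_of_nonneg_right (not_lt.1 hl) (Int.natCast_nonneg m)]
  · intro h
    have : (l + 1) * m ≤ A * m := mul_le_mul_of_nonneg_right (by omega) (by omega)
    have e : (l + 1) * (m : ℤ) = l * m + m := by ring
    omega

theorem key_injective {i j : Fin m} {l n : ℤ} (h : key i l = key j n) : i = j ∧ l = n := by
  have h1 := key_lt_iff i l (n + 1)
  have h2 := key_lt_iff j n (l + 1)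
  have h3 := key_lt_iff i l (l + 1)
  have h4 := key_lt_iff j n (n + 1)
  rw [h] at h1 h3
  have hl : l = n := by
    have := h1.1 (h4.2 (by omega))
    have := h2.1 (h3.2 (by omega))
    omega
  subst hl
  unfold key at h
  exact ⟨Fin.ext (by omega), rfl⟩

theorem key_surjective (hm : 0 < m) (K : ℤ) : ∃ (i : Fin m) (l : ℤ), key i l = K := by
  have h1 := Int.emod_nonneg K (b := m) (by omega)
  have h2 := Int.emod_lt_of_pos K (b := m) (by omega)
  refine ⟨⟨(m - 1 - K % m).toNat, by omega⟩, K / m, ?_⟩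
  have h3 := Int.ediv_mul_add_emod K m
  unfold key
  simp only
  omega

theorem key_add (i : Fin m) (l n : ℤ) : key i (l + n) = key i l + n * m := by
  unfold key
  ring

theorem keyGE_mul_iff {A : ℤ} {v : LoopSpace m} : KeyGE (A * m) v ↔ v ∈ stdLattice m A := by
  simp only [KeyGE, key_lt_iff]
  rfl

theorem KeyGE.mono {K K' : ℤ} {v : LoopSpace m} (h : KeyGE K' v) (hK : K ≤ K') : KeyGE K v :=
  fun i l hl => h i l (by omega)

theorem KeyGE.add {K : ℤ} {v w : LoopSpace m} (hv : KeyGE K v) (hw : KeyGE K w) :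
    KeyGE K (v + w) := fun i l hl => by simp [hv i l hl, hw i l hl]

theorem KeyGE.sub {K : ℤ} {v w : LoopSpace m} (hv : KeyGE K v) (hw : KeyGE K w) :
    KeyGE K (v - w) := fun i l hl => by simp [hv i l hl, hw i l hl]

theorem KeyGE.smul {K : ℤ} {v : LoopSpace m} (hv : KeyGE K v) (a : ℂ) :
    KeyGE K (a • v) := fun i l hl => by simp [hv i l hl]

theorem KeyGE.succ {i : Fin m} {l : ℤ} {v : LoopSpace m} (hv : KeyGE (key i l) v)
    (h : (v i).coeff l = 0) : KeyGE (key i l + 1) v := by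
  intro j n hn
  by_cases e : key j n = key i l
  · obtain ⟨rfl, rfl⟩ := key_injective e
    exact h
  · exact hv j n (by omega)

theorem keyGE_monom (i : Fin m) (l : ℤ) :
    KeyGE (key i l) (monom i l) := by
  intro j n hn
  rw [coeff_monom, if_neg]
  rintro ⟨rfl, rfl⟩
  omega

/-- The subspace `L` contains a vector with leading term `w_i ⊗ t^l`. -/
def IsLead (L : Submodule ℂ (LoopSpace m)) (i : Fin m) (l : ℤ) : Prop :=
  ∃ w ∈ L, KeyGE (key i l) w ∧ (w i).coeff l = 1

theorem IsLead.of_ne_zero {L : Submodule ℂ (LoopSpace m)} {i : Fin m} {l : ℤ} {w : LoopSpace m}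
    (hw : w ∈ L) (h : KeyGE (key i l) w) (h0 : (w i).coeff l ≠ 0) : IsLead L i l :=
  ⟨_, L.smul_mem ((w i).coeff l)⁻¹ hw, h.smul _, by simp [h0]⟩

theorem IsLead.succ {L : Submodule ℂ (LoopSpace m)} (hL : TStable L) {i : Fin m} {l : ℤ}
    (h : IsLead L i l) : IsLead L i (l + 1) := by
  obtain ⟨w, hw, h1, h2⟩ := h
  refine ⟨_, hL w hw, fun j n hn => ?_, ?_⟩
  · rw [coeff_T_mul]
    refine h1 j _ ?_
    rw [key_add] at hn
    rw [sub_eq_add_neg, key_add]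
    omega
  · rw [coeff_T_mul, add_sub_cancel_right, h2]

theorem IsLead.of_le {L : Submodule ℂ (LoopSpace m)} (hL : TStable L) {i : Fin m} {l n : ℤ}
    (h : IsLead L i l) (hn : l ≤ n) : IsLead L i n := by
  induction n, hn using Int.leInduction with
  | base => exact h
  | succ n _ ih => exact ih.succ hL

/-- Gaussian elimination from the lowest position upwards. It stops because all vectors starting at
position `A * m` or later lie in `L`; `n` bounds the number of positions before that. -/
theorem exists_reduction (hm : 0 < m) {A : ℤ} {c : Fin m → ℤ} {L : Submodule ℂ (LoopSpace m)}
    (hA : stdLattice m A ≤ L) (hlead : ∀ i l, c i ≤ l → IsLead L i l) (n : ℕ) :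
    ∀ (K : ℤ), A * m - n ≤ K → ∀ v : LoopSpace m, KeyGE K v →
      ∃ a ∈ L, KeyGE K a ∧ ∀ i l, c i ≤ l → ((v - a) i).coeff l = 0 := by
  induction n with
  | zero =>
    intro K hK v hv
    exact ⟨v, hA (keyGE_mul_iff.1 (hv.mono (by simpa using hK))), hv, by simp⟩
  | succ n ih =>
    intro K hK v hv
    obtain ⟨i, l, rfl⟩ := key_surjective hm K
    by_cases hl : c i ≤ l
    · obtain ⟨w, hw, h1, h2⟩ := hlead i l hl
      obtain ⟨a, ha, ha1, ha2⟩ := ih (key i l + 1) (by push_cast at hK; omega)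
        (v - (v i).coeff l • w) ((hv.sub (h1.smul _)).succ (by simp [h2]))
      refine ⟨a + (v i).coeff l • w, L.add_mem ha (L.smul_mem _ hw),
        (ha1.mono (by omega)).add (h1.smul _), fun j k hk => ?_⟩
      rw [← ha2 j k hk, add_comm, sub_add_eq_sub_sub]
    -- No leading monomial is required here, so this term is left in the remainder; it is subtracted
    -- only to apply the induction to the tail.
    · obtain ⟨a, ha, ha1, ha2⟩ := ih (key i l + 1) (by push_cast at hK; omega)
        (v - (v i).coeff l • monom i l)
        ((hv.sub ((keyGE_monom i l).smul _)).succ (by simp))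
      refine ⟨a, ha, ha1.mono (by omega), fun j k hk => ?_⟩
      have h := ha2 j k hk
      have h3 : (monom i l j).coeff k = 0 := by
        rw [coeff_monom, if_neg]
        rintro ⟨rfl, rfl⟩
        exact hl hk
      simpa [h3] using h

theorem TStable.smul_mem {L : Submodule ℂ (LoopSpace m)} (hL : TStable L) {v : LoopSpace m}
    (hv : v ∈ L) {f : ℂ[T;T⁻¹]} (hf : OrdGE 0 f) : f • v ∈ L := by
  have hT : ∀ n : ℤ, 0 ≤ n → (LaurentPolynomial.T n : ℂ[T;T⁻¹]) • v ∈ L := by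
    intro n hn
    induction n, hn using Int.leInduction with
    | base => simpa using hv
    | succ n _ ih =>
      have := hL _ ih
      rw [add_comm, LaurentPolynomial.T_add, mul_smul]
      exact this
  have e : f = ∑ l ∈ f.coeff.support, f.coeff l • LaurentPolynomial.T l := by
    apply LaurentPolynomial.ext
    intro a
    rw [AddMonoidAlgebra.coeff_sum, Finsupp.finsetSum_apply]
    simp only [coeff_smul_T]
    rw [Finset.sum_ite_eq']
    split_ifs with h
    · rfl
    · simpa using h
  rw [e, Finset.sum_smul]
  refine L.sum_mem fun l hl => ?_
  rw [smul_assoc]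
  refine L.smul_mem _ (hT l ?_)
  by_contra h
  exact (Finsupp.mem_support_iff.1 hl) (hf l (by omega))

/-! ### Unipotent matrices in the Iwahori order -/

/-- The order of the matrices with entries in `ℂ[t]` which are upper triangular modulo `t`. -/
def InIwahoriOrder (M : Matrix (Fin m) (Fin m) ℂ[T;T⁻¹]) : Prop :=
  ∀ i j, OrdGE (if j < i then 1 else 0) (M i j)

theorem InIwahoriOrder.one : InIwahoriOrder (1 : Matrix (Fin m) (Fin m) ℂ[T;T⁻¹]) :=
  fun i j => ((iwahori m).one_mem i j).1

theorem InIwahoriOrder.mul {M M' : Matrix (Fin m) (Fin m) ℂ[T;T⁻¹]} (h : InIwahoriOrder M)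
    (h' : InIwahoriOrder M') : InIwahoriOrder (M * M') := by
  intro i j
  rw [Matrix.mul_apply]
  exact OrdGE.sum fun l _ => ((h i l).mul (h' l j)).mono (by split_ifs <;> omega)

theorem InIwahoriOrder.add {M M' : Matrix (Fin m) (Fin m) ℂ[T;T⁻¹]} (h : InIwahoriOrder M)
    (h' : InIwahoriOrder M') : InIwahoriOrder (M + M') :=
  fun i j l hl => by simp [h i j l hl, h' i j l hl]

theorem InIwahoriOrder.pow {M : Matrix (Fin m) (Fin m) ℂ[T;T⁻¹]} (h : InIwahoriOrder M) (n : ℕ) :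
    InIwahoriOrder (M ^ n) := by
  induction n with
  | zero => exact InIwahoriOrder.one
  | succ n ih => exact pow_succ M n ▸ ih.mul h

theorem InIwahoriOrder.sum {s : Finset ℕ} {M : ℕ → Matrix (Fin m) (Fin m) ℂ[T;T⁻¹]}
    (h : ∀ n, InIwahoriOrder (M n)) : InIwahoriOrder (∑ n ∈ s, M n) := by
  intro i j
  rw [Matrix.sum_apply]
  exact OrdGE.sum fun n _ => h n i j

theorem coe_inv_eq {g : LoopSL m} {H : Matrix (Fin m) (Fin m) ℂ[T;T⁻¹]} (h : g.1 * H = 1) :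
    g⁻¹.1 = H := by
  rw [← mul_one g⁻¹.1, ← h, ← mul_assoc, ← Matrix.SpecialLinearGroup.coe_mul, inv_mul_cancel,
    Matrix.SpecialLinearGroup.coe_one, one_mul]

/-- Grouping the indices by the value of `c` makes `1 + X` block triangular with identity diagonal
blocks. -/
theorem det_one_add_of_triangular {X : Matrix (Fin m) (Fin m) ℂ[T;T⁻¹]} {c : Fin m → ℤ}
    (h0 : ∀ i j, c i ≤ c j → X i j = 0) : (1 + X).det = 1 := by
  have ht : (1 + X).BlockTriangular fun i => - c i := by
    intro i j hij
    dsimp only at hij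
    rw [Matrix.add_apply, h0 i j (by omega), Matrix.one_apply_ne, add_zero]
    rintro rfl
    simp at hij
  rw [ht.det]
  refine Finset.prod_eq_one fun a _ => ?_
  have : (1 + X).toSquareBlock (fun i => - c i) a = 1 := by
    ext1 i j
    rw [Matrix.toSquareBlock_def, Matrix.of_apply, Matrix.add_apply,
      h0 i j (by have := i.2; have := j.2; omega), add_zero, Matrix.one_apply, Matrix.one_apply]
    simp only [Subtype.ext_iff]
  rw [this, Matrix.det_one]

/-- A nonzero entry `X i j` requires `c i > c j`, so each factor of a power accounts for a rise of
`c` by at least one. -/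
theorem pow_apply_eq_zero_of_triangular {X : Matrix (Fin m) (Fin m) ℂ[T;T⁻¹]} {c : Fin m → ℤ}
    (h0 : ∀ i j, c i ≤ c j → X i j = 0) (n : ℕ) : ∀ i j, c i < c j + n → (X ^ n) i j = 0 := by
  induction n with
  | zero =>
    intro i j hij
    rw [pow_zero, Matrix.one_apply_ne]
    rintro rfl
    simp at hij
  | succ n ih =>
    intro i j hij
    rw [pow_succ, Matrix.mul_apply]
    refine Finset.sum_eq_zero fun k _ => ?_
    by_cases h : c k ≤ c j
    · rw [h0 k j h, mul_zero]
    · rw [ih i k (by push_cast at hij; omega), zero_mul]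

theorem mem_iwahori_of_mul_eq_one {g : LoopSL m} {H : Matrix (Fin m) (Fin m) ℂ[T;T⁻¹]}
    (hg : InIwahoriOrder g.1) (hH : InIwahoriOrder H) (h : g.1 * H = 1) : g ∈ iwahori m := by
  intro i j
  rw [coe_inv_eq h]
  exact ⟨hg i j, hH i j⟩

/-- A unipotent matrix in the Iwahori order, strictly triangular with respect to some bounded
function `c`, belongs to the Iwahori subgroup. -/
theorem exists_iwahori_of_triangular {X : Matrix (Fin m) (Fin m) ℂ[T;T⁻¹]}
    (hX : InIwahoriOrder X) {c : Fin m → ℤ} {A B : ℤ} (hc : ∀ i, B ≤ c i ∧ c i ≤ A)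
    (h0 : ∀ i j, c i ≤ c j → X i j = 0) : ∃ g ∈ iwahori m, g.1 = 1 + X := by
  have hdet := det_one_add_of_triangular h0
  -- The values of `c` lie in an interval of length `A - B`, so `X` is nilpotent. The inverse of `1
  -- + X` is then a finite geometric sum, which stays in the Iwahori order.
  have hnil : (-X) ^ ((A - B).toNat + 1) = 0 := by
    rw [neg_pow]
    have : X ^ ((A - B).toNat + 1) = 0 := by
      ext1 i j
      refine pow_apply_eq_zero_of_triangular h0 _ i j ?_
      have := hc i
      have := hc j
      push_cast
      omega
    rw [this, mul_zero]
  have hneg : InIwahoriOrder (-X) := fun i j l hl => by simp [hX i j l hl]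
  have hinv := mul_neg_geom_sum (-X) ((A - B).toNat + 1)
  rw [hnil, sub_zero, sub_neg_eq_add] at hinv
  exact ⟨⟨1 + X, hdet⟩, mem_iwahori_of_mul_eq_one (InIwahoriOrder.one.add hX)
    (InIwahoriOrder.sum fun n => hneg.pow n) hinv, rfl⟩

/-- A first nonzero term of `v` would be a leading monomial of `L`, and those have coefficient zero
in `v`. Hence the starting position of `v` exceeds every bound. -/
theorem eq_zero_of_not_lead (hm : 0 < m) {c : Fin m → ℤ} {L : Submodule ℂ (LoopSpace m)}
    (hc : ∀ i l, IsLead L i l → c i ≤ l) {v : LoopSpace m} (hv : v ∈ L)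
    (h0 : ∀ i l, c i ≤ l → (v i).coeff l = 0) {K : ℤ} (hK : KeyGE K v) : v = 0 := by
  have h : ∀ K', K ≤ K' → KeyGE K' v := by
    intro K' hK'
    induction K', hK' using Int.leInduction with
    | base => exact hK
    | succ K' _ ih =>
      obtain ⟨i, l, rfl⟩ := key_surjective hm K'
      refine ih.succ ?_
      by_contra hne
      exact hne (h0 i l (hc i l (IsLead.of_ne_zero hv ih hne)))
  funext i
  apply LaurentPolynomial.ext
  intro l
  exact h (max K (key i l + 1)) (le_max_left _ _) i l (by omega)

/-- Every `t`-stable lattice is a translate of a coordinate lattice by the Iwahori subgroup. -/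
theorem exists_translate_coordLattice (hm : 0 < m) {L : Submodule ℂ (LoopSpace m)}
    (hT : TStable L) {a : ℤ} {N : ℕ} (hL : InWindow a N L) :
    ∃ g ∈ iwahori m, ∃ c : Fin m → ℤ, L = translate g (coordLattice c) := by
  have hleadA : ∀ i, IsLead L i (a + N) := fun i => ⟨_, hL.1 (monom_mem_coordLattice le_rfl),
    keyGE_monom i _, by simp⟩
  have hleadB : ∀ i l, IsLead L i l → a ≤ l := by
    rintro i l ⟨w, hw, -, h⟩
    by_contra hl
    have := mem_stdLattice.1 (hL.2 hw) i l (by omega)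
    rw [h] at this
    exact one_ne_zero this
  have hex : ∀ i, ∃ c, IsLead L i c ∧ ∀ l, IsLead L i l → c ≤ l := fun i =>
    Int.exists_least_of_bdd ⟨a, fun l hl => hleadB i l hl⟩ ⟨_, hleadA i⟩
  choose c hc hmin using hex
  have hc1 : ∀ i, a ≤ c i ∧ c i ≤ a + N := fun i => ⟨hleadB i _ (hc i), hmin i _ (hleadA i)⟩
  have hlead : ∀ i l, c i ≤ l → IsLead L i l := fun i l hl => (hc i).of_le hT hl
  choose w hw hw1 hw2 using hc
  -- The reduced echelon basis: `c i` is the least exponent of a leading monomial in direction `i`,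
  -- and the tail of `w i` is reduced modulo `L` until it contains no leading monomial.
  have hred : ∀ i, ∃ n : LoopSpace m, monom i (c i) + n ∈ L ∧
      KeyGE (key i (c i) + 1) n ∧ ∀ j l, c j ≤ l → (n j).coeff l = 0 := by
    intro i
    have h1 : KeyGE (key i (c i) + 1) (w i - monom i (c i)) :=
      ((hw1 i).sub (keyGE_monom i _)).succ (by simp [hw2])
    obtain ⟨x, hx, hx1, hx2⟩ := exists_reduction hm hL.1 hlead
      ((a + N) * m - (key i (c i) + 1)).toNat _ (by omega) _ h1
    refine ⟨_, ?_, h1.sub hx1, hx2⟩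
    convert! L.sub_mem (hw i) hx using 1
    abel
  choose n hn hn1 hn2 using hred
  -- The columns are rescaled so that `1 + X` sends `w_i ⊗ t^(c i)` to the `i`-th echelon vector.
  let X : Matrix (Fin m) (Fin m) ℂ[T;T⁻¹] := fun j i => LaurentPolynomial.T (- c i) * n i j
  -- The first inequality holds because the tails avoid leading monomials, the second because they
  -- start after the leading term. The second puts `X` in the Iwahori order; together they give
  -- strict triangularity, since `l ≥ 0` then forces `c i < c j`.
  have hXc : ∀ j i l, (X j i).coeff l ≠ 0 → l + c i < c j ∧ key i (c i) < key j (l + c i) := by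
    intro j i l h
    change (LaurentPolynomial.T (- c i) * n i j).coeff l ≠ 0 at h
    rw [coeff_T_mul, sub_neg_eq_add] at h
    constructor
    · by_contra h'
      exact h (hn2 i j _ (by omega))
    · by_contra h'
      exact h (hn1 i j _ (by omega))
  have hX : InIwahoriOrder X := by
    intro j i l hl
    by_contra h
    have h2 := (hXc j i l h).2
    rw [add_comm, key_add, add_comm] at h2
    unfold key at h2
    by_cases hl0 : l < 0
    · have : l * (m : ℤ) ≤ (-1) * m := mul_le_mul_of_nonneg_right (by omega) (by omega)
      have := i.2
      have := j.2
      omega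
    · split_ifs at hl with hij
      · obtain rfl : l = 0 := by omega
        have : (i : ℕ) < j := hij
        omega
      · omega
  have hX0 : ∀ j i, c j ≤ c i → X j i = 0 := by
    intro j i hji
    apply LaurentPolynomial.ext
    intro l
    by_contra h
    have h1 := (hXc j i l h).1
    have h2 := hX j i l
    refine h (h2 ?_)
    split_ifs <;> omega
  obtain ⟨g, hg, hgX⟩ := exists_iwahori_of_triangular hX hc1 hX0
  have hcol : ∀ i, g.1.mulVec (monom i (c i)) =
      monom i (c i) + n i := by
    intro i
    rw [hgX, Matrix.add_mulVec, Matrix.one_mulVec, Matrix.mulVec_single]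
    congr 1
    funext j
    change (LaurentPolynomial.T (- c i) * n i j) * LaurentPolynomial.T (c i) = n i j
    rw [mul_comm, ← mul_assoc, ← LaurentPolynomial.T_add]
    simp
  refine ⟨g, hg, c, ?_⟩
  have hML : translate g (coordLattice c) ≤ L := by
    rintro _ ⟨v, hv, rfl⟩
    have e : v = ∑ i, (LaurentPolynomial.T (- c i) * v i) •
        (monom i (c i)) := by
      funext j
      rw [Finset.sum_apply, Finset.sum_eq_single j]
      · simp only [Pi.smul_apply, Pi.single_eq_same, smul_eq_mul]
        rw [mul_comm, ← mul_assoc, ← LaurentPolynomial.T_add]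
        simp
      · intro i _ hi
        simp [Pi.single_eq_of_ne hi.symm]
      · simp
    rw [e, map_sum]
    refine L.sum_mem fun i _ => ?_
    change g.1.mulVec _ ∈ L
    rw [Matrix.mulVec_smul, hcol]
    refine hT.smul_mem (hn i) fun l hl => ?_
    rw [coeff_T_mul]
    exact hv i _ (by omega)
  -- The translate has all the leading monomials of `L`. Reducing `v ∈ L` modulo the translate
  -- leaves an element of `L` without leading monomials, which is zero.
  refine le_antisymm (fun v hv => ?_) hML
  have hMA : stdLattice m (a + N) ≤ translate g (coordLattice c) := by
    rw [← translate_stdLattice hg (a + N)]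
    exact translate_mono g (coordLattice_le_iff.2 fun i => (hc1 i).2)
  have hMlead : ∀ i l, c i ≤ l → IsLead (translate g (coordLattice c)) i l := by
    intro i l hl
    refine IsLead.of_le ((coordLattice_tStable c).translate g) ?_ hl
    refine ⟨_, ⟨_, monom_mem_coordLattice le_rfl, hcol i⟩,
      (keyGE_monom i _).add ((hn1 i).mono (by omega)), ?_⟩
    have h1 := hn2 i i (c i) le_rfl
    simp [h1]
  have hvK : KeyGE (a * m) v := keyGE_mul_iff.2 (hL.2 hv)
  obtain ⟨x, hx, hx1, hx2⟩ := exists_reduction hm hMA hMlead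
    ((a + N) * m - a * m).toNat _ (by omega) v hvK
  have := eq_zero_of_not_lead hm hmin (L.sub_mem hv (hML hx)) hx2 (hvK.sub hx1)
  rw [sub_eq_zero] at this
  rwa [this]

end Echelon

/-! ## Points of the affine flag variety -/

section Points

variable {m b : ℕ}

theorem sum_fundExp (hb : b ≤ m) : ∑ i, fundExp m b i = -b := by
  unfold fundExp
  rw [Fin.sum_univ_eq_sum_range (fun i : ℕ => if i < b then (-1 : ℤ) else 0) m, ← Finset.sum_filter]
  have : (Finset.range m).filter (· < b) = Finset.range b := by
    ext x
    simp only [Finset.mem_filter, Finset.mem_range]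
    omega
  rw [this]
  simp

theorem prod_T {ι : Type*} (s : Finset ι) (d : ι → ℤ) :
    ∏ i ∈ s, (LaurentPolynomial.T (d i) : ℂ[T;T⁻¹]) = LaurentPolynomial.T (∑ i ∈ s, d i) := by
  classical
  induction s using Finset.induction with
  | empty => simp
  | insert i s hi ih => rw [Finset.prod_insert hi, Finset.sum_insert hi, ih, LaurentPolynomial.T_add]

/-- The diagonal matrix with entries `t^(d i)`. -/
def diagT (d : Fin m → ℤ) (hd : ∑ i, d i = 0) : LoopSL m :=
  ⟨Matrix.diagonal fun i => LaurentPolynomial.T (d i), by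
    rw [Matrix.det_diagonal, prod_T, hd, LaurentPolynomial.T_zero]⟩

theorem translate_diagT (d : Fin m → ℤ) (hd : ∑ i, d i = 0) (c : Fin m → ℤ) :
    translate (diagT d hd) (coordLattice c) = coordLattice fun i => c i + d i := by
  ext v
  rw [mem_translate]
  constructor
  · rintro ⟨w, hw, rfl⟩
    refine mem_coordLattice.2 fun i l hl => ?_
    change ((Matrix.diagonal fun i => LaurentPolynomial.T (d i)).mulVec w i).coeff l = 0
    rw [Matrix.mulVec_diagonal, coeff_T_mul]
    exact hw i _ (by omega)
  · intro hv
    refine ⟨fun i => LaurentPolynomial.T (- d i) * v i, mem_coordLattice.2 fun i l hl => ?_, ?_⟩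
    · rw [coeff_T_mul]
      exact mem_coordLattice.1 hv i _ (by omega)
    · funext i
      change (Matrix.diagonal fun i => LaurentPolynomial.T (d i)).mulVec _ i = v i
      rw [Matrix.mulVec_diagonal, ← mul_assoc, ← LaurentPolynomial.T_add]
      simp

/-- The point of the affine flag variety with lattice `coordLattice c`. -/
def fixedPoint (c : Fin m → ℤ) (hc : ∑ i, c i = ∑ i, fundExp m b i) : FlagVariety m b :=
  FlagVariety.mk (diagT (fun i => c i - fundExp m b i) (by rw [Finset.sum_sub_distrib, hc, sub_self]))

theorem lattice_fixedPoint (c : Fin m → ℤ) (hc : ∑ i, c i = ∑ i, fundExp m b i) :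
    (fixedPoint c hc).lattice = coordLattice c := by
  unfold fixedPoint
  rw [lattice_mk, translate_diagT]
  simp

theorem ordGE_prod {ι : Type*} (s : Finset ι) (d : ι → ℤ) (f : ι → ℂ[T;T⁻¹])
    (h : ∀ i ∈ s, OrdGE (d i) (f i)) : OrdGE (∑ i ∈ s, d i) (∏ i ∈ s, f i) := by
  classical
  induction s using Finset.induction with
  | empty =>
    intro l hl
    rw [Finset.sum_empty] at hl
    rw [Finset.prod_empty, ← LaurentPolynomial.T_zero, LaurentPolynomial.T_apply, if_neg hl.ne']
  | insert i s hi ih =>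
    rw [Finset.prod_insert hi, Finset.sum_insert hi]
    exact (h i (Finset.mem_insert_self _ _)).mul
      (ih fun j hj => h j (Finset.mem_insert_of_mem hj))

/-- Each term of the Leibniz expansion of `det g` has order at least `∑ c' - ∑ c`, while `det g = 1`
has order `0`. -/
theorem sum_le_of_translate_le {c c' : Fin m → ℤ} {g : LoopSL m}
    (h : translate g (coordLattice c) ≤ coordLattice c') : ∑ i, c' i ≤ ∑ i, c i := by
  have h1 : OrdGE (∑ i, c' i - ∑ i, c i) g.1.det := by
    rw [Matrix.det_apply]
    refine OrdGE.sum fun σ _ => ?_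
    have h2 := ordGE_prod Finset.univ (fun i => c' (σ i) - c i) (fun i => g.1 (σ i) i)
      fun i _ => ordGE_of_translate_coordLattice_le h _ _
    rw [Finset.sum_sub_distrib, Equiv.sum_comp σ c'] at h2
    intro l hl
    rcases Int.units_eq_one_or (Equiv.Perm.sign σ) with hs | hs <;> simp [hs, h2 l hl]
  rw [g.2, ← LaurentPolynomial.T_zero] at h1
  by_contra hlt
  have := h1 0 (by omega)
  simp at this

theorem sum_eq_of_translate_eq {c c' : Fin m → ℤ} {g : LoopSL m}
    (h : translate g (coordLattice c) = coordLattice c') : ∑ i, c' i = ∑ i, c i := by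
  refine le_antisymm (sum_le_of_translate_le h.le) ?_
  refine sum_le_of_translate_le (g := g⁻¹) (le_of_eq ?_)
  rw [translate_inv_eq_iff, h]

/-- The Bruhat decomposition of the affine flag variety. -/
theorem exists_eq_smul_of_lattice (hm : 0 < m) {L : Submodule ℂ (LoopSpace m)} (hT : TStable L)
    {a : ℤ} {N : ℕ} (hL : InWindow a N L) :
    ∃ g ∈ iwahori m, ∃ c : Fin m → ℤ, L = translate g (coordLattice c) ∧
      ∀ i, a ≤ c i ∧ c i ≤ a + N := by
  obtain ⟨g, hg, c, rfl⟩ := exists_translate_coordLattice hm hT hL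
  refine ⟨g, hg, c, rfl, inWindow_coordLattice_iff.1 ?_⟩
  have := hL.translate (inv_mem hg)
  rwa [← translate_mul, inv_mul_cancel, translate_one] at this

theorem exists_eq_smul_fixedPoint (hm : 0 < m) {p : FlagVariety m b} {a : ℤ} {N : ℕ}
    (hp : InWindow a N p.lattice) :
    ∃ g ∈ iwahori m, ∃ (c : Fin m → ℤ) (hc : ∑ i, c i = ∑ i, fundExp m b i),
      p = g • fixedPoint c hc ∧ ∀ i, a ≤ c i ∧ c i ≤ a + N := by
  obtain ⟨g, hg, c, hgc, hca⟩ := exists_eq_smul_of_lattice hm (lattice_tStable p) hp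
  -- Some element of determinant one carries `L_b` to `coordLattice c`, which fixes the sum of the
  -- exponents.
  have hc : ∑ i, c i = ∑ i, fundExp m b i := by
    obtain ⟨h, rfl⟩ := mk_surjective p
    rw [lattice_mk, ← translate_inv_eq_iff, ← translate_mul] at hgc
    exact sum_eq_of_translate_eq hgc
  refine ⟨g, hg, c, hc, lattice_injective ?_, hca⟩
  rw [lattice_smul, lattice_fixedPoint, hgc]

theorem map_win_coordLattice {c : Fin m → ℤ} {a : ℤ} {N : ℕ} (hc : ∀ i, a ≤ c i ∧ c i ≤ a + N) :
    (coordLattice c).map (win m a N) =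
      coordSpace (Finset.univ.filter fun x : Fin m × Fin N => c x.1 ≤ a + x.2) := by
  ext x
  rw [(inWindow_coordLattice_iff.2 hc).mem_map_win, mem_coordSpace]
  simp only [Finset.mem_filter, Finset.mem_univ, true_and, not_le]
  constructor
  · intro h y hy
    rw [← coeff_sec_add (a := a) x y.1 y.2]
    exact h _ _ hy
  · intro h i l hl
    rw [coeff_sec]
    refine Finset.sum_eq_zero fun j _ => ?_
    split_ifs with hj
    · exact h (i, j) (by dsimp only; omega)
    · rfl

theorem finrank_map_win_coordLattice {c : Fin m → ℤ} {a : ℤ} {N : ℕ}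
    (hc : ∀ i, a ≤ c i ∧ c i ≤ a + N) :
    (Module.finrank ℂ ((coordLattice c).map (win m a N)) : ℤ) = ∑ i, (a + N - c i) := by
  rw [map_win_coordLattice hc, finrank_coordSpace, Finset.card_filter, Fintype.sum_prod_type]
  push_cast
  refine Finset.sum_congr rfl fun i _ => ?_
  obtain ⟨h1, h2⟩ := hc i
  rw [Fin.sum_univ_eq_sum_range (fun l : ℕ => if c i ≤ a + (l : ℤ) then (1 : ℤ) else 0) N,
    ← Finset.sum_filter]
  have : (Finset.range N).filter (fun l : ℕ => c i ≤ a + (l : ℤ)) =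
      Finset.Ico (c i - a).toNat N := by
    ext x
    simp only [Finset.mem_filter, Finset.mem_range, Finset.mem_Ico]
    omega
  rw [this]
  simp only [Finset.sum_const, Nat.card_Ico, nsmul_eq_mul, mul_one]
  omega

/-- The Iwahori action preserves dimensions of windows, and for a fixed point the dimension depends
on `c` only through `∑ c i`, which is the same for all points. -/
theorem finrank_map_win_lattice (hm : 0 < m) {p : FlagVariety m b} {a : ℤ} {N : ℕ}
    (hp : InWindow a N p.lattice) :
    Module.finrank ℂ (p.lattice.map (win m a N)) =
      (∑ i, (a + N - fundExp m b i)).toNat := by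
  obtain ⟨g, hg, c, hc, rfl, hca⟩ := exists_eq_smul_fixedPoint hm hp
  have h := finrank_map_win_coordLattice hca
  rw [lattice_smul, lattice_fixedPoint, finrank_map_win_translate hg
    (inWindow_coordLattice_iff.2 hca).2]
  rw [Finset.sum_sub_distrib, ← hc, ← Finset.sum_sub_distrib, ← h, Int.toNat_natCast]

theorem mem_piece_iff {n : ℕ} {p : FlagVariety m b} :
    p ∈ FlagVariety.piece m b n ↔ InWindow (-n) (2 * n) p.lattice := by
  unfold InWindow
  have : (-n : ℤ) + (2 * n : ℕ) = n := by push_cast; ring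
  rw [this]
  rfl

theorem InWindow.exists_piece {a : ℤ} {N : ℕ} {p : FlagVariety m b} (h : InWindow a N p.lattice) :
    p ∈ FlagVariety.piece m b (a.natAbs + N) :=
  mem_piece_iff.2 (h.mono (by omega) (by omega))

theorem map_window_eq {n : ℕ} (L : Submodule ℂ (LoopSpace m)) :
    L.map (window m n) = L.map (win m (-n) (2 * n)) := by rw [window_eq_win]

theorem pluckerEquiv_piece (hm : 0 < m) {Y : Type*} (i : Y → FlagVariety m b) {a : ℤ} {N n : ℕ}
    (h : ∀ y, InWindow a N (i y).lattice) (hn : ∀ y, i y ∈ FlagVariety.piece m b n) :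
    ∃ k k', PluckerEquiv k k' (fun y => (i y).lattice.map (win m a N))
      fun y => (i y).lattice.map (window m n) := by
  simp only [map_window_eq]
  exact ⟨_, _, pluckerEquiv_win h (fun y => mem_piece_iff.1 (hn y))
    (fun y => finrank_map_win_lattice hm (h y))
    fun y => finrank_map_win_lattice hm (mem_piece_iff.1 (hn y))⟩

/-- A family bounded by one window lies in a single piece, so openness on that piece suffices in one
direction. In the other direction each piece is compared with the given window. -/
theorem flagStructure_isOpen_iff (hm : 0 < m) {Y : Type*} (i : Y → FlagVariety m b) {a : ℤ} {N : ℕ}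
    (h : ∀ y, InWindow a N (i y).lattice) (O : Set Y) :
    IsOpen[(flagStructure i).top] O ↔
      IsOpen[((grassmannian (Fin m × Fin N → ℂ)).induced
        fun y => (i y).lattice.map (win m a N)).top] O := by
  constructor
  · intro hO
    obtain ⟨k, k', hP⟩ := pluckerEquiv_piece hm i h fun y => (h y).exists_piece
    refine hP.1.isOpen ?_
    obtain ⟨A, hA, hAO⟩ := (isOpen_iSup_iff.1 hO) (a.natAbs + N)
    refine ⟨A, hA, ?_⟩
    ext y
    exact Set.ext_iff.1 hAO ⟨y, (h y).exists_piece⟩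
  · rintro ⟨A, hA, rfl⟩
    refine isOpen_iSup_iff.2 fun n => ?_
    obtain ⟨k, k', hP⟩ := pluckerEquiv_piece hm
      (fun y : i ⁻¹' FlagVariety.piece m b n => i y.1) (fun y => h y.1) fun y => y.2
    exact hP.2.isOpen ⟨A, hA, rfl⟩

theorem flagStructure_regular_iff (hm : 0 < m) {Y : Type*} (i : Y → FlagVariety m b) {a : ℤ} {N : ℕ}
    (h : ∀ y, InWindow a N (i y).lattice) (O : Set Y) (f : Y → ℂ) :
    f ∈ (flagStructure i).regular O ↔
      f ∈ ((grassmannian (Fin m × Fin N → ℂ)).induced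
        fun y => (i y).lattice.map (win m a N)).regular O := by
  constructor
  · intro hf
    obtain ⟨k, k', hP⟩ := pluckerEquiv_piece hm i h fun y => (h y).exists_piece
    refine hP.1.regular fun y hy => ?_
    obtain ⟨A, hA, hyA, g, hg, hfg⟩ := hf (a.natAbs + N) ⟨y, (h y).exists_piece⟩ hy
    exact ⟨A, hA, hyA, g, hg, fun z hz hzA => hfg ⟨z, (h z).exists_piece⟩ hz hzA⟩
  · intro hf n
    obtain ⟨k, k', hP⟩ := pluckerEquiv_piece hm
      (fun y : i ⁻¹' FlagVariety.piece m b n => i y.1) (fun y => h y.1) fun y => y.2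
    refine hP.2.regular fun y hy => ?_
    obtain ⟨A, hA, hyA, g, hg, hfg⟩ := hf y.1 hy
    exact ⟨A, hA, hyA, g, hg, fun z hz hzA => hfg z.1 hz hzA⟩

/-- A subset of the affine flag variety which is contained in a window carries the structure
induced by this window. -/
theorem nonempty_spaceIso_flagStructure (hm : 0 < m) {Y : Type*} (i : Y → FlagVariety m b)
    {a : ℤ} {N : ℕ} (h : ∀ y, InWindow a N (i y).lattice) :
    Nonempty (SpaceIso ((grassmannian (Fin m × Fin N → ℂ)).induced
      fun y => (i y).lattice.map (win m a N)) (flagStructure i)) :=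
  ⟨⟨Equiv.refl Y, fun O => flagStructure_isOpen_iff hm i h O,
    fun O f _ => flagStructure_regular_iff hm i h O f⟩⟩

end Points

/-! ## Fixed points of the Cartan torus -/

section Torus

variable {m b : ℕ}

theorem coe_unit_T_zpow (n : ℤ) :
    (((LaurentPolynomial.isUnit_T (R := ℂ) 1).unit ^ n : (ℂ[T;T⁻¹])ˣ) : ℂ[T;T⁻¹]) =
      LaurentPolynomial.T n := by
  have h : ∀ k : ℕ, (((LaurentPolynomial.isUnit_T (R := ℂ) 1).unit ^ k : (ℂ[T;T⁻¹])ˣ) : ℂ[T;T⁻¹]) =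
      LaurentPolynomial.T k := by
    intro k
    rw [Units.val_pow_eq_pow_val, IsUnit.unit_spec, LaurentPolynomial.T_pow, mul_one]
  cases n with
  | ofNat k => exact h k
  | negSucc k =>
    rw [zpow_negSucc]
    refine Units.inv_eq_of_mul_eq_one_right ?_
    rw [h, ← LaurentPolynomial.T_add, Int.negSucc_eq]
    simp

theorem coeff_rotate (c : ℂˣ) (f : ℂ[T;T⁻¹]) (l : ℤ) :
    (rotate c f).coeff l = (c ^ l : ℂˣ) * f.coeff l := by
  induction f using LaurentPolynomial.induction_on' with
  | add p q hp hq =>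
    rw [map_add, AddMonoidAlgebra.coeff_add, AddMonoidAlgebra.coeff_add, Finsupp.add_apply,
      Finsupp.add_apply, hp, hq, mul_add]
  | C_mul_T n a =>
    have : rotate c (LaurentPolynomial.C a * LaurentPolynomial.T n) =
        LaurentPolynomial.C (((c ^ n : ℂˣ) : ℂ) * a) * LaurentPolynomial.T n := by
      unfold rotate
      rw [LaurentPolynomial.eval₂_C_mul_T, mul_zpow, Units.val_mul, coe_unit_T_zpow, ← map_zpow,
        Units.coe_map, ← mul_assoc, map_mul, mul_comm (LaurentPolynomial.C a)]
      rfl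
    rw [this, ← LaurentPolynomial.single_eq_C_mul_T, ← LaurentPolynomial.single_eq_C_mul_T]
    simp only [AddMonoidAlgebra.coeff_single, Finsupp.single_apply]
    split_ifs with h
    · rw [h]
    · simp

theorem rotate_rotate_inv (c : ℂˣ) (f : ℂ[T;T⁻¹]) : rotate c (rotate c⁻¹ f) = f := by
  apply LaurentPolynomial.ext
  intro l
  rw [coeff_rotate, coeff_rotate, ← mul_assoc, ← Units.val_mul, inv_zpow, mul_inv_cancel,
    Units.val_one, one_mul]

theorem rotate_mem_coordLattice {c : Fin m → ℤ} {v : LoopSpace m} (hv : v ∈ coordLattice c)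
    (z : ℂˣ) : (fun i => rotate z (v i)) ∈ coordLattice c := by
  intro i l hl
  rw [coeff_rotate, hv i l hl, mul_zero]

/-- Rotating both the matrix and the vector rotates their product, and coordinate lattices are
stable under rotation. -/
theorem translate_map_rotate {c c' : Fin m → ℤ} {g : LoopSL m}
    (h : translate g (coordLattice c) = coordLattice c') (z : ℂˣ) :
    translate (Matrix.SpecialLinearGroup.map (rotate z) g) (coordLattice c) = coordLattice c' := by
  have key : ∀ v : LoopSpace m, (Matrix.SpecialLinearGroup.map (rotate z) g).1.mulVec
      (fun i => rotate z (v i)) = fun i => rotate z (g.1.mulVec v i) := by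
    intro v
    funext i
    exact (RingHom.map_mulVec (rotate z) g.1 v i).symm
  ext v
  rw [mem_translate]
  constructor
  · rintro ⟨w, hw, rfl⟩
    have h1 := rotate_mem_coordLattice hw z⁻¹
    have h2 := key fun i => rotate z⁻¹ (w i)
    simp only [rotate_rotate_inv] at h2
    rw [h2]
    refine rotate_mem_coordLattice ?_ z
    rw [← h]
    exact ⟨_, h1, rfl⟩
  · intro hv
    have h1 := rotate_mem_coordLattice hv z⁻¹
    rw [← h] at h1
    obtain ⟨w, hw, hw1⟩ := h1
    refine ⟨_, rotate_mem_coordLattice hw z, ?_⟩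
    rw [key]
    funext i
    have h2 : g.1.mulVec w i = rotate z⁻¹ (v i) := congrFun hw1 i
    rw [h2, rotate_rotate_inv]

theorem translate_diagonal_C (c : Fin m → ℤ) {h : LoopSL m} {d : Fin m → ℂ}
    (hd : h.1 = Matrix.diagonal fun i => LaurentPolynomial.C (d i)) :
    translate h (coordLattice c) = coordLattice c := by
  have hd0 : ∀ i, d i ≠ 0 := by
    intro i hi
    have h1 : (h⁻¹.1 * h.1) i i = 1 := by
      rw [← Matrix.SpecialLinearGroup.coe_mul, inv_mul_cancel, Matrix.SpecialLinearGroup.coe_one,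
        Matrix.one_apply_eq]
    rw [hd, Matrix.mul_diagonal, hi, map_zero, mul_zero] at h1
    exact zero_ne_one h1
  ext v
  rw [mem_translate, hd]
  constructor
  · rintro ⟨w, hw, rfl⟩ i l hl
    rw [Matrix.mulVec_diagonal, coeff_C_mul, hw i l hl, mul_zero]
  · intro hv
    refine ⟨fun i => LaurentPolynomial.C (d i)⁻¹ * v i, fun i l hl => ?_, ?_⟩
    · rw [coeff_C_mul, hv i l hl, mul_zero]
    · funext i
      rw [Matrix.mulVec_diagonal, ← mul_assoc, ← map_mul, mul_inv_cancel₀ (hd0 i), map_one, one_mul]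

theorem isTorusFixed_fixedPoint (c : Fin m → ℤ) (hc : ∑ i, c i = ∑ i, fundExp m b i) :
    IsTorusFixed (fixedPoint (b := b) c hc) := by
  refine ⟨fun h d hd => lattice_injective ?_, fun z g hg => lattice_injective ?_⟩
  · rw [lattice_smul, lattice_fixedPoint, translate_diagonal_C c hd]
  · have h1 := congrArg FlagVariety.lattice hg
    rw [lattice_fixedPoint, lattice_mk] at h1
    rw [lattice_fixedPoint, lattice_mk, translate_map_rotate h1]

end Torus

/-! ## Closures of Iwahori orbits -/

section Closure

variable {m b : ℕ}

theorem isOpen_top_iff {O : Set (FlagVariety m b)} :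
    IsOpen[FlagVariety.top m b] O ↔ ∀ n, IsOpen[(grassmannianTop (Fin m × Fin (2 * n) → ℂ)).induced
      fun y : FlagVariety.piece m b n => y.1.lattice.map (window m n)] (Subtype.val ⁻¹' O) :=
  isOpen_iSup_iff

theorem isClosed_top_of_pieces {S : Set (FlagVariety m b)}
    (h : ∀ n, IsClosed[(grassmannianTop (Fin m × Fin (2 * n) → ℂ)).induced
      fun y : FlagVariety.piece m b n => y.1.lattice.map (window m n)] (Subtype.val ⁻¹' S)) :
    IsClosed[FlagVariety.top m b] S := by
  rw [← @isOpen_compl_iff _ _ (FlagVariety.top m b), isOpen_top_iff]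
  intro n
  have := (@isOpen_compl_iff _ _ ((grassmannianTop (Fin m × Fin (2 * n) → ℂ)).induced
    fun y : FlagVariety.piece m b n => y.1.lattice.map (window m n))).2 (h n)
  exact this

theorem isClosed_induced_preimage {Y M : Type*} [AddCommGroup M] [Module ℂ M]
    (j : Y → Submodule ℂ M) {A : Set (Submodule ℂ M)} (hA : IsClosed[grassmannianTop M] A) :
    IsClosed[(grassmannianTop M).induced j] (j ⁻¹' A) :=
  @isClosed_induced_iff _ _ (grassmannianTop M) _ _ |>.2 ⟨A, hA, rfl⟩

theorem isClosed_mem_lattice (v : LoopSpace m) :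
    IsClosed[FlagVariety.top m b] {p : FlagVariety m b | v ∈ p.lattice} := by
  refine isClosed_top_of_pieces fun n => ?_
  by_cases hv : v ∈ stdLattice m (-n)
  · convert! isClosed_induced_preimage
      (fun y : FlagVariety.piece m b n => y.1.lattice.map (window m n))
      (isClosed_mem (win m (-n) (2 * n) v)) using 1
    ext y
    have := (mem_piece_iff.1 y.2).mem_iff hv
    rw [← map_window_eq] at this
    exact this
  · convert! @isClosed_empty _ ((grassmannianTop (Fin m × Fin (2 * n) → ℂ)).induced
      fun y : FlagVariety.piece m b n => y.1.lattice.map (window m n)) using 1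
    exact Set.eq_empty_iff_forall_notMem.2 fun y hy => hv ((mem_piece_iff.1 y.2).2 hy)

/-- On the `n`-th piece the condition is automatic for `l < -n`, is the vanishing of a linear form
on the window for `-n ≤ l < n`, and is impossible for `l ≥ n`, where `w_i ⊗ t^l` lies in every
lattice. -/
theorem isClosed_coeff_lattice (i : Fin m) (l : ℤ) :
    IsClosed[FlagVariety.top m b] {p : FlagVariety m b | ∀ v ∈ p.lattice, (v i).coeff l = 0} := by
  refine isClosed_top_of_pieces fun n => ?_
  by_cases h1 : l < -n
  · convert! @isClosed_univ _ ((grassmannianTop (Fin m × Fin (2 * n) → ℂ)).induced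
      fun y : FlagVariety.piece m b n => y.1.lattice.map (window m n)) using 1
    exact Set.eq_univ_of_forall fun y v hv => (mem_piece_iff.1 y.2).2 hv i l h1
  by_cases h2 : l < n
  · let x : Fin m × Fin (2 * n) := (i, ⟨(l + n).toNat, by omega⟩)
    convert! isClosed_induced_preimage
      (fun y : FlagVariety.piece m b n => y.1.lattice.map (window m n))
      (isClosed_le_ker (LinearMap.proj x)) using 1
    ext y
    have hx : ∀ v : LoopSpace m, window m n v x = (v i).coeff l := by
      intro v
      change (v i).coeff _ = _
      congr 1
      simp only [x]
      omega
    constructor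
    · rintro h _ ⟨v, hv, rfl⟩
      exact (hx v).trans (h v hv)
    · intro h v hv
      exact (hx v).symm.trans (h _ ⟨v, hv, rfl⟩)
  · convert! @isClosed_empty _ ((grassmannianTop (Fin m × Fin (2 * n) → ℂ)).induced
      fun y : FlagVariety.piece m b n => y.1.lattice.map (window m n)) using 1
    refine Set.eq_empty_iff_forall_notMem.2 fun y hy => ?_
    have h3 : monom i l ∈ y.1.lattice := y.2.1 (monom_mem_coordLattice (by omega))
    have h4 := hy _ h3
    rw [coeff_monom, if_pos ⟨rfl, rfl⟩] at h4
    exact one_ne_zero h4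

theorem isClosed_inWindow (a : ℤ) (N : ℕ) :
    IsClosed[FlagVariety.top m b] {p : FlagVariety m b | InWindow a N p.lattice} := by
  let _ := FlagVariety.top m b
  have h : {p : FlagVariety m b | InWindow a N p.lattice} =
      (⋂ v : stdLattice m (a + N), {p : FlagVariety m b | v.1 ∈ p.lattice}) ∩
      ⋂ x : Fin m × {l : ℤ // l < a},
        {p : FlagVariety m b | ∀ v ∈ p.lattice, (v x.1).coeff x.2.1 = 0} := by
    ext p
    simp only [Set.mem_inter_iff, Set.mem_iInter]
    exact ⟨fun h => ⟨fun v => h.1 v.2, fun x v hv => h.2 hv x.1 x.2.1 x.2.2⟩,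
      fun h => ⟨fun v hv => h.1 ⟨v, hv⟩, fun v hv i l hl => h.2 (i, ⟨l, hl⟩) v hv⟩⟩
  rw [h]
  exact (isClosed_iInter fun v : stdLattice m (a + N) => isClosed_mem_lattice v.1).inter
    (isClosed_iInter fun x : Fin m × {l : ℤ // l < a} => isClosed_coeff_lattice x.1 x.2.1)

/-! ### The Iwahori action on Schubert varieties -/

theorem smul_mem_piece {g : LoopSL m} (hg : g ∈ iwahori m) {n : ℕ} {p : FlagVariety m b}
    (hp : p ∈ FlagVariety.piece m b n) : g • p ∈ FlagVariety.piece m b n := by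
  rw [mem_piece_iff, lattice_smul]
  exact (mem_piece_iff.1 hp).translate hg

/-- On each piece `g` acts through a linear automorphism of the window, along which Plücker forms
pull back. -/
theorem continuous_smul_iwahori (hm : 0 < m) {g : LoopSL m} (hg : g ∈ iwahori m) :
    @Continuous _ _ (FlagVariety.top m b) (FlagVariety.top m b) fun p => g • p := by
  refine @Continuous.mk _ _ (FlagVariety.top m b) (FlagVariety.top m b) _ fun O hO => ?_
  rw [isOpen_top_iff] at hO ⊢
  intro n
  obtain ⟨A, hA, hAO⟩ := hO n
  let k := (∑ i, ((-n : ℤ) + (2 * n : ℕ) - fundExp m b i)).toNat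
  have hP : PluckerDom k k (fun y : FlagVariety.piece m b n => y.1.lattice.map (window m n))
      fun y : FlagVariety.piece m b n => (g • y.1).lattice.map (window m n) := by
    simp only [map_window_eq]
    refine PluckerDom.map (fun y => finrank_map_win_lattice hm (mem_piece_iff.1 y.2))
      (windowAction g (-n) (2 * n)) (fun y u hu h => ?_) fun y => ?_
    · rw [← windowAction_inv hg (-n) (2 * n) u, h, map_zero]
    · rw [lattice_smul, map_win_translate hg (mem_piece_iff.1 y.2).2]
  refine hP.isOpen ⟨A, hA, ?_⟩
  ext y
  exact Set.ext_iff.1 hAO ⟨g • y.1, smul_mem_piece hg y.2⟩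

theorem smul_mem_schubertSet (hm : 0 < m) {p q : FlagVariety m b} (hq : q ∈ schubertSet p)
    {g : LoopSL m} (hg : g ∈ iwahori m) : g • q ∈ schubertSet p := by
  let _ := FlagVariety.top m b
  refine map_mem_closure (continuous_smul_iwahori hm hg) hq ?_
  rintro _ ⟨h, hh, rfl⟩
  exact ⟨g * h, mul_mem hg hh, (mul_smul g h p).symm⟩

theorem schubertSet_subset (hm : 0 < m) {p q : FlagVariety m b} (hq : q ∈ schubertSet p) :
    schubertSet q ⊆ schubertSet p := by
  let _ := FlagVariety.top m b
  refine closure_minimal ?_ isClosed_closure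
  rintro _ ⟨g, hg, rfl⟩
  exact smul_mem_schubertSet hm hq hg

theorem mem_schubertSet_self (p : FlagVariety m b) : p ∈ schubertSet p := by
  let _ := FlagVariety.top m b
  exact subset_closure ⟨1, one_mem _, (one_smul _ p).symm⟩

theorem schubertSet_subset_inWindow {p : FlagVariety m b} {a : ℤ} {N : ℕ}
    (hp : InWindow a N p.lattice) : schubertSet p ⊆ {q | InWindow a N q.lattice} := by
  let _ := FlagVariety.top m b
  refine closure_minimal ?_ (isClosed_inWindow a N)
  rintro _ ⟨g, hg, rfl⟩
  change InWindow a N (g • p).lattice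
  rw [lattice_smul]
  exact hp.translate hg

/-! ### Degenerations between fixed points along elementary matrices -/

/-- The elementary matrix with entry `f` at `(i, j)`. -/
def elem (i j : Fin m) (hij : i ≠ j) (f : ℂ[T;T⁻¹]) : LoopSL m :=
  ⟨Matrix.transvection i j f, Matrix.det_transvection_of_ne i j hij f⟩

theorem elem_mulVec (i j : Fin m) (hij : i ≠ j) (f : ℂ[T;T⁻¹]) (v : LoopSpace m) :
    (elem i j hij f).1.mulVec v = v + Pi.single i (f * v j) := by
  change (1 + Matrix.single i j f).mulVec v = _
  rw [Matrix.add_mulVec, Matrix.one_mulVec, Matrix.single_mulVec]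
  rfl

theorem elem_mem_iwahori {i j : Fin m} (hij : i < j) {f : ℂ[T;T⁻¹]} (hf : OrdGE 0 f) :
    elem i j hij.ne f ∈ iwahori m := by
  have key : ∀ f : ℂ[T;T⁻¹], OrdGE 0 f → InIwahoriOrder (Matrix.transvection i j f) := by
    intro f hf
    refine InIwahoriOrder.one.add fun k l => ?_
    by_cases h : i = k ∧ j = l
    · obtain ⟨rfl, rfl⟩ := h
      rw [if_neg hij.not_gt, Matrix.single_apply_same]
      exact hf
    · rw [Matrix.single_apply, if_neg h]
      intro n _
      rfl
  refine mem_iwahori_of_mul_eq_one (key f hf)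
    (key (-f) fun l hl => by simp [hf l hl]) ?_
  change Matrix.transvection i j f * Matrix.transvection i j (-f) = 1
  rw [Matrix.transvection_mul_transvection_same i j hij.ne, add_neg_cancel,
    Matrix.transvection_zero]

/-- The linear map `v ↦ t^d v_j w_i`. -/
def shiftMap (i j : Fin m) (d : ℤ) : LoopSpace m →ₗ[ℂ] LoopSpace m where
  toFun v := Pi.single i (LaurentPolynomial.T d * v j)
  map_add' v w := by simp [mul_add, Pi.single_add]
  map_smul' a v := by simp [Pi.single_smul]

theorem elem_smul_T_mulVec (i j : Fin m) (hij : i ≠ j) (s : ℂ) (d : ℤ) (v : LoopSpace m) :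
    (elem i j hij (s • LaurentPolynomial.T d)).1.mulVec v = v + s • shiftMap i j d v := by
  rw [elem_mulVec]
  change v + _ = v + s • Pi.single i (LaurentPolynomial.T d * v j)
  rw [← Pi.single_smul, smul_mul_assoc]

theorem coeff_single_T_mul (i k : Fin m) (d l : ℤ) (f : ℂ[T;T⁻¹]) :
    ((Pi.single i (LaurentPolynomial.T d * f) : LoopSpace m) k).coeff l =
      if k = i then f.coeff (l - d) else 0 := by
  by_cases h : k = i
  · subst h
    rw [Pi.single_eq_same, coeff_T_mul, if_pos rfl]
  · rw [Pi.single_eq_of_ne h, if_neg h]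
    rfl

theorem coeff_shiftMap (i j k : Fin m) (d l : ℤ) (v : LoopSpace m) :
    (shiftMap i j d v k).coeff l = if k = i then (v j).coeff (l - d) else 0 :=
  coeff_single_T_mul i k d l (v j)

/-- With `x = s t^d`, in rows and columns `i, j`, one has `[[1, x], [0, 1]] = [[1, 0], [x⁻¹, 1]] *
[[1, x], [-x⁻¹, 0]]`. The last factor carries `coordLattice c` onto `coordLattice c'`; it maps into
it because `c' i ≤ c i`. -/
theorem translate_elem_eq {c c' : Fin m → ℤ} {i j : Fin m} (hij : i ≠ j) {d : ℤ}
    (hd : c' i = c j + d) (hd' : c' j = c i - d) (hi : c' i ≤ c i)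
    (hc : ∀ k, k ≠ i → k ≠ j → c' k = c k) {s : ℂ} (hs : s ≠ 0) :
    translate (elem i j hij (s • LaurentPolynomial.T d)) (coordLattice c) =
      translate (elem j i hij.symm (s⁻¹ • LaurentPolynomial.T (-d))) (coordLattice c') := by
  have hji := hij.symm
  have hT : ∀ r : ℤ, ∀ f : ℂ[T;T⁻¹], LaurentPolynomial.T (-r) * (LaurentPolynomial.T r * f) = f := by
    intro r f
    rw [← mul_assoc, ← LaurentPolynomial.T_add, neg_add_cancel, LaurentPolynomial.T_zero, one_mul]
  have hTn : ∀ r : ℤ, ∀ f : ℂ[T;T⁻¹], LaurentPolynomial.T r * (LaurentPolynomial.T (-r) * f) = f := by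
    intro r f
    rw [← mul_assoc, ← LaurentPolynomial.T_add, add_neg_cancel, LaurentPolynomial.T_zero, one_mul]
  apply le_antisymm
  · rintro _ ⟨v, hv, rfl⟩
    -- The image of `v` under `[[1, x], [-x⁻¹, 0]]`.
    refine ⟨Function.update (Function.update v i (v i + s • (LaurentPolynomial.T d * v j))) j
      (-(s⁻¹ • (LaurentPolynomial.T (-d) * v i))), ?_, ?_⟩
    · refine mem_coordLattice.2 fun k l hl => ?_
      by_cases hkj : k = j
      · subst hkj
        have := mem_coordLattice.1 hv i (l + d) (by omega)
        simp [-LaurentPolynomial.T_mul, coeff_T_mul, this]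
      · by_cases hki : k = i
        · subst hki
          have h1 := mem_coordLattice.1 hv k l (by omega)
          have h2 := mem_coordLattice.1 hv j (l - d) (by omega)
          simp [-LaurentPolynomial.T_mul, hij, coeff_T_mul, h1, h2]
        · simp only [ne_eq, hkj, not_false_eq_true, Function.update_of_ne, hki]
          exact mem_coordLattice.1 hv k l (by rw [← hc k hki hkj]; exact hl)
    · change (elem j i _ _).1.mulVec _ = (elem i j _ _).1.mulVec _
      rw [elem_smul_T_mulVec, elem_smul_T_mulVec]
      funext k
      change _ + s⁻¹ • (Pi.single j _ : LoopSpace m) k = _ + s • (Pi.single i _ : LoopSpace m) k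
      by_cases hkj : k = j
      · subst hkj
        simp [-LaurentPolynomial.T_mul, hij, hji, mul_add, smul_add, smul_smul, hs, hT]
      · by_cases hki : k = i
        · subst hki
          simp [hij]
        · simp [hkj, hki]
  · rintro _ ⟨v, hv, rfl⟩
    -- The image of `v` under the inverse matrix `[[0, -x], [x⁻¹, 1]]`.
    refine ⟨Function.update (Function.update v i (-(s • (LaurentPolynomial.T d * v j)))) j
      (v j + s⁻¹ • (LaurentPolynomial.T (-d) * v i)), ?_, ?_⟩
    · refine mem_coordLattice.2 fun k l hl => ?_
      by_cases hkj : k = j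
      · subst hkj
        have h1 := mem_coordLattice.1 hv i (l + d) (by omega)
        have h2 := mem_coordLattice.1 hv k l (by omega)
        simp [-LaurentPolynomial.T_mul, coeff_T_mul, h1, h2]
      · by_cases hki : k = i
        · subst hki
          have h2 := mem_coordLattice.1 hv j (l - d) (by omega)
          simp [-LaurentPolynomial.T_mul, hij, coeff_T_mul, h2]
        · simp only [ne_eq, hkj, not_false_eq_true, Function.update_of_ne, hki]
          exact mem_coordLattice.1 hv k l (by rw [hc k hki hkj]; exact hl)
    · change (elem i j _ _).1.mulVec _ = (elem j i _ _).1.mulVec _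
      rw [elem_smul_T_mulVec, elem_smul_T_mulVec]
      funext k
      change _ + s • (Pi.single i _ : LoopSpace m) k = _ + s⁻¹ • (Pi.single j _ : LoopSpace m) k
      by_cases hkj : k = j
      · subst hkj
        simp [hji]
      · by_cases hki : k = i
        · subst hki
          simp [-LaurentPolynomial.T_mul, hij, mul_add, smul_add, smul_smul, hs, hTn]
        · simp [hkj, hki]

/-- The curve `x s` below passes through the point of `c` at `s = 0` and lies in the Iwahori orbit
of the point of `c'` for `s ≠ 0`. -/
theorem fixedPoint_mem_schubertSet (hm : 0 < m) {c c' : Fin m → ℤ}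
    (hc : ∑ i, c i = ∑ i, fundExp m b i) (hc' : ∑ i, c' i = ∑ i, fundExp m b i) {i j : Fin m}
    (hji : j < i) {e : ℤ} (he : 0 ≤ e) (hce : c i - e ≤ c j) (hi : c' i = c i - e)
    (hj : c' j = c j + e) (hk : ∀ k, k ≠ i → k ≠ j → c' k = c k) :
    fixedPoint c hc ∈ schubertSet (fixedPoint (b := b) c' hc') := by
  let _ := FlagVariety.top m b
  obtain ⟨n, hn⟩ : ∃ n : ℕ, ∀ k, (-n ≤ c k ∧ c k ≤ n) ∧ -n ≤ c' k ∧ c' k ≤ n := by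
    refine ⟨∑ k, ((c k).natAbs + (c' k).natAbs), fun k => ?_⟩
    have := Finset.single_le_sum (f := fun k => (c k).natAbs + (c' k).natAbs) (fun _ _ => by omega)
      (Finset.mem_univ k)
    omega
  have hw : InWindow (-n) (2 * n) (coordLattice c) :=
    inWindow_coordLattice_iff.2 fun k => ⟨(hn k).1.1, by have := (hn k).1.2; push_cast; omega⟩
  have hw' : InWindow (-n) (2 * n) (coordLattice c') :=
    inWindow_coordLattice_iff.2 fun k => ⟨(hn k).2.1, by have := (hn k).2.2; push_cast; omega⟩
  -- The shift that turns `(c i, c j)` into `(c i - e, c j + e)`. Here `hce` gives `d ≤ 0`, so the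
  -- opposite elementary matrix, with entry in `ℂ t^(-d)` above the diagonal, lies in the Iwahori
  -- subgroup.
  let d := c i - e - c j
  let x : ℂ → FlagVariety m b := fun s =>
    elem i j hji.ne' (s • LaurentPolynomial.T d) • fixedPoint c hc
  have hx : ∀ s, s ≠ 0 → x s = elem j i hji.ne (s⁻¹ • LaurentPolynomial.T (-d)) •
      fixedPoint c' hc' := by
    intro s hs
    apply lattice_injective
    rw [lattice_smul, lattice_smul, lattice_fixedPoint, lattice_fixedPoint]
    exact translate_elem_eq hji.ne' (by omega) (by omega) (by omega) hk hs
  have hel : ∀ s : ℂ, elem j i hji.ne (s⁻¹ • LaurentPolynomial.T (-d)) ∈ iwahori m := by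
    refine fun s => elem_mem_iwahori hji fun l hl => ?_
    rw [coeff_smul_T, if_neg (by omega)]
  have hxw : ∀ s, s ≠ 0 → InWindow (-n) (2 * n) (x s).lattice := by
    intro s hs
    rw [hx s hs, lattice_smul, lattice_fixedPoint]
    exact hw'.translate (hel s)
  let E := win m (-n) (2 * n) ∘ₗ shiftMap i j d ∘ₗ sec m (-n) (2 * n)
  have hE : ∀ u, E (E u) = 0 := by
    intro u
    have h0 : ∀ l, (sec m (-n) (2 * n) (E u) j).coeff l = 0 := by
      intro l
      rw [coeff_sec]
      refine Finset.sum_eq_zero fun r _ => ?_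
      have : E u (j, r) = 0 := by
        change (shiftMap i j d _ j).coeff _ = 0
        rw [coeff_shiftMap, if_neg hji.ne]
      rw [this, ite_self]
    funext y
    change (shiftMap i j d _ y.1).coeff _ = 0
    rw [coeff_shiftMap, h0, ite_self]
  have hinj : ∀ s : ℂ, Function.Injective
      (LinearMap.id + s • E : (Fin m × Fin (2 * n) → ℂ) →ₗ[ℂ] (Fin m × Fin (2 * n) → ℂ)) := by
    refine fun s => Function.LeftInverse.injective (g := fun u => u - s • E u) fun u => ?_
    change (u + s • E u) - s • E (u + s • E u) = u
    rw [map_add, map_smul, hE, smul_zero, add_zero, add_sub_cancel_right]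
  -- The matrix with entry `s t^d` below the diagonal is not in the Iwahori subgroup when `s ≠ 0`,
  -- so it need not act on windows. One inclusion is checked on representatives supported in the
  -- window, and equality follows by dimension.
  have hmap : ∀ s, s ≠ 0 → (x s).lattice.map (window m n) =
      ((coordLattice c).map (window m n)).map (LinearMap.id + s • E) := by
    intro s hs
    rw [map_window_eq, map_window_eq]
    symm
    refine Submodule.eq_of_le_of_finrank_eq ?_ ?_
    · rintro _ ⟨_, ⟨v, hv, rfl⟩, rfl⟩
      refine ⟨(elem i j hji.ne' (s • LaurentPolynomial.T d)).1.mulVec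
        (sec m (-n) (2 * n) (win m (-n) (2 * n) v)), ?_, ?_⟩
      · change _ ∈ (x s).lattice
        rw [lattice_smul, lattice_fixedPoint]
        exact ⟨_, hw.sec_win_mem hv, rfl⟩
      · rw [elem_smul_T_mulVec, map_add, map_smul, win_sec]
        rfl
    · rw [← (Submodule.equivMapOfInjective _ (hinj s) _).finrank_eq,
        finrank_map_win_lattice hm (hxw s hs)]
      have := finrank_map_win_lattice (b := b) hm (p := fixedPoint c hc) (a := -n) (N := 2 * n)
        (by rwa [lattice_fixedPoint])
      rw [lattice_fixedPoint] at this
      exact this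
  refine mem_closure_iff.2 fun O hO hcO => ?_
  obtain ⟨A, hA, hAO⟩ := isOpen_top_iff.1 hO n
  have hpiece : fixedPoint c hc ∈ FlagVariety.piece m b n := by
    rw [mem_piece_iff, lattice_fixedPoint]
    exact hw
  have h0 : (coordLattice c).map (window m n) ∈ A := by
    have := (Set.ext_iff.1 hAO ⟨fixedPoint c hc, hpiece⟩).2 hcO
    rwa [Set.mem_preimage, lattice_fixedPoint] at this
  have hcont := continuous_map_one_add_smul E hE ((coordLattice c).map (window m n))
  have hopen := (@Continuous.isOpen_preimage _ _ _ (grassmannianTop _) _ hcont A hA)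
  -- A Zariski neighbourhood of the point at `s = 0` pulls back to a classical neighbourhood of `0`,
  -- which contains some `s ≠ 0`.
  obtain ⟨s, hsA, hs⟩ := (dense_compl_singleton (0 : ℂ)).inter_open_nonempty _ hopen ⟨0, by
    change Submodule.map (LinearMap.id + (0 : ℂ) • E) _ ∈ A
    rwa [zero_smul, add_zero, Submodule.map_id]⟩
  have hs0 : s ≠ 0 := hs
  refine ⟨x s, ?_, _, hel s, hx s hs0⟩
  refine (Set.ext_iff.1 hAO ⟨x s, mem_piece_iff.2 (hxw s hs0)⟩).1 ?_
  rw [Set.mem_preimage, hmap s hs0]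
  exact hsA

/-! ## Maximal coordinate lattices in a window -/

/-- Transferring exponents from a larger index to a smaller one strictly lowers the nonnegative sum
`∑ i (c i - a)`, so the process ends, and it ends where no transfer stays in the window. -/
theorem exists_maximal_coordLattice (hm : 0 < m) {a : ℤ} {N : ℕ} (n : ℕ) :
    ∀ (c : Fin m → ℤ) (hc : ∑ i, c i = ∑ i, fundExp m b i), (∀ i, a ≤ c i ∧ c i ≤ a + N) →
      ∑ i : Fin m, (i : ℤ) * (c i - a) ≤ n →
      ∃ (c' : Fin m → ℤ) (hc' : ∑ i, c' i = ∑ i, fundExp m b i), (∀ i, a ≤ c' i ∧ c' i ≤ a + N) ∧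
        (∀ i j, j < i → c' i = a ∨ c' j = a + N) ∧
        fixedPoint c hc ∈ schubertSet (fixedPoint (b := b) c' hc') := by
  induction n with
  | zero =>
    intro c hc hca hn
    refine ⟨c, hc, hca, fun i j hji => ?_, mem_schubertSet_self _⟩
    have h0 : ∀ i ∈ Finset.univ, 0 ≤ ((i : Fin m) : ℤ) * (c i - a) := fun i _ =>
      mul_nonneg (by omega) (by have := (hca i).1; omega)
    have h1 := (Finset.single_le_sum h0 (Finset.mem_univ i)).trans hn
    left
    have h2 := (hca i).1
    have h3 : (j : ℕ) < i := hji
    have h4 : (1 : ℤ) ≤ (i : ℕ) := by omega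
    by_contra hne
    have h5 : 1 ≤ c i - a := by omega
    have h6 := mul_le_mul h4 h5 (by omega) (by omega)
    push_cast at h1
    omega
  | succ n ih =>
    intro c hc hca hn
    by_cases hmax : ∀ i j, j < i → c i = a ∨ c j = a + N
    · exact ⟨c, hc, hca, hmax, mem_schubertSet_self _⟩
    push Not at hmax
    obtain ⟨i, j, hji, hi, hj⟩ := hmax
    have hci := hca i
    have hcj := hca j
    -- If `c j < c i` the two exponents are swapped, otherwise one unit is moved. In both cases the
    -- window is respected and `c i - e ≤ c j`.
    let e := max 1 (c i - c j)
    let c' : Fin m → ℤ := fun k => c k + (if k = j then e else 0) - (if k = i then e else 0)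
    have hc'i : c' i = c i - e := by simp [c', hji.ne']
    have hc'j : c' j = c j + e := by simp [c', hji.ne]
    have hc'k : ∀ k, k ≠ i → k ≠ j → c' k = c k := fun k h1 h2 => by simp [c', h1, h2]
    have hc' : ∑ i, c' i = ∑ i, fundExp m b i := by
      simp [c', Finset.sum_sub_distrib, Finset.sum_add_distrib, hc]
    have hw : ∑ k : Fin m, (k : ℤ) * (c' k - a) =
        ∑ k : Fin m, (k : ℤ) * (c k - a) + (j : ℕ) * e - (i : ℕ) * e := by
      have : ∀ k : Fin m, (k : ℤ) * (c' k - a) = (k : ℤ) * (c k - a) +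
          (if k = j then ((k : ℕ) : ℤ) * e else 0) - (if k = i then ((k : ℕ) : ℤ) * e else 0) := by
        intro k
        simp only [c']
        split_ifs <;> ring
      simp [this, Finset.sum_sub_distrib, Finset.sum_add_distrib]
    have hca' : ∀ k, a ≤ c' k ∧ c' k ≤ a + N := by
      intro k
      by_cases hki : k = i
      · subst hki
        omega
      · by_cases hkj : k = j
        · subst hkj
          omega
        · rw [hc'k k hki hkj]
          exact hca k
    obtain ⟨c'', hc'', h1, h2, h3⟩ := ih c' hc' hca' (by
      have h3 : ((j : ℕ) : ℤ) + 1 ≤ (i : ℕ) := by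
        have : (j : ℕ) < i := hji
        omega
      have h4 := mul_le_mul h3 (le_max_left 1 (c i - c j)) (by omega) (by omega)
      have h5 : ((j : ℕ) + 1 : ℤ) * 1 ≤ (i : ℕ) := by omega
      have h6 : (((j : ℕ) : ℤ) + 1) * e ≤ (i : ℕ) * e :=
        mul_le_mul_of_nonneg_right h3 (by omega)
      have h7 : (((j : ℕ) : ℤ) + 1) * e = (j : ℕ) * e + e := by ring
      push_cast at hn
      omega)
    refine ⟨c'', hc'', h1, h2, schubertSet_subset hm h3 ?_⟩
    exact fixedPoint_mem_schubertSet hm hc hc' hji (by omega) (by omega) hc'i hc'j hc'k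

/-- At the first index `j` of disagreement, say `c j < c' j ≤ a + N`, maximality forces `c i = a`
for all `i > j`. Then `c ≤ c'` everywhere with strict inequality at `j`, contradicting the equality
of the sums. -/
theorem maximal_coordLattice_le {a : ℤ} {N : ℕ} {c c' : Fin m → ℤ} (hs : ∑ i, c i = ∑ i, c' i)
    (hc : ∀ i, a ≤ c i ∧ c i ≤ a + N) (hc' : ∀ i, a ≤ c' i ∧ c' i ≤ a + N)
    (hmax : ∀ i j, j < i → c i = a ∨ c j = a + N)
    (hmax' : ∀ i j, j < i → c' i = a ∨ c' j = a + N) (j : Fin m) : c j = c' j := by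
  induction j using WellFoundedLT.induction with
  | ind j ih =>
    by_contra hne
    have key : ∀ c c' : Fin m → ℤ, ∑ i, c i = ∑ i, c' i → (∀ i, a ≤ c' i ∧ c' i ≤ a + N) →
        (∀ i j, j < i → c i = a ∨ c j = a + N) → (∀ i < j, c i = c' i) → ¬ c j < c' j := by
      intro c c' hs hc' hmax ih hlt
      refine (Finset.sum_lt_sum (s := Finset.univ) (fun i _ => ?_) ⟨j, Finset.mem_univ j, hlt⟩).ne hs
      rcases lt_trichotomy i j with h | rfl | h
      · exact (ih i h).le
      · exact hlt.le
      · rcases hmax i j h with h' | h'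
        · rw [h']
          exact (hc' i).1
        · have := (hc' j).2
          omega
    rcases lt_or_gt_of_ne hne with h | h
    · exact key c c' hs hc' hmax ih h
    · exact key c' c hs.symm hc hmax' (fun i hi => (ih i hi).symm) h

/-- The points of the affine flag variety in a window form a Schubert variety. -/
theorem exists_schubertSet_eq (hm : 0 < m) {a : ℤ} {N : ℕ}
    (hf : ∀ i, a ≤ fundExp m b i ∧ fundExp m b i ≤ a + N) :
    ∃ p : FlagVariety m b, IsTorusFixed p ∧ schubertSet p = {q | InWindow a N q.lattice} := by
  have hex : ∀ (c : Fin m → ℤ) (hc : ∑ i, c i = ∑ i, fundExp m b i),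
      (∀ i, a ≤ c i ∧ c i ≤ a + N) →
      ∃ (c' : Fin m → ℤ) (hc' : ∑ i, c' i = ∑ i, fundExp m b i), (∀ i, a ≤ c' i ∧ c' i ≤ a + N) ∧
        (∀ i j, j < i → c' i = a ∨ c' j = a + N) ∧
        fixedPoint c hc ∈ schubertSet (fixedPoint (b := b) c' hc') := fun c hc hca =>
    exists_maximal_coordLattice hm (∑ i : Fin m, (i : ℤ) * (c i - a)).toNat c hc hca
      (Int.self_le_toNat _)
  -- `L_b` itself lies in the window, so a maximal `c` exists. By uniqueness it is the one reached
  -- from every other fixed point of the window.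
  obtain ⟨c, hc, hca, hmax, -⟩ := hex _ rfl hf
  refine ⟨fixedPoint c hc, isTorusFixed_fixedPoint c hc, subset_antisymm ?_ fun q hq => ?_⟩
  · refine schubertSet_subset_inWindow ?_
    rw [lattice_fixedPoint]
    exact inWindow_coordLattice_iff.2 hca
  · obtain ⟨g, hg, c₁, hc₁, rfl, hca₁⟩ := exists_eq_smul_fixedPoint hm hq
    obtain ⟨c₂, hc₂, hca₂, hmax₂, h⟩ := hex c₁ hc₁ hca₁
    obtain rfl : c₂ = c :=
      funext (maximal_coordLattice_le (hc₂.trans hc.symm) hca₂ hca hmax₂ hmax)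
    exact smul_mem_schubertSet hm h hg

end Closure

/-! ## Shift-stable subspaces -/

section Shift

variable {m : ℕ}

/-- The nilpotent operator with `m` Jordan blocks of size `N`. -/
def shift (m N : ℕ) : (Fin m × Fin N → ℂ) →ₗ[ℂ] (Fin m × Fin N → ℂ) where
  toFun u x := if (x.2 : ℕ) = 0 then 0 else u (x.1, ⟨x.2 - 1, by omega⟩)
  map_add' u v := by
    funext x
    dsimp only [Pi.add_apply]
    split_ifs <;> simp
  map_smul' a u := by
    funext x
    dsimp only [Pi.smul_apply, RingHom.id_apply]
    split_ifs <;> simp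

theorem shift_apply {N : ℕ} (u : Fin m × Fin N → ℂ) (x : Fin m × Fin N) :
    shift m N u x = if (x.2 : ℕ) = 0 then 0 else u (x.1, ⟨x.2 - 1, by omega⟩) := rfl

theorem win_T_mul {a : ℤ} {N : ℕ} {v : LoopSpace m} (hv : v ∈ stdLattice m a) :
    win m a N (fun i => LaurentPolynomial.T 1 * v i) = shift m N (win m a N v) := by
  funext x
  rw [shift_apply, win_apply, coeff_T_mul]
  split_ifs with h
  · exact mem_stdLattice.1 hv _ _ (by omega)
  · rw [win_apply]
    congr 1
    dsimp only
    omega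

/-- The `k`-dimensional subspaces which are stable under `shift`. -/
def ShiftGrassmannian (m N k : ℕ) : Type :=
  {U : Submodule ℂ (Fin m × Fin N → ℂ) // Module.finrank ℂ U = k ∧ ∀ u ∈ U, shift m N u ∈ U}

/-- The variety of the `k`-dimensional subspaces which are stable under `shift`. -/
def shiftGrassmannian (m N k : ℕ) : SpaceWithFunctions (ShiftGrassmannian m N k) :=
  (grassmannian (Fin m × Fin N → ℂ)).induced Subtype.val

theorem isAffineSchubert_shiftGrassmannian {m N k : ℕ} (hm : 0 < m) (hk : k ≤ m * N) :
    IsAffineSchubert m (k % m) (shiftGrassmannian m N k) := by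
  have hbm : k % m < m := Nat.mod_lt _ hm
  have hkq : m * (k / m) + k % m = k := Nat.div_add_mod k m
  generalize k % m = b at hbm hkq ⊢
  generalize k / m = q at hkq
  have hqN : q ≤ N := by
    by_contra h
    have : m * (N + 1) ≤ m * q := Nat.mul_le_mul_left m (by omega)
    have e : m * (N + 1) = m * N + m := by ring
    omega
  -- For `b > 0` the lattice `L_b` contains vectors with `t⁻¹`, so the window has to start at a
  -- negative exponent.
  have hqN' : 0 < b → q < N := by
    intro h0
    by_contra h
    have : m * N ≤ m * q := Nat.mul_le_mul_left m (by omega)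
    omega
  -- The window ends at `t^q`, and `L_b` modulo `t^q` has dimension `m q + b = k`.
  let a : ℤ := q - N
  have haN : a + N = q := by simp [a]
  have hf : ∀ i, a ≤ fundExp m b i ∧ fundExp m b i ≤ a + N := by
    intro i
    unfold fundExp
    split_ifs with h
    · have := hqN' (by omega)
      omega
    · omega
  have hdim : ∑ i, (a + N - fundExp m b i) = k := by
    rw [Finset.sum_sub_distrib, sum_fundExp hbm.le, haN, ← hkq]
    simp
  obtain ⟨p, hp, hpS⟩ := exists_schubertSet_eq (b := b) hm hf
  refine ⟨p, hp, ?_⟩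
  have hw : ∀ y : schubertSet p, InWindow a N y.1.lattice := fun y =>
    (Set.ext_iff.1 hpS y.1).1 y.2
  have hfr : ∀ y : schubertSet p, Module.finrank ℂ (y.1.lattice.map (win m a N)) = k := fun y => by
    rw [finrank_map_win_lattice hm (hw y), hdim, Int.toNat_natCast]
  let F : schubertSet p → ShiftGrassmannian m N k := fun y =>
    ⟨y.1.lattice.map (win m a N), hfr y, by
      rintro _ ⟨v, hv, rfl⟩
      exact ⟨_, lattice_tStable y.1 v hv, win_T_mul ((hw y).2 hv)⟩⟩
  have hF : Function.Bijective F := by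
    constructor
    · intro y z hyz
      exact Subtype.ext (lattice_injective
        ((hw y).eq_of_map_win_eq (hw z) (congrArg Subtype.val hyz)))
    · rintro ⟨U, hU, hUs⟩
      have hL := latticeOf_inWindow a N U
      have hT : TStable (latticeOf a N U) := by
        intro v hv
        refine ⟨fun i l hl => ?_, ?_⟩
        · rw [coeff_T_mul]
          exact hv.1 i _ (lt_trans (by omega) hl)
        · change win m a N _ ∈ U
          rw [win_T_mul hv.1]
          exact hUs _ hv.2
      obtain ⟨g, hg, c, hgc, hca⟩ := exists_eq_smul_of_lattice hm hT hL
      -- The dimension `k` of `U` determines the sum of the exponents, so this lattice belongs to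
      -- the flag variety for `P_b`.
      have hc : ∑ i, c i = ∑ i, fundExp m b i := by
        have h1 := finrank_map_win_coordLattice hca
        rw [← finrank_map_win_translate hg (inWindow_coordLattice_iff.2 hca).2, ← hgc,
          map_win_latticeOf, hU, ← hdim, Finset.sum_sub_distrib, Finset.sum_sub_distrib] at h1
        omega
      have hlat : (g • fixedPoint c hc : FlagVariety m b).lattice = latticeOf a N U := by
        rw [lattice_smul, lattice_fixedPoint, hgc]
      refine ⟨⟨g • fixedPoint c hc, ?_⟩, Subtype.ext ?_⟩
      · rw [hpS]
        change InWindow a N _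
        rwa [hlat]
      · change Submodule.map _ (g • fixedPoint c hc : FlagVariety m b).lattice = U
        rw [hlat, map_win_latticeOf]
  let e := (Equiv.ofBijective F hF).symm
  have h1 : PluckerEquiv k k (fun U : ShiftGrassmannian m N k => U.1)
      ((fun y : schubertSet p => y.1.lattice.map (win m a N)) ∘ e) := by
    refine PluckerEquiv.map (fun U => U.2.1) LinearMap.id LinearMap.id (fun _ => rfl) fun U => ?_
    rw [Submodule.map_id]
    exact congrArg Subtype.val ((Equiv.ofBijective F hF).apply_symm_apply U)
  obtain ⟨e1⟩ := h1.spaceIso e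
  obtain ⟨e2⟩ := nonempty_spaceIso_flagStructure hm (Subtype.val : schubertSet p → _) hw
  exact e1.trans e2

theorem IsAffineSchubert.of_spaceIso {m b : ℕ} {X Y : Type*} {S : SpaceWithFunctions X}
    {S' : SpaceWithFunctions Y} (h : IsAffineSchubert m b S') (e : Nonempty (SpaceIso S S')) :
    IsAffineSchubert m b S := by
  obtain ⟨p, hp, ⟨e'⟩⟩ := h
  obtain ⟨e⟩ := e
  exact ⟨p, hp, e.trans e'⟩

/-- A family of subspaces which a linear isomorphism identifies with the shift-stable ones. -/
theorem nonempty_spaceIso_shiftGrassmannian {Y M : Type*} [AddCommGroup M] [Module ℂ M]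
    [FiniteDimensional ℂ M] {N k : ℕ} (i : Y → Submodule ℂ M) (hi : Function.Injective i)
    (φ : M ≃ₗ[ℂ] (Fin m × Fin N → ℂ)) (hk : ∀ y, Module.finrank ℂ (i y) = k)
    (hs : ∀ y, ∀ u ∈ i y, φ.symm (shift m N (φ u)) ∈ i y)
    (hsurj : ∀ V : Submodule ℂ M, Module.finrank ℂ V = k →
      (∀ u ∈ V, φ.symm (shift m N (φ u)) ∈ V) → ∃ y, i y = V) :
    Nonempty (SpaceIso ((grassmannian M).induced i) (shiftGrassmannian m N k)) := by
  let F : Y → ShiftGrassmannian m N k := fun y =>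
    ⟨(i y).map (φ : M →ₗ[ℂ] (Fin m × Fin N → ℂ)), by rw [LinearEquiv.finrank_map_eq, hk], by
      rintro _ ⟨u, hu, rfl⟩
      exact ⟨_, hs y u hu, φ.apply_symm_apply _⟩⟩
  have hF : Function.Bijective F := by
    constructor
    · intro y z hyz
      exact hi (Submodule.map_injective_of_injective φ.injective (congrArg Subtype.val hyz))
    · rintro ⟨U, hU, hUs⟩
      obtain ⟨y, hy⟩ := hsurj (U.map (φ.symm : (Fin m × Fin N → ℂ) →ₗ[ℂ] M))
        (by rw [LinearEquiv.finrank_map_eq, hU]) (by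
          rintro _ ⟨u, hu, rfl⟩
          exact ⟨_, hUs u hu, by simp⟩)
      refine ⟨y, Subtype.ext ?_⟩
      change (i y).map (φ : M →ₗ[ℂ] (Fin m × Fin N → ℂ)) = U
      rw [hy, ← Submodule.map_comp]
      convert Submodule.map_id U
      ext1 u
      simp
  refine PluckerEquiv.spaceIso (k := k) (k' := k) (Equiv.ofBijective F hF) ?_
  exact PluckerEquiv.map hk φ φ.symm (fun u => φ.symm_apply_apply u) fun y => rfl

end Shift

/-! ## Quiver Grassmannians -/

section Quiver

variable {m N : ℕ}

/-- The coefficients of an element of `ℂ[t]/(t^N)`. -/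
def truncCoeff (N : ℕ) : TruncPoly N →ₗ[ℂ] (Fin N → ℂ) :=
  LinearMap.pi (fun l : Fin N => Polynomial.lcoeff ℂ l) ∘ₗ
    AdjoinRoot.modByMonicHom (Polynomial.monic_X_pow (R := ℂ) N)

theorem truncCoeff_mk (p : ℂ[X]) (l : Fin N) :
    truncCoeff N (AdjoinRoot.mk _ p) l = p.coeff l := by
  change (AdjoinRoot.modByMonicHom (Polynomial.monic_X_pow (R := ℂ) N)
    (AdjoinRoot.mk _ p)).coeff l = _
  rw [AdjoinRoot.modByMonicHom_mk]
  conv_rhs => rw [← Polynomial.modByMonic_add_div p (Polynomial.X ^ N)]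
  rw [Polynomial.coeff_add, Polynomial.coeff_X_pow_mul', if_neg (by omega), add_zero]

theorem truncCoeff_bijective (N : ℕ) : Function.Bijective (truncCoeff N) := by
  constructor
  · rw [injective_iff_map_eq_zero]
    intro x hx
    obtain ⟨p, rfl⟩ := AdjoinRoot.mk_surjective x
    rw [AdjoinRoot.mk_eq_zero, Polynomial.X_pow_dvd_iff]
    intro d hd
    rw [← truncCoeff_mk p ⟨d, hd⟩, hx]
    rfl
  · intro y
    refine ⟨AdjoinRoot.mk _ (∑ j : Fin N, Polynomial.monomial j (y j)), ?_⟩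
    funext l
    rw [truncCoeff_mk, Polynomial.finsetSum_coeff, Finset.sum_eq_single l]
    · simp
    · intro j _ hj
      rw [Polynomial.coeff_monomial, if_neg]
      exact fun h => hj (Fin.ext h)
    · simp

theorem truncCoeff_root_mul (x : TruncPoly N) (l : Fin N) :
    truncCoeff N (AdjoinRoot.root _ * x) l =
      if (l : ℕ) = 0 then 0 else truncCoeff N x ⟨l - 1, by omega⟩ := by
  obtain ⟨p, rfl⟩ := AdjoinRoot.mk_surjective x
  rw [← AdjoinRoot.mk_X, ← map_mul, truncCoeff_mk]
  split_ifs with h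
  · rw [h, Polynomial.coeff_X_mul_zero]
  · rw [truncCoeff_mk]
    obtain ⟨n, hn⟩ := Nat.exists_eq_succ_of_ne_zero h
    simp only [hn, Nat.succ_eq_add_one, Polynomial.coeff_X_mul, Nat.add_sub_cancel]

/-- The coordinates on `ℂ^m ⊗ A_N`. -/
def truncEquiv (m N : ℕ) : (Fin m → TruncPoly N) ≃ₗ[ℂ] (Fin m × Fin N → ℂ) :=
  (LinearEquiv.piCongrRight fun _ : Fin m =>
    LinearEquiv.ofBijective (truncCoeff N) (truncCoeff_bijective N)).trans
    (LinearEquiv.curry ℂ ℂ (Fin m) (Fin N)).symm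

theorem truncEquiv_apply (u : Fin m → TruncPoly N) (x : Fin m × Fin N) :
    truncEquiv m N u x = truncCoeff N (u x.1) x.2 := rfl

theorem truncEquiv_root_smul (u : Fin m → TruncPoly N) :
    truncEquiv m N ((AdjoinRoot.root (Polynomial.X ^ N : ℂ[X]) : TruncPoly N) • u) =
      shift m N (truncEquiv m N u) := by
  funext x
  rw [truncEquiv_apply, shift_apply, truncEquiv_apply, Pi.smul_apply, smul_eq_mul,
    truncCoeff_root_mul]

theorem symm_shift_truncEquiv (u : Fin m → TruncPoly N) :
    (truncEquiv m N).symm (shift m N (truncEquiv m N u)) =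
      (AdjoinRoot.root (Polynomial.X ^ N : ℂ[X]) : TruncPoly N) • u := by
  rw [← truncEquiv_root_smul, LinearEquiv.symm_apply_apply]

theorem smul_mem_of_root_smul_mem {V : Submodule ℂ (Fin m → TruncPoly N)}
    (hV : ∀ u ∈ V, (AdjoinRoot.root (Polynomial.X ^ N : ℂ[X]) : TruncPoly N) • u ∈ V)
    (x : TruncPoly N) {u : Fin m → TruncPoly N} (hu : u ∈ V) : x • u ∈ V := by
  obtain ⟨p, rfl⟩ := AdjoinRoot.mk_surjective x
  induction p using Polynomial.induction_on with
  | C a =>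
    have : (AdjoinRoot.mk (Polynomial.X ^ N : ℂ[X]) (Polynomial.C a) : TruncPoly N) • u = a • u := by
      rw [AdjoinRoot.mk_C, ← AdjoinRoot.algebraMap_eq, algebraMap_smul]
    rw [this]
    exact V.smul_mem a hu
  | add p q hp hq =>
    rw [map_add, add_smul]
    exact V.add_mem hp hq
  | monomial n a h =>
    rw [pow_succ, ← mul_assoc, mul_comm, map_mul, mul_smul, AdjoinRoot.mk_X]
    exact hV _ h

theorem nonempty_spaceIso_quiverGrassmannian (m N k : ℕ) :
    Nonempty (SpaceIso (quiverGrassmannian m N k) (shiftGrassmannian m N k)) := by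
  refine nonempty_spaceIso_shiftGrassmannian
    (fun U : QuiverGrassmannian m N k => U.1.restrictScalars ℂ) (fun U U' h => ?_)
    (truncEquiv m N) (fun U => U.2) (fun U u hu => ?_) fun V hV hVs => ?_
  · exact Subtype.ext (Submodule.restrictScalars_injective ℂ _ _ h)
  · rw [symm_shift_truncEquiv]
    exact U.1.smul_mem _ hu
  · simp only [symm_shift_truncEquiv] at hVs
    exact ⟨⟨{ V with smul_mem' := fun x u hu => smul_mem_of_root_smul_mem hVs x hu }, hV⟩, rfl⟩

end Quiver

/-! ## Degenerate affine Grassmannians -/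

section Degenerate

variable {n : ℕ}

theorem finrank_quotient_stdLattice {a : ℤ} {N r : ℕ} (hr : a + N = r)
    {U : Submodule ℂ (LoopSpace n)} (hU : U ≤ stdLattice n a) :
    FiniteDimensional ℂ (U ⧸ (stdLattice n r).submoduleOf U) ∧
      Module.finrank ℂ (U ⧸ (stdLattice n r).submoduleOf U) =
        Module.finrank ℂ (U.map (win n a N)) := by
  have hker : LinearMap.ker ((win n a N).domRestrict U) = (stdLattice n r).submoduleOf U := by
    ext v
    rw [LinearMap.mem_ker, ← hr]
    exact ⟨fun h => mem_of_win_eq_zero (hU v.2) h, fun h => win_eq_zero h⟩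
  have e := ((win n a N).domRestrict U).quotKerEquivRange
  rw [hker] at e
  refine ⟨e.symm.finiteDimensional, ?_⟩
  rw [e.finrank_eq, LinearMap.range_domRestrict]

theorem card_window_tail {a : ℤ} {N N' : ℕ} (h : N ≤ N') :
    (Finset.univ.filter fun x : Fin n × Fin N' => a + N ≤ a + x.2).card = n * (N' - N) := by
  have hc : ∀ i : Fin n, a ≤ a + N ∧ a + N ≤ a + N' := fun _ => ⟨by omega, by omega⟩
  have h1 := finrank_map_win_coordLattice (c := fun _ : Fin n => a + N) hc
  rw [map_win_coordLattice hc, finrank_coordSpace] at h1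
  simp only [Finset.sum_const, Finset.card_univ, Fintype.card_fin, nsmul_eq_mul] at h1
  zify [h]
  rw [h1]
  ring

theorem finrank_map_win_add {a : ℤ} {N N' : ℕ} {U : Submodule ℂ (LoopSpace n)}
    (hU : InWindow a N U) (h : N ≤ N') :
    Module.finrank ℂ (U.map (win n a N')) =
      Module.finrank ℂ (U.map (win n a N)) + n * (N' - N) := by
  have h1 := pluckerEquiv_win_of_subset (ℓ := fun _ : Unit => U) (N' := N') le_rfl (by omega)
    (fun _ => hU) fun _ => rfl
  rw [← card_window_tail h]
  exact h1.1.finrank_eq_right ()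

/-- The condition does not depend on `r`: enlarging a window by one power of `t` contained in `U`
adds `n` to both sides. The exponents `r` and `N` are compared in the window ending at `max r N`. -/
theorem mem_satoGrassmannian_iff {N : ℕ} {U : Submodule ℂ (LoopSpace n)}
    (hU : InWindow (-N) (2 * N) U) :
    U ∈ satoGrassmannian n ↔ Module.finrank ℂ (U.map (win n (-N) (2 * N))) = N * n := by
  constructor
  · rintro ⟨r, hr, -, h⟩
    rw [(finrank_quotient_stdLattice (a := -N) (N := N + r) (by push_cast; ring) hU.2).2] at h
    have h1 := finrank_map_win_add (N' := N + max r N) hU (by omega)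
    have h2 := finrank_map_win_add (N' := N + max r N) (N := N + r) (a := -N) (U := U)
      ⟨by rwa [show (-N : ℤ) + (N + r : ℕ) = r by push_cast; ring], hU.2⟩ (by omega)
    rw [h1, h] at h2
    rcases le_total r N with hrN | hrN
    · rw [max_eq_right hrN, show N + N - 2 * N = 0 by omega, show N + N - (N + r) = N - r by omega,
        mul_zero, add_zero, ← mul_add, Nat.add_sub_cancel' hrN, mul_comm n N] at h2
      exact h2
    · rw [max_eq_left hrN, show N + r - 2 * N = r - N by omega, Nat.sub_self, mul_zero,
        add_zero] at h2
      have h3 : n * r = n * N + n * (r - N) := by rw [← mul_add, Nat.add_sub_cancel' hrN]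
      rw [h3] at h2
      rw [mul_comm N n]
      omega
  · intro h
    obtain ⟨h1, h2⟩ := finrank_quotient_stdLattice (a := -N) (N := 2 * N) (r := N)
      (by push_cast; ring) hU.2
    refine ⟨N, ?_, h1, by rw [h2, h, mul_comm]⟩
    have := hU.1
    rwa [show (-N : ℤ) + (2 * N : ℕ) = N by push_cast; ring] at this

/-- The splitting of the window `-N ≤ l < N` into its negative and its nonnegative part. -/
def splitIndex (n N : ℕ) : Fin (2 * n) × Fin N ≃ Fin n × Fin (2 * N) :=
  ((finProdFinEquiv.symm.trans (Equiv.prodComm _ _)).prodCongr (Equiv.refl _)).trans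
    ((Equiv.prodAssoc _ _ _).trans ((Equiv.refl _).prodCongr finProdFinEquiv))

/-- A block occupies the exponents from `-N` to `-1` or from `0` to `N - 1` of one coordinate, and a
step inside a block is a step of the exponent. -/
theorem splitIndex_snd (N : ℕ) (j : Fin (2 * n)) (l : Fin N) :
    (((splitIndex n N (j, l)).2 : ℕ) = l ∨ ((splitIndex n N (j, l)).2 : ℕ) = l + N) ∧
      ∀ l' : Fin N, (splitIndex n N (j, l')).1 = (splitIndex n N (j, l)).1 ∧
        ((splitIndex n N (j, l')).2 : ℕ) + l = (splitIndex n N (j, l)).2 + l' := by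
  have h : ∀ l : Fin N, ((splitIndex n N (j, l)).2 : ℕ) =
      l + N * (finProdFinEquiv.symm j).1 := fun l => rfl
  refine ⟨?_, fun l' => ⟨rfl, ?_⟩⟩
  · rw [h]
    have h2 := (finProdFinEquiv.symm j).1.2
    interval_cases ((finProdFinEquiv.symm j).1 : ℕ)
    · left; simp
    · right; simp
  · rw [h, h]
    omega

/-- The coordinates in which `pr ∘ t` is the shift operator. -/
def splitEquiv (n N : ℕ) : (Fin n × Fin (2 * N) → ℂ) ≃ₗ[ℂ] (Fin (2 * n) × Fin N → ℂ) :=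
  LinearEquiv.funCongrLeft ℂ ℂ (splitIndex n N)

theorem splitEquiv_apply {N : ℕ} (u : Fin n × Fin (2 * N) → ℂ) (x : Fin (2 * n) × Fin N) :
    splitEquiv n N u x = u (splitIndex n N x) := rfl

theorem splitEquiv_win_prConst {N : ℕ} {v : LoopSpace n} (hv : v ∈ stdLattice n (-N)) :
    splitEquiv n N (win n (-N) (2 * N) (prConst fun i => LaurentPolynomial.T 1 * v i)) =
      shift (2 * n) N (splitEquiv n N (win n (-N) (2 * N) v)) := by
  funext ⟨j, l⟩
  rw [shift_apply, splitEquiv_apply, splitEquiv_apply]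
  dsimp only
  obtain ⟨h1, h2⟩ := splitIndex_snd N j l
  have h3 : ∀ y : ℤ, (prConst (fun i => LaurentPolynomial.T 1 * v i)
      (splitIndex n N (j, l)).1).coeff y =
      if y = 0 then 0 else (v (splitIndex n N (j, l)).1).coeff (y - 1) := by
    intro y
    change (LaurentPolynomial.T 1 * v _ - LaurentPolynomial.C
      ((LaurentPolynomial.T 1 * v _).coeff 0)).coeff y = _
    rw [AddMonoidAlgebra.coeff_sub, Finsupp.sub_apply, LaurentPolynomial.C_apply, coeff_T_mul,
      coeff_T_mul]
    split_ifs with hy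
    · rw [hy, sub_self]
    · rw [sub_zero]
  rw [win_apply, h3]
  by_cases hl : (l : ℕ) = 0
  -- A block starts at exponent `0`, where `pr` removes what `t` brings in, or at `-N`, where
  -- nothing comes in.
  · rw [if_pos hl]
    split_ifs with hy
    · rfl
    · exact mem_stdLattice.1 hv _ _ (by omega)
  · obtain ⟨h4, h5⟩ := h2 ⟨l - 1, by omega⟩
    dsimp only at h5
    rw [if_neg hl, if_neg (by omega), win_apply, h4]
    congr 1
    omega

theorem prConst_T_mul_mem {N : ℕ} {v : LoopSpace n} (hv : v ∈ stdLattice n (-N)) :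
    prConst (fun i => LaurentPolynomial.T 1 * v i) ∈ stdLattice n (-N) := by
  refine mem_stdLattice.2 fun i l hl => ?_
  change (LaurentPolynomial.T 1 * v i - LaurentPolynomial.C
    ((LaurentPolynomial.T 1 * v i).coeff 0)).coeff l = 0
  rw [AddMonoidAlgebra.coeff_sub, Finsupp.sub_apply, LaurentPolynomial.C_apply, coeff_T_mul,
    if_neg (by omega), sub_zero]
  exact mem_stdLattice.1 hv i _ (by omega)

theorem symm_shift_splitEquiv {N : ℕ} {v : LoopSpace n} (hv : v ∈ stdLattice n (-N)) :
    (splitEquiv n N).symm (shift (2 * n) N (splitEquiv n N (win n (-N) (2 * N) v))) =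
      win n (-N) (2 * N) (prConst fun i => LaurentPolynomial.T 1 * v i) := by
  rw [← splitEquiv_win_prConst hv, LinearEquiv.symm_apply_apply]

theorem nonempty_spaceIso_degGrassmannian (n N : ℕ) :
    Nonempty (SpaceIso (degGrassmannian n N) (shiftGrassmannian (2 * n) N (N * n))) := by
  have hwin : ∀ U : Submodule ℂ (LoopSpace n),
      (stdLattice n N ≤ U ∧ U ≤ stdLattice n (-N)) ↔ InWindow (-N) (2 * N) U := by
    intro U
    unfold InWindow
    rw [show (-N : ℤ) + (2 * N : ℕ) = N by push_cast; ring]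
  refine nonempty_spaceIso_shiftGrassmannian
    (fun U : DegGrassmannian n N => U.1.map (window n N)) (fun U U' h => ?_)
    (splitEquiv n N) (fun U => ?_) (fun U u hu => ?_) fun V hV hVs => ?_
  · dsimp only at h
    rw [map_window_eq, map_window_eq] at h
    exact Subtype.ext (((hwin _).1 U.2.2).eq_of_map_win_eq ((hwin _).1 U'.2.2) h)
  · rw [map_window_eq]
    exact (mem_satoGrassmannian_iff ((hwin _).1 U.2.2)).1 U.2.1.1
  · rw [map_window_eq] at hu ⊢
    obtain ⟨v, hv, rfl⟩ := hu
    rw [symm_shift_splitEquiv (U.2.2.2 hv)]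
    exact ⟨_, U.2.1.2 v hv, rfl⟩
  · have hL := latticeOf_inWindow (-N) (2 * N) V
    have hLV := map_win_latticeOf (-N) (2 * N) V
    refine ⟨⟨latticeOf (-N) (2 * N) V, ⟨(mem_satoGrassmannian_iff hL).2 (by rw [hLV, hV]),
      fun u hu => ⟨prConst_T_mul_mem hu.1, ?_⟩⟩, (hwin _).2 hL⟩, ?_⟩
    · change win n (-N) (2 * N) _ ∈ V
      rw [← symm_shift_splitEquiv hu.1]
      exact hVs _ hu.2
    · change Submodule.map (window n N) _ = V
      rw [map_window_eq, hLV]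

end Degenerate

end

end AffineSchubert

/-! ### Both families as Schubert varieties -/

theorem proposition3 :
    (∀ m N k : ℕ, 1 ≤ m → k ≤ m * N →
      AffineSchubert.IsAffineSchubert m (k % m) (AffineSchubert.quiverGrassmannian m N k)) ∧
    (∀ n N : ℕ, 1 ≤ n →
      AffineSchubert.IsAffineSchubert (2 * n) (N * n % (2 * n))
        (AffineSchubert.degGrassmannian n N)) := by
  refine ⟨fun m N k hm hk => ?_, fun n N hn => ?_⟩
  · exact (AffineSchubert.isAffineSchubert_shiftGrassmannian hm hk).of_spaceIso
      (AffineSchubert.nonempty_spaceIso_quiverGrassmannian m N k)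
  · refine (AffineSchubert.isAffineSchubert_shiftGrassmannian (by omega) ?_).of_spaceIso
      (AffineSchubert.nonempty_spaceIso_degGrassmannian n N)
    rw [mul_comm N n, mul_assoc]
    omega
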